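/- Let $d\ge 1$, $k\in\mathbb{N}=\{0,1,2,\dots\}$, $\lambda\in\mathbb{C}$, $F(u)=\lambda|u|^{2k}u$, $1\le p,q\le\infty$, $1/q+1/q'=1$, $s\ge 0$, and assume $q'>2kd$; if $d=1$, assume also $q'\ge 2k+1$ (for $d\ge2$ this is automatic). For $\sigma\in\mathbb{R}$ let $\mathcal{M}^{p,q}_\sigma=\mathcal{M}^{p,q}_\sigma(\mathbb{R}^d)$ be the closure of the Schwartz class, in the tempered distributions, with respect to the norm $$\|f\|_{\mathcal{M}^{p,q}_\sigma}=\Big\|\,(1+|\xi|^2)^{\sigma/2}\,\|V_gf(x,\xi)\|_{L^p_x}\Big\|_{L^q_\xi},\qquad V_gf(x,\xi)=\int_{\mathbb{R}^d} e^{-2\pi i\xi\cdot y}f(y)\overline{g(y-x)}\,dy,$$ where $g\ne0$ is any fixed Schwartz function (the integral is read as a distributional pairing). On $\mathcal{M}^{p,q}_s$ the nonlinearity $F$ is understood as the continuous extension from Schwartz functions: $F(u)$ is the distributional limit of $F(\varphi_n)$ for every sequence of Schwartz functions $\varphi_n\to u$ in $\mathcal{M}^{p,q}_s$. Let $K'(t)=\cos(t\sqrt{-\Delta})$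 and $K(t)=\sin(t\sqrt{-\Delta})/\sqrt{-\Delta}$ be the Fourier multipliers with symbols $\cos(2\pi t|\xi|)$ and $\sin(2\pi t|\xi|)/(2\pi|\xi|)$. For every $R\ge0$ there exists $T>0$ such that for every $(u_0,u_1)$ in the ball $B_R$ of center $0$ and radius $R$ in $\mathcal{M}^{p,q}_s\times\mathcal{M}^{p,q}_{s-1}$ there exists a unique $u\in C([0,T];\mathcal{M}^{p,q}_s)$ (in particular, $F(u(\tau))$ is well defined for all $\tau\in[0,T]$) with $$u(t)=K'(t)u_0+K(t)u_1+\int_0^tK(t-\tau)F(u(\tau))\,d\tau,\qquad t\in[0,T],$$ the integral being taken in the tempered distributions. Furthermore, the map $(u_0,u_1)\mapsto u$ from $B_R$ to $C([0,T];\mathcal{M}^{p,q}_s)$ is Lipschitz continuous. -/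

import Mathlib

open MeasureTheory Filter Topology Set
open scoped SchwartzMap ENNReal NNReal

noncomputable section

namespace NLW

/-- The Euclidean space `ℝ^d`. -/
abbrev Space (d : ℕ) : Type := EuclideanSpace ℝ (Fin d)

/-- The oscillation `y ↦ exp (-2πi ξ·y)`. -/
def character {d : ℕ} (ξ y : Space d) : ℂ :=
  Complex.exp ((-(2 * Real.pi * inner ℝ ξ y) : ℝ) * Complex.I)

/-- The Schwartz function `y ↦ exp (-2πi ξ·y) * conj (g (y - x))`, that is, the complex conjugate
of the time-frequency shift `M_ξ T_x g` of the window `g`. -/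
def conjShift {d : ℕ} (g : 𝓢(Space d, ℂ)) (x ξ : Space d) : 𝓢(Space d, ℂ) :=
  SchwartzMap.smulLeftCLM ℂ (character ξ)
    (SchwartzMap.compSubConstCLM ℂ x
      (SchwartzMap.postcompCLM (𝕜 := ℝ) (Complex.conjCLE : ℂ →L[ℝ] ℂ) g))

theorem character_hasTemperateGrowth {d : ℕ} (ξ : Space d) :
    (character ξ).HasTemperateGrowth := by
  have h : Function.HasTemperateGrowth (fun r : ℝ ↦ Complex.exp (r * Complex.I)) := by
    have hd : ∀ n : ℕ, iteratedDeriv n (fun r : ℝ ↦ Complex.exp (r * Complex.I)) =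
        fun r : ℝ ↦ Complex.I ^ n * Complex.exp (r * Complex.I) := by
      intro n
      induction n with
      | zero => simp
      | succ n ih =>
        rw [iteratedDeriv_succ, ih]
        funext r
        have h1 : HasDerivAt (fun r : ℝ ↦ (r : ℂ) * Complex.I) (1 * Complex.I) r :=
          (Complex.ofRealCLM.hasDerivAt (x := r)).mul_const _
        rw [(h1.cexp.const_mul (Complex.I ^ n)).deriv]
        ring
    refine ⟨(Complex.ofRealCLM.contDiff.mul contDiff_const).cexp, fun n ↦ ⟨0, 1, fun r ↦ ?_⟩⟩
    rw [norm_iteratedFDeriv_eq_norm_iteratedDeriv, hd]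
    simp [Complex.norm_exp_ofReal_mul_I]
  have h2 : Function.HasTemperateGrowth (fun y : Space d ↦ -(2 * Real.pi * inner ℝ ξ y)) := by
    fun_prop
  exact h.comp h2

theorem conjShift_apply {d : ℕ} (g : 𝓢(Space d, ℂ)) (x ξ y : Space d) :
    conjShift g x ξ y = character ξ y * (starRingEnd ℂ) (g (y - x)) := by
  simp [conjShift, SchwartzMap.smulLeftCLM_apply_apply (character_hasTemperateGrowth ξ),
    SchwartzMap.compSubConstCLM_apply]

/-- The short-time Fourier transform `V_g f (x, ξ) = ⟨f, M_ξ T_x g⟩` of a tempered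
distribution `f` with window `g`; the bracket is conjugate-linear in the second entry. -/
def stft {d : ℕ} (g : 𝓢(Space d, ℂ)) (f : 𝓢'(Space d, ℂ)) (x ξ : Space d) : ℂ :=
  f (conjShift g x ξ)

/-- The modulation norm `‖ ⟨ξ⟩^s ‖V_g f (x, ξ)‖_{L^p_x} ‖_{L^q_ξ}`, `⟨ξ⟩ = (1 + |ξ|²)^{1/2}`,
with values in `[0, ∞]`. -/
def modNorm {d : ℕ} (g : 𝓢(Space d, ℂ)) (p q : ℝ≥0∞) (s : ℝ) (f : 𝓢'(Space d, ℂ)) : ℝ≥0∞ :=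
  eLpNorm (fun ξ : Space d ↦ ENNReal.ofReal ((1 + ‖ξ‖ ^ 2) ^ (s / 2)) *
    eLpNorm (fun x : Space d ↦ stft g f x ξ) p volume) q volume

/-- A Schwartz function, regarded as a tempered distribution `ψ ↦ ∫ φ ψ`. -/
def ofSchwartz {d : ℕ} (φ : 𝓢(Space d, ℂ)) : 𝓢'(Space d, ℂ) :=
  SchwartzMap.toTemperedDistributionCLM (Space d) ℂ volume φ

theorem ofSchwartz_apply {d : ℕ} (φ ψ : 𝓢(Space d, ℂ)) : ofSchwartz φ ψ = ∫ x, ψ x * φ x := by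
  simp [ofSchwartz]

/-- The modulation space `M^{p,q}_s(ℝ^d)`: the closure of the Schwartz class, within the tempered
distributions, with respect to the modulation norm. -/
def modSpace {d : ℕ} (g : 𝓢(Space d, ℂ)) (p q : ℝ≥0∞) (s : ℝ) : Set 𝓢'(Space d, ℂ) :=
  {f | ∀ ε : ℝ≥0∞, 0 < ε → ∃ φ : 𝓢(Space d, ℂ), modNorm g p q s (f - ofSchwartz φ) < ε}

/-- `K'(t) = cos(t √-Δ)`, the Fourier multiplier with (smooth) symbol `cos(2πt|ξ|)`. -/
def propCos {d : ℕ} (t : ℝ) : 𝓢'(Space d, ℂ) →L[ℂ] 𝓢'(Space d, ℂ) :=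
  TemperedDistribution.fourierMultiplierCLM ℂ
    (fun ξ : Space d ↦ ((Real.cos (2 * Real.pi * t * ‖ξ‖) : ℝ) : ℂ))

/-- `K(t) = sin(t √-Δ) / √-Δ`, the Fourier multiplier with (smooth) symbol
`sin(2πt|ξ|) / (2π|ξ|)`, extended by its limit `t` to `ξ = 0`. -/
def propSin {d : ℕ} (t : ℝ) : 𝓢'(Space d, ℂ) →L[ℂ] 𝓢'(Space d, ℂ) :=
  TemperedDistribution.fourierMultiplierCLM ℂ
    (fun ξ : Space d ↦ ((t * Real.sinc (2 * Real.pi * t * ‖ξ‖) : ℝ) : ℂ))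

theorem propSin_symbol (t r : ℝ) (hr : r ≠ 0) :
    t * Real.sinc (2 * Real.pi * t * r) = Real.sin (2 * Real.pi * t * r) / (2 * Real.pi * r) := by
  have hpi := Real.pi_ne_zero
  rcases eq_or_ne t 0 with rfl | ht
  · simp
  · rw [Real.sinc_of_ne_zero (by positivity)]
    field_simp

/-- `w = λ |u|^{2k} u` for `u ∈ M^{p,q}_s`. The nonlinearity is defined pointwise on Schwartz
functions and by continuous extension on their closure: whenever Schwartz functions `φ_n` converge
to `u` in `M^{p,q}_s`, the functions `λ |φ_n|^{2k} φ_n` converge to `w` as distributions. -/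
def IsPower {d : ℕ} (g : 𝓢(Space d, ℂ)) (p q : ℝ≥0∞) (s : ℝ) (lam : ℂ) (k : ℕ)
    (u w : 𝓢'(Space d, ℂ)) : Prop :=
  u ∈ modSpace g p q s ∧
  ∀ φ : ℕ → 𝓢(Space d, ℂ),
    Tendsto (fun n ↦ modNorm g p q s (u - ofSchwartz (φ n))) atTop (𝓝 0) →
    ∀ ψ : 𝓢(Space d, ℂ),
      Tendsto (fun n ↦ ∫ x, (lam * (‖φ n x‖ : ℂ) ^ (2 * k) * φ n x) * ψ x) atTop (𝓝 (w ψ))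

/-- `u ∈ C([0,T]; M^{p,q}_s)`. -/
def IsModCurve {d : ℕ} (g : 𝓢(Space d, ℂ)) (p q : ℝ≥0∞) (s T : ℝ)
    (u : ℝ → 𝓢'(Space d, ℂ)) : Prop :=
  (∀ t ∈ Icc 0 T, u t ∈ modSpace g p q s) ∧
  ∀ t ∈ Icc 0 T, Tendsto (fun τ ↦ modNorm g p q s (u τ - u t)) (𝓝[Icc 0 T] t) (𝓝 0)

/-- `u ∈ C([0,T]; M^{p,q}_s)` solves, for all `t ∈ [0,T]`,
`u(t) = K'(t) u₀ + K(t) u₁ + ∫₀ᵗ K(t - τ) F(u(τ)) dτ` with `F(u) = λ |u|^{2k} u`.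
The integral is that of a function with values in the tempered distributions. -/
def IsSolution {d : ℕ} (g : 𝓢(Space d, ℂ)) (p q : ℝ≥0∞) (s : ℝ) (lam : ℂ) (k : ℕ) (T : ℝ)
    (u₀ u₁ : 𝓢'(Space d, ℂ)) (u : ℝ → 𝓢'(Space d, ℂ)) : Prop :=
  IsModCurve g p q s T u ∧
  ∃ w : ℝ → 𝓢'(Space d, ℂ), (∀ t ∈ Icc 0 T, IsPower g p q s lam k (u t) (w t)) ∧
    ∀ t ∈ Icc 0 T, ∀ ψ : 𝓢(Space d, ℂ),
      IntervalIntegrable (fun τ ↦ propSin (t - τ) (w τ) ψ) volume 0 t ∧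
      u t ψ = propCos t u₀ ψ + propSin t u₁ ψ + ∫ τ in (0 : ℝ)..t, propSin (t - τ) (w τ) ψ

/-- The closed ball of center `0` and radius `R` in `M^{p,q}_s × M^{p,q}_{s-1}`. -/
def dataBall {d : ℕ} (g : 𝓢(Space d, ℂ)) (p q : ℝ≥0∞) (s : ℝ) (R : ℝ≥0) :
    Set (𝓢'(Space d, ℂ) × 𝓢'(Space d, ℂ)) :=
  {a | a.1 ∈ modSpace g p q s ∧ a.2 ∈ modSpace g p q (s - 1) ∧
    modNorm g p q s a.1 + modNorm g p q (s - 1) a.2 ≤ R}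

end NLW

end

/-! The equation is a semilinear Cauchy problem solved by a contraction in `C([0,T]; M^{p,q}_s)`.
Two facts drive it: the nonlinearity loses exactly one derivative, being locally Lipschitz from
`M^{p,q}_s` to `M^{p,q}_{s-1}` (`exists_modNorm_nonlinS_sub_le`), and `K(t)` gains it back, while
`K'(t)` is bounded on `M^{p,q}_s`, uniformly for `|t| ≤ 1` (`exists_modNorm_propSin_le`,
`exists_modNorm_propCos_le`).

Everything about modulation norms rests on the reproducing formula: a distribution tested against a
time-frequency shift of any Schwartz function is dominated by its short-time Fourier transform
convolved with a rapidly decaying kernel (`exists_enorm_apply_tfShift_le`). Minkowski, Young and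
Peetre then give independence of the window, the embedding `M^{p,q}_s ⊂ M^{∞,q}_s`, control of the
pairing with test functions, and boundedness of Fourier multipliers. For multipliers, the symbol
enters only through its translates by `ξ`, so it suffices that all its derivatives are bounded, or
`O(⟨ξ⟩^{-1})` to gain a derivative. The wave symbols satisfy this because they are `G(|tξ|²)` and
`t·c·G'(|tξ|²)` with `G(r) = cos(2π√r)` entire, and the differential equation of `G` yields the
decay of its derivatives.

For the nonlinearity, the transform of a product with respect to a product window is a convolution
in frequency (`cross_mulS`). Hölder in `x` and Young in `ξ`, with the submultiplicative weight for
`s ≥ 0`, put a product of `2k+1` factors of `M^{p,q}_s` into `M^{p,r}_s` with `1/r = 1 - (2k+1)/q'`;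
this needs `2k+1 ≤ q'`. Since `2k/q' + 1/r = 1/q`, Hölder against `⟨ξ⟩^{-1} ∈ L^{q'/(2k)}` returns
to `L^q` at the cost of one derivative; this needs `q' > 2kd`.

The closure of the Schwartz class becomes a Banach space `ModSp`, on which the nonlinearity extends
from the dense Schwartz functions, and distributional solutions correspond to mild solutions with
Bochner integrals (`ModSp.isSolution_iff_isMild`). Banach's fixed point theorem and Gronwall's
inequality, collected in `exists_wellPosed`, then give existence, unconditional uniqueness and
Lipschitz dependence. -/

noncomputable section

namespace NLW

/-! ### Hölder and Minkowski inequalities for `[0, ∞]`-valued functions. -/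

section LpToolkit

variable {α β : Type*} [MeasurableSpace α] [MeasurableSpace β] {μ : Measure α} {ν : Measure β}

theorem eLpNorm_ennreal {p : ℝ≥0∞} (h0 : p ≠ 0) (ht : p ≠ ∞) (f : α → ℝ≥0∞) :
    eLpNorm f p μ = (∫⁻ x, f x ^ p.toReal ∂μ) ^ (1 / p.toReal) := by
  simp [eLpNorm_eq_lintegral_rpow_enorm_toReal h0 ht]

theorem ae_le_eLpNorm_top (f : α → ℝ≥0∞) : ∀ᵐ x ∂μ, f x ≤ eLpNorm f ∞ μ := by
  simpa using enorm_ae_le_eLpNormEssSup f μ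

theorem eLpNorm_top_le {f : α → ℝ≥0∞} {C : ℝ≥0∞} (h : ∀ᵐ x ∂μ, f x ≤ C) :
    eLpNorm f ∞ μ ≤ C := by
  rw [eLpNorm_exponent_top]
  exact eLpNormEssSup_le_of_ae_enorm_bound (by simpa using h)

theorem eLpNorm_top_le_iff {f : α → ℝ≥0∞} {C : ℝ≥0∞} :
    eLpNorm f ∞ μ ≤ C ↔ ∀ᵐ x ∂μ, f x ≤ C :=
  ⟨fun h ↦ (ae_le_eLpNorm_top f).mono fun _ hx ↦ hx.trans h, eLpNorm_top_le⟩

theorem eLpNorm_mono_ennreal {f g : α → ℝ≥0∞} (p : ℝ≥0∞) (h : ∀ x, f x ≤ g x) :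
    eLpNorm f p μ ≤ eLpNorm g p μ :=
  eLpNorm_mono_enorm (by simpa using h)

theorem eLpNorm_const_mul_ennreal {f : α → ℝ≥0∞} (hf : Measurable f) (c : ℝ≥0∞) {p : ℝ≥0∞}
    (hp : p ≠ 0) : eLpNorm (fun x ↦ c * f x) p μ ≤ c * eLpNorm f p μ := by
  rcases eq_or_ne p ∞ with rfl | ht
  · exact eLpNorm_top_le ((ae_le_eLpNorm_top f).mono fun x hx ↦ by gcongr)
  · have hp' : 0 < p.toReal := ENNReal.toReal_pos hp ht
    rw [eLpNorm_ennreal hp ht, eLpNorm_ennreal hp ht]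
    simp_rw [ENNReal.mul_rpow_of_nonneg _ _ hp'.le]
    rw [lintegral_const_mul _ (hf.pow_const _), ENNReal.mul_rpow_of_nonneg _ _ (by positivity),
      ← ENNReal.rpow_mul, mul_one_div_cancel hp'.ne', ENNReal.rpow_one]

/-- Hölder's inequality for three exponents. -/
theorem eLpNorm_mul_le_ennreal {p q r : ℝ≥0∞} (hr : r ≠ 0) (h : p⁻¹ + q⁻¹ = r⁻¹)
    {f g : α → ℝ≥0∞} (hf : Measurable f) (hg : Measurable g) :
    eLpNorm (fun x ↦ f x * g x) r μ ≤ eLpNorm f p μ * eLpNorm g q μ := by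
  have hri : r⁻¹ ≠ ∞ := by simpa using hr
  have hp : p ≠ 0 := by
    rintro rfl
    simp [eq_comm, hr] at h
  have hq : q ≠ 0 := by
    rintro rfl
    simp [eq_comm, hr] at h
  rcases eq_or_ne p ∞ with rfl | hpt
  · have hqr : q = r := by simpa using h
    subst hqr
    calc eLpNorm (fun x ↦ f x * g x) q μ ≤ eLpNorm (fun x ↦ eLpNorm f ∞ μ * g x) q μ := by
          apply eLpNorm_mono_enorm_ae
          filter_upwards [ae_le_eLpNorm_top f] with x hx
          simp only [enorm_eq_self]
          gcongr
      _ ≤ _ := eLpNorm_const_mul_ennreal hg _ hr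
  rcases eq_or_ne q ∞ with rfl | hqt
  · have hpr : p = r := by simpa using h
    subst hpr
    calc eLpNorm (fun x ↦ f x * g x) p μ ≤ eLpNorm (fun x ↦ eLpNorm g ∞ μ * f x) p μ := by
          apply eLpNorm_mono_enorm_ae
          filter_upwards [ae_le_eLpNorm_top g] with x hx
          simp only [enorm_eq_self]
          rw [mul_comm]
          gcongr
      _ ≤ _ := (eLpNorm_const_mul_ennreal hf _ hr).trans_eq (mul_comm _ _)
  have hrt : r ≠ ∞ := by
    rintro rfl
    simp [hpt] at h
  rw [eLpNorm_ennreal hp hpt, eLpNorm_ennreal hq hqt, eLpNorm_ennreal hr hrt]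
  have hp0 := ENNReal.toReal_pos hp hpt
  have hq0 := ENNReal.toReal_pos hq hqt
  have hr0 := ENNReal.toReal_pos hr hrt
  have h' : 1 / r.toReal = 1 / p.toReal + 1 / q.toReal := by
    have := congrArg ENNReal.toReal h
    rw [ENNReal.toReal_add (by simpa using hp) (by simpa using hq)] at this
    simpa [ENNReal.toReal_inv] using this.symm
  refine ENNReal.lintegral_Lp_mul_le_Lq_mul_Lr hr0 ?_ h' μ hf.aemeasurable hg.aemeasurable
  have : 0 < 1 / q.toReal := by positivity
  exact lt_of_one_div_lt_one_div hp0 (by linarith)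

/-- Hölder's inequality. -/
theorem lintegral_mul_le_eLpNorm {p q : ℝ≥0∞} (h : p⁻¹ + q⁻¹ = 1)
    {f g : α → ℝ≥0∞} (hf : Measurable f) (hg : Measurable g) :
    ∫⁻ x, f x * g x ∂μ ≤ eLpNorm f p μ * eLpNorm g q μ := by
  have := eLpNorm_mul_le_ennreal (μ := μ) (r := 1) one_ne_zero (by simpa using h) hf hg
  rwa [eLpNorm_ennreal one_ne_zero ENNReal.one_ne_top, ENNReal.toReal_one, div_one,
    ENNReal.rpow_one, lintegral_congr (fun x ↦ ENNReal.rpow_one _)] at this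

/-- For `p = ∞` a sublevel set consists of the points where the section of `{c < F}` is null, so
measurability comes from that of the measure of sections; finite exponents are covered by Tonelli.
-/
theorem measurable_eLpNorm_section [SFinite μ] {F : α → β → ℝ≥0∞}
    (hF : Measurable (Function.uncurry F)) (p : ℝ≥0∞) :
    Measurable fun y ↦ eLpNorm (fun x ↦ F x y) p μ := by
  rcases eq_or_ne p 0 with rfl | hp
  · simp
  rcases eq_or_ne p ∞ with rfl | ht
  · refine measurable_of_Iic fun c ↦ ?_
    have : (fun y ↦ eLpNorm (fun x ↦ F x y) ∞ μ) ⁻¹' Iic c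
        = {y | μ ((fun x ↦ (x, y)) ⁻¹' {z | c < Function.uncurry F z}) = 0} := by
      ext y
      simp only [mem_preimage, mem_Iic, eLpNorm_top_le_iff, mem_ofPred_eq, ae_iff, not_le]
      rfl
    rw [this]
    exact measurable_measure_prodMk_right (measurableSet_lt measurable_const hF)
      (measurableSet_singleton 0)
  · simp_rw [eLpNorm_ennreal hp ht]
    exact ((hF.pow_const _).lintegral_prod_left').pow_const _

/-- Cancellation of `a ^ (1 / Q)`. It fails for `a = ∞`, which is why Minkowski's inequality is
proved for truncations first. -/
theorem rpow_le_of_self_le_mul {a A : ℝ≥0∞} {P Q : ℝ} (hPQ : P.HolderConjugate Q)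
    (ha : a ≠ ∞) (h : a ≤ A * a ^ (1 / Q)) : a ^ (1 / P) ≤ A := by
  rcases eq_or_ne a 0 with rfl | h0
  · simp [hPQ.pos]
  have hne : a ^ (1 / Q) ≠ 0 := by simp [h0, ha]
  have hnt : a ^ (1 / Q) ≠ ∞ := ENNReal.rpow_ne_top_of_nonneg (by simpa using hPQ.symm.nonneg) ha
  rw [← ENNReal.mul_le_mul_iff_left hne hnt, ← ENNReal.rpow_add _ _ h0 ha]
  simpa [hPQ.inv_add_inv_eq_one] using h

/-- Write `h^P = h · h^(P-1)`, bound the first factor by the integral, exchange the integrals, apply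
Hölder for each `y` and cancel. An arbitrary minorant `h` of the integral is allowed so that
truncations with finite norm can be used. -/
theorem minkowski_aux [SigmaFinite μ] [SFinite ν] {F : α → β → ℝ≥0∞}
    (hF : Measurable (Function.uncurry F)) {P Q : ℝ} (hPQ : P.HolderConjugate Q)
    {h : α → ℝ≥0∞} (hh : Measurable h) (hle : ∀ x, h x ≤ ∫⁻ y, F x y ∂ν)
    (hfin : ∫⁻ x, h x ^ P ∂μ ≠ ∞) :
    (∫⁻ x, h x ^ P ∂μ) ^ (1 / P) ≤ ∫⁻ y, (∫⁻ x, F x y ^ P ∂μ) ^ (1 / P) ∂ν := by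
  refine rpow_le_of_self_le_mul hPQ hfin ?_
  have hQ : 0 < Q := hPQ.symm.pos
  calc ∫⁻ x, h x ^ P ∂μ ≤ ∫⁻ x, ∫⁻ y, F x y * h x ^ (P - 1) ∂ν ∂μ := by
        refine lintegral_mono fun x ↦ ?_
        have hFx : Measurable (F x) := hF.comp measurable_prodMk_left
        rw [lintegral_mul_const _ hFx]
        calc h x ^ P = h x ^ (1 + (P - 1)) := by ring_nf
          _ = h x * h x ^ (P - 1) := by
            rw [ENNReal.rpow_add_of_nonneg _ _ zero_le_one hPQ.sub_one_pos.le, ENNReal.rpow_one]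
          _ ≤ _ := by gcongr; exact hle x
    _ = ∫⁻ y, ∫⁻ x, F x y * h x ^ (P - 1) ∂μ ∂ν :=
        lintegral_lintegral_swap
          (hF.mul ((hh.comp measurable_fst).pow_const _)).aemeasurable
    _ ≤ ∫⁻ y, (∫⁻ x, F x y ^ P ∂μ) ^ (1 / P) * (∫⁻ x, h x ^ P ∂μ) ^ (1 / Q) ∂ν :=
        lintegral_mono fun y ↦ ENNReal.lintegral_mul_rpow_le_lintegral_rpow_mul_lintegral_rpow
          hPQ (hF.comp measurable_prodMk_right).aemeasurable hh.aemeasurable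
    _ = _ := lintegral_mul_const _
        (((hF.pow_const P).lintegral_prod_left').pow_const _)

/-- Minkowski's integral inequality. -/
theorem eLpNorm_lintegral_le [SigmaFinite μ] [SFinite ν] {F : α → β → ℝ≥0∞}
    (hF : Measurable (Function.uncurry F)) {p : ℝ≥0∞} (hp : 1 ≤ p) :
    eLpNorm (fun x ↦ ∫⁻ y, F x y ∂ν) p μ ≤ ∫⁻ y, eLpNorm (fun x ↦ F x y) p μ ∂ν := by
  rcases eq_or_ne p ∞ with rfl | ht
  · refine eLpNorm_top_le ?_
    have hM := measurable_eLpNorm_section (μ := μ) hF ∞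
    -- The exceptional null set depends on `y`; passing through the product measure exchanges the
    -- order of the two "almost everywhere".
    have h1 : ∀ᵐ z ∂ν.prod μ, F z.2 z.1 ≤ eLpNorm (fun x ↦ F x z.1) ∞ μ := by
      refine (Measure.ae_prod_iff_ae_ae (measurableSet_le (hF.comp measurable_swap)
        (hM.comp measurable_fst))).2 (.of_forall fun y ↦ ae_le_eLpNorm_top (μ := μ) fun x ↦ F x y)
    have h2 : ∀ᵐ z ∂μ.prod ν, F z.1 z.2 ≤ eLpNorm (fun x ↦ F x z.2) ∞ μ := by
      rw [← Measure.prod_swap] at h1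
      exact ae_of_ae_map measurable_swap.aemeasurable h1
    filter_upwards [Measure.ae_ae_of_ae_prod h2] with x hx
    exact lintegral_mono_ae hx
  rcases hp.eq_or_lt with rfl | hp1
  · simp only [eLpNorm_ennreal one_ne_zero ENNReal.one_ne_top, ENNReal.toReal_one, div_one,
      ENNReal.rpow_one]
    exact (lintegral_lintegral_swap hF.aemeasurable).le
  have hp0 : p ≠ 0 := (zero_lt_one.trans hp1).ne'
  have hP1 : 1 < p.toReal := by
    simpa using (ENNReal.toReal_lt_toReal ENNReal.one_ne_top ht).2 hp1
  have hPQ := Real.HolderConjugate.conjExponent hP1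
  simp_rw [eLpNorm_ennreal hp0 ht]
  have hH : Measurable fun x ↦ ∫⁻ y, F x y ∂ν := hF.lintegral_prod_right'
  set H := fun x ↦ ∫⁻ y, F x y ∂ν with hHdef
  -- Cutting off both the height and the support makes the norm finite; monotone convergence
  -- recovers `H`.
  let h : ℕ → α → ℝ≥0∞ := fun n ↦ (spanningSets μ n).indicator fun x ↦ min (H x) n
  have hmeas : ∀ n, Measurable (h n) := fun n ↦
    (hH.min measurable_const).indicator (measurableSet_spanningSets μ n)
  have hmono : Monotone h := by
    intro m n hmn x
    refine (indicator_le_indicator_of_subset (monotone_spanningSets μ hmn)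
      (fun _ ↦ zero_le) x).trans (indicator_le_indicator ?_)
    exact min_le_min_left _ (by exact_mod_cast hmn)
  have hle : ∀ n x, h n x ≤ H x := fun n x ↦
    (indicator_le_self _ _ x).trans (min_le_left _ _)
  have hsup : ∀ x, ⨆ n, h n x = H x := by
    intro x
    refine le_antisymm (iSup_le fun n ↦ hle n x) ?_
    refine le_of_forall_lt fun c hc ↦ ?_
    obtain ⟨n, hn⟩ := ENNReal.exists_nat_gt (hc.ne_top)
    have hx : x ∈ ⋃ n, spanningSets μ n := by simp [iUnion_spanningSets]
    obtain ⟨m, hm⟩ := mem_iUnion.1 hx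
    refine lt_of_lt_of_le ?_ (le_iSup _ (max m n))
    have hx' : x ∈ spanningSets μ (max m n) := monotone_spanningSets μ (le_max_left _ _) hm
    simp only [h, indicator_of_mem hx', lt_min_iff]
    refine ⟨hc, hn.trans_le ?_⟩
    exact_mod_cast le_max_right m n
  have hfin : ∀ n, ∫⁻ x, h n x ^ p.toReal ∂μ ≠ ∞ := by
    intro n
    have : ∫⁻ x, h n x ^ p.toReal ∂μ ≤
        ∫⁻ x, (spanningSets μ n).indicator (fun _ ↦ (n : ℝ≥0∞) ^ p.toReal) x ∂μ := by
      refine lintegral_mono fun x ↦ ?_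
      by_cases hx : x ∈ spanningSets μ n
      · simp only [h, indicator_of_mem hx]
        gcongr
        exact min_le_right _ _
      · simp [h, hx, hPQ.pos]
    refine (this.trans_lt ?_).ne
    rw [lintegral_indicator_const (measurableSet_spanningSets μ n)]
    exact ENNReal.mul_lt_top (ENNReal.rpow_lt_top_of_nonneg hPQ.nonneg (by simp))
      (measure_spanningSets_lt_top μ n)
  have hlim : ∫⁻ x, H x ^ p.toReal ∂μ = ⨆ n, ∫⁻ x, h n x ^ p.toReal ∂μ := by
    rw [← lintegral_iSup (fun n ↦ (hmeas n).pow_const _)]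
    · refine lintegral_congr fun x ↦ ?_
      rw [← hsup x]
      exact (ENNReal.orderIsoRpow p.toReal hPQ.pos).map_iSup _
    · intro m n hmn x
      exact ENNReal.rpow_le_rpow (hmono hmn x) hPQ.nonneg
  have hpow : (∫⁻ x, H x ^ p.toReal ∂μ) ^ (1 / p.toReal) =
      ⨆ n, (∫⁻ x, h n x ^ p.toReal ∂μ) ^ (1 / p.toReal) := by
    rw [hlim]
    exact (ENNReal.orderIsoRpow (1 / p.toReal) (by simpa using hPQ.pos)).map_iSup _
  rw [hpow]
  exact iSup_le fun n ↦ minkowski_aux hF hPQ (hmeas n) (hle n) (hfin n)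

end LpToolkit

/-! ### Young's convolution inequality. -/

section Young

set_option linter.unusedSectionVars false

variable {G : Type*} [AddCommGroup G] [MeasurableSpace G] [MeasurableAdd₂ G] [MeasurableNeg G]
  {μ : Measure G} [SigmaFinite μ] [μ.IsAddLeftInvariant] [μ.IsNegInvariant]

theorem eLpNorm_comp_sub_left (f : G → ℝ≥0∞) (hf : Measurable f) (p : ℝ≥0∞) (a : G) :
    eLpNorm (fun x ↦ f (a - x)) p μ = eLpNorm f p μ :=
  eLpNorm_comp_measurePreserving hf.aestronglyMeasurable (Measure.measurePreserving_sub_left μ a)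

theorem measurable_uncurry_sub {f g : G → ℝ≥0∞} (hf : Measurable f) (hg : Measurable g) :
    Measurable (Function.uncurry fun x y : G ↦ f y * g (x - y)) := by
  have h1 : Measurable fun z : G × G ↦ z.1 - z.2 := by fun_prop
  exact (hf.comp measurable_snd).mul (hg.comp h1)

/-- Factor `f(y) g(x-y)` as `(f^A g^B)^(1/R) · (f^A)^(1/A-1/R) · (g^B)^(1/B-1/R)`. The three
exponents add up to one, so Hölder applies for fixed `x`; the last two factors integrate to
constants, and the `R`-th power of the first is integrated in `x` by Tonelli. -/
theorem young_aux {f g : G → ℝ≥0∞} (hf : Measurable f) (hg : Measurable g) {A B R : ℝ}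
    (hA : 0 < A) (hB : 0 < B) (hR : 0 < R) (hAR : 1 / R ≤ 1 / A) (hBR : 1 / R ≤ 1 / B)
    (h : 1 / A + 1 / B = 1 + 1 / R) :
    (∫⁻ x, (∫⁻ y, f y * g (x - y) ∂μ) ^ R ∂μ) ^ (1 / R) ≤
      (∫⁻ x, f x ^ A ∂μ) ^ (1 / A) * (∫⁻ x, g x ^ B ∂μ) ^ (1 / B) := by
  set U := ∫⁻ x, f x ^ A ∂μ with hU
  set V := ∫⁻ x, g x ^ B ∂μ with hV
  have hu : Measurable fun y ↦ f y ^ A := hf.pow_const A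
  have hv : Measurable fun y ↦ g y ^ B := hg.pow_const B
  have key : ∀ x, ∫⁻ y, f y * g (x - y) ∂μ ≤
      (∫⁻ y, f y ^ A * g (x - y) ^ B ∂μ) ^ (1 / R) * (U ^ (1 / A - 1 / R) *
        V ^ (1 / B - 1 / R)) := by
    intro x
    have hgx : Measurable fun y ↦ g (x - y) := by fun_prop
    have hVx : ∫⁻ y, g (x - y) ^ B ∂μ = V :=
      lintegral_sub_left_eq_self (fun y ↦ g y ^ B) x
    have := ENNReal.lintegral_mul_prod_norm_pow_le (μ := μ) (Finset.univ : Finset (Fin 2))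
      (g := fun y ↦ f y ^ A * g (x - y) ^ B)
      (f := ![fun y ↦ f y ^ A, fun y ↦ g (x - y) ^ B])
      (hu.mul (hgx.pow_const B)).aemeasurable
      (by
        intro i _
        fin_cases i
        · exact hu.aemeasurable
        · exact (hgx.pow_const B).aemeasurable) (1 / R)
      (p := ![1 / A - 1 / R, 1 / B - 1 / R])
      (by simp [Fin.sum_univ_two]; ring_nf; ring_nf at h; linarith) (by positivity)
      (by
        intro i _
        fin_cases i
        · simpa using hAR
        · simpa using hBR)
    simp only [Fin.prod_univ_two, Matrix.cons_val_zero, Matrix.cons_val_one,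
      hVx] at this
    refine le_trans (lintegral_mono fun y ↦ ?_) this
    rw [ENNReal.mul_rpow_of_nonneg _ _ (by positivity : 0 ≤ 1 / R)]
    simp only [← ENNReal.rpow_mul]
    calc f y * g (x - y) = f y ^ (A * (1 / R) + A * (1 / A - 1 / R)) *
          g (x - y) ^ (B * (1 / R) + B * (1 / B - 1 / R)) := by
          have e1 : A * (1 / R) + A * (1 / A - 1 / R) = 1 := by field_simp; ring
          have e2 : B * (1 / R) + B * (1 / B - 1 / R) = 1 := by field_simp; ring
          rw [e1, e2, ENNReal.rpow_one, ENNReal.rpow_one]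
      _ = _ := by
          have h1 : 0 ≤ 1 / A - 1 / R := by linarith
          have h2 : 0 ≤ 1 / B - 1 / R := by linarith
          rw [ENNReal.rpow_add_of_nonneg _ _ (by positivity) (by positivity),
            ENNReal.rpow_add_of_nonneg _ _ (by positivity) (by positivity)]
          ring
      _ ≤ _ := le_rfl
  have hmeas2 := measurable_uncurry_sub hu hv
  have hUV : ∫⁻ x, ∫⁻ y, f y ^ A * g (x - y) ^ B ∂μ ∂μ = U * V := by
    rw [lintegral_lintegral_swap hmeas2.aemeasurable, hU, ← lintegral_mul_const _ hu]
    refine lintegral_congr fun y ↦ ?_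
    have hgy : Measurable fun x ↦ g (x - y) ^ B := by fun_prop
    rw [lintegral_const_mul _ hgy, lintegral_sub_right_eq_self (fun x ↦ g x ^ B) y]
  have hRA : 1 / R * R = 1 := by field_simp
  calc (∫⁻ x, (∫⁻ y, f y * g (x - y) ∂μ) ^ R ∂μ) ^ (1 / R)
      ≤ (∫⁻ x, (∫⁻ y, f y ^ A * g (x - y) ^ B ∂μ) *
          (U ^ (1 / A - 1 / R) * V ^ (1 / B - 1 / R)) ^ R ∂μ) ^ (1 / R) := by
        gcongr with x
        refine (ENNReal.rpow_le_rpow (key x) hR.le).trans_eq ?_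
        rw [ENNReal.mul_rpow_of_nonneg _ _ hR.le, ← ENNReal.rpow_mul, hRA, ENNReal.rpow_one]
    _ = (U * V) ^ (1 / R) * (U ^ (1 / A - 1 / R) * V ^ (1 / B - 1 / R)) := by
        have hm3 : Measurable fun x ↦ ∫⁻ y, f y ^ A * g (x - y) ^ B ∂μ :=
          hmeas2.lintegral_prod_right'
        rw [lintegral_mul_const _ hm3, hUV,
          ENNReal.mul_rpow_of_nonneg _ _ (by positivity), ← ENNReal.rpow_mul,
          mul_one_div_cancel hR.ne', ENNReal.rpow_one]
    _ = U ^ (1 / R + (1 / A - 1 / R)) * V ^ (1 / R + (1 / B - 1 / R)) := by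
        rw [ENNReal.rpow_add_of_nonneg _ _ (by positivity) (by linarith),
            ENNReal.rpow_add_of_nonneg _ _ (by positivity) (by linarith),
            ENNReal.mul_rpow_of_nonneg _ _ (by positivity)]
        ring
    _ = _ := by ring_nf

/-- Young's convolution inequality. -/
theorem eLpNorm_conv_le {f g : G → ℝ≥0∞} (hf : Measurable f) (hg : Measurable g)
    {a b r : ℝ≥0∞} (ha : 1 ≤ a) (hb : 1 ≤ b) (h : a⁻¹ + b⁻¹ = 1 + r⁻¹) :
    eLpNorm (fun x ↦ ∫⁻ y, f y * g (x - y) ∂μ) r μ ≤ eLpNorm f a μ * eLpNorm g b μ := by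
  have hai : a⁻¹ ≤ 1 := ENNReal.inv_le_one.2 ha
  have hbi : b⁻¹ ≤ 1 := ENNReal.inv_le_one.2 hb
  rcases eq_or_ne r ∞ with rfl | hrt
  · refine eLpNorm_top_le (.of_forall fun x ↦ ?_)
    have hgx : Measurable fun y ↦ g (x - y) := by fun_prop
    refine (lintegral_mul_le_eLpNorm (by simpa using h) hf hgx).trans_eq ?_
    rw [eLpNorm_comp_sub_left g hg]
  have hri : r⁻¹ ≠ 0 := by simpa using hrt
  have hra : r⁻¹ ≤ a⁻¹ := by
    have : 1 + r⁻¹ ≤ 1 + a⁻¹ := by rw [← h, add_comm]; gcongr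
    exact (ENNReal.add_le_add_iff_left ENNReal.one_ne_top).1 this
  have hrb : r⁻¹ ≤ b⁻¹ := by
    have : 1 + r⁻¹ ≤ 1 + b⁻¹ := by rw [← h]; gcongr
    exact (ENNReal.add_le_add_iff_left ENNReal.one_ne_top).1 this
  have a0 : a ≠ 0 := (zero_lt_one.trans_le ha).ne'
  have b0 : b ≠ 0 := (zero_lt_one.trans_le hb).ne'
  have ait : a⁻¹ ≠ ∞ := by simpa using a0
  have bit : b⁻¹ ≠ ∞ := by simpa using b0
  have rit : r⁻¹ ≠ ∞ := ne_top_of_le_ne_top ait hra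
  have r0 : r ≠ 0 := by simpa using rit
  have hat : a ≠ ∞ := by
    rintro rfl
    simp at hra
    exact hrt hra
  have hbt : b ≠ ∞ := by
    rintro rfl
    simp at hrb
    exact hrt hrb
  rw [eLpNorm_ennreal r0 hrt, eLpNorm_ennreal a0 hat, eLpNorm_ennreal b0 hbt]
  refine young_aux hf hg (ENNReal.toReal_pos a0 hat) (ENNReal.toReal_pos b0 hbt)
    (ENNReal.toReal_pos r0 hrt) ?_ ?_ ?_
  · simpa [ENNReal.toReal_inv] using ENNReal.toReal_mono ait hra
  · simpa [ENNReal.toReal_inv] using ENNReal.toReal_mono bit hrb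
  · have := congrArg ENNReal.toReal h
    rw [ENNReal.toReal_add ait bit, ENNReal.toReal_add ENNReal.one_ne_top rit] at this
    simpa [ENNReal.toReal_inv] using this

end Young

/-! ### Continuous seminorms on the Schwartz space and translations. -/

section Seminorms

variable {E : Type*} [NormedAddCommGroup E] [NormedSpace ℝ E]

theorem continuous_schwartzSeminorm (k n : ℕ) :
    Continuous (SchwartzMap.seminorm ℝ k n : Seminorm ℝ 𝓢(E, ℂ)) :=
  (schwartz_withSeminorms ℝ E ℂ).continuous_seminorm (k, n)

theorem sum_schwartzSeminorm_apply (s : Finset (ℕ × ℕ)) (f : 𝓢(E, ℂ)) :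
    (∑ i ∈ s, SchwartzMap.seminorm ℝ i.1 i.2 : Seminorm ℝ 𝓢(E, ℂ)) f =
      ∑ i ∈ s, SchwartzMap.seminorm ℝ i.1 i.2 f := by
  induction s using Finset.cons_induction with
  | empty => simp
  | cons a s ha ih => rw [Finset.sum_cons, Finset.sum_cons, add_apply, ih]

/-- A continuous seminorm is bounded by a finite sum of the standard ones. -/
theorem exists_le_sum_schwartzSeminorm {P : Seminorm ℝ 𝓢(E, ℂ)} (hP : Continuous P) :
    ∃ (s : Finset (ℕ × ℕ)) (C : ℝ), 0 ≤ C ∧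
      ∀ f, P f ≤ C * ∑ i ∈ s, SchwartzMap.seminorm ℝ i.1 i.2 f := by
  obtain ⟨s, C, -, h⟩ := Seminorm.bound_of_continuous (schwartz_withSeminorms ℝ E ℂ) P hP
  refine ⟨s, C, C.2, fun f ↦ (h f).trans ?_⟩
  rw [smul_apply, NNReal.smul_def, smul_eq_mul]
  gcongr
  exact (Seminorm.finset_sup_le_sum _ s f).trans_eq (sum_schwartzSeminorm_apply s f)

theorem continuous_sum_schwartzSeminorm (s : Finset (ℕ × ℕ)) (C : ℝ≥0) :
    Continuous (C • ∑ i ∈ s, SchwartzMap.seminorm ℝ i.1 i.2 : Seminorm ℝ 𝓢(E, ℂ)) := by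
  have : ⇑(C • ∑ i ∈ s, SchwartzMap.seminorm ℝ i.1 i.2 : Seminorm ℝ 𝓢(E, ℂ)) =
      fun f ↦ C * ∑ i ∈ s, SchwartzMap.seminorm ℝ i.1 i.2 f := by
    ext f
    rw [smul_apply, NNReal.smul_def, smul_eq_mul, sum_schwartzSeminorm_apply]
  rw [this]
  exact continuous_const.mul (continuous_finsetSum s fun i _ ↦ continuous_schwartzSeminorm _ _)

/-- Translation of Schwartz functions. -/
def translate (a : E) : 𝓢(E, ℂ) →L[ℂ] 𝓢(E, ℂ) := SchwartzMap.compSubConstCLM ℂ a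

@[simp]
theorem translate_apply (a : E) (f : 𝓢(E, ℂ)) (x : E) : translate a f x = f (x - a) := rfl

theorem iteratedFDeriv_translate (n : ℕ) (a : E) (f : 𝓢(E, ℂ)) (x : E) :
    iteratedFDeriv ℝ n (translate a f) x = iteratedFDeriv ℝ n f (x - a) :=
  iteratedFDeriv_comp_sub n a x

theorem schwartzSeminorm_translate_le (k n : ℕ) (a : E) (f : 𝓢(E, ℂ)) :
    SchwartzMap.seminorm ℝ k n (translate a f) ≤ (1 + ‖a‖) ^ k *
      (2 ^ k * ∑ i ∈ Finset.Iic (k, n), SchwartzMap.seminorm ℝ i.1 i.2 f) := by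
  have h0 : 0 ≤ ∑ i ∈ Finset.Iic (k, n), SchwartzMap.seminorm ℝ i.1 i.2 f :=
    Finset.sum_nonneg fun i _ ↦ apply_nonneg _ _
  refine SchwartzMap.seminorm_le_bound ℝ k n _ (by positivity) fun x ↦ ?_
  rw [iteratedFDeriv_translate]
  have h1 : ‖x‖ ≤ (1 + ‖a‖) * (1 + ‖x - a‖) := by
    have : ‖x‖ ≤ ‖x - a‖ + ‖a‖ := by simpa using norm_add_le (x - a) a
    nlinarith [norm_nonneg a, norm_nonneg (x - a)]
  have h2 := SchwartzMap.one_add_le_sup_seminorm_apply (𝕜 := ℝ) (m := (k, n)) le_rfl le_rfl f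
    (x - a)
  have h3 : (Finset.Iic (k, n)).sup (fun m ↦ SchwartzMap.seminorm ℝ m.1 m.2) f ≤
      ∑ i ∈ Finset.Iic (k, n), SchwartzMap.seminorm ℝ i.1 i.2 f :=
    (Seminorm.finset_sup_le_sum _ _ f).trans_eq (sum_schwartzSeminorm_apply _ f)
  calc ‖x‖ ^ k * ‖iteratedFDeriv ℝ n f (x - a)‖
      ≤ ((1 + ‖a‖) * (1 + ‖x - a‖)) ^ k * ‖iteratedFDeriv ℝ n f (x - a)‖ := by gcongr
    _ = (1 + ‖a‖) ^ k * ((1 + ‖x - a‖) ^ k * ‖iteratedFDeriv ℝ n f (x - a)‖) := by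
      rw [mul_pow, mul_assoc]
    _ ≤ _ := mul_le_mul_of_nonneg_left (h2.trans
        (mul_le_mul_of_nonneg_left h3 (by positivity))) (by positivity)

/-- Continuous seminorms grow at most polynomially under translations. -/
theorem exists_translate_le {P : Seminorm ℝ 𝓢(E, ℂ)} (hP : Continuous P) :
    ∃ (N : ℕ) (Q : Seminorm ℝ 𝓢(E, ℂ)), Continuous Q ∧
      ∀ a f, P (translate a f) ≤ (1 + ‖a‖) ^ N * Q f := by
  obtain ⟨s, C, hC, h⟩ := exists_le_sum_schwartzSeminorm hP
  let N := s.sup Prod.fst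
  let t : Finset (ℕ × ℕ) := s.biUnion fun i ↦ Finset.Iic i
  have hcard : 0 ≤ C * (s.card * 2 ^ N) := by positivity
  let c : ℝ≥0 := ⟨C * (s.card * 2 ^ N), hcard⟩
  refine ⟨N, c • (∑ i ∈ t, SchwartzMap.seminorm ℝ i.1 i.2 :
    Seminorm ℝ 𝓢(E, ℂ)), continuous_sum_schwartzSeminorm _ _, fun a f ↦ (h _).trans ?_⟩
  have hQ : (c • ∑ i ∈ t, SchwartzMap.seminorm ℝ i.1 i.2 :
      Seminorm ℝ 𝓢(E, ℂ)) f = C * (s.card * 2 ^ N) * ∑ i ∈ t, SchwartzMap.seminorm ℝ i.1 i.2 f := by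
    rw [smul_apply, NNReal.smul_def, smul_eq_mul, sum_schwartzSeminorm_apply]
    rfl
  rw [hQ]
  have key : ∀ i ∈ s, SchwartzMap.seminorm ℝ i.1 i.2 (translate a f) ≤ (1 + ‖a‖) ^ N *
      (2 ^ N * ∑ i ∈ t, SchwartzMap.seminorm ℝ i.1 i.2 f) := by
    intro i hi
    have hiN : i.1 ≤ N := Finset.le_sup (f := Prod.fst) hi
    refine (schwartzSeminorm_translate_le i.1 i.2 a f).trans ?_
    have h0 : 0 ≤ ∑ j ∈ Finset.Iic (i.1, i.2), SchwartzMap.seminorm ℝ j.1 j.2 f :=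
      Finset.sum_nonneg fun i _ ↦ apply_nonneg _ _
    gcongr
    · linarith [norm_nonneg a]
    · norm_num
    · exact Finset.subset_biUnion_of_mem (fun i : ℕ × ℕ ↦ Finset.Iic i) hi
  calc C * ∑ i ∈ s, SchwartzMap.seminorm ℝ i.1 i.2 (translate a f)
      ≤ C * (s.card • ((1 + ‖a‖) ^ N * (2 ^ N * ∑ i ∈ t, SchwartzMap.seminorm ℝ i.1 i.2 f))) := by
        gcongr
        exact Finset.sum_le_card_nsmul _ _ _ key
    _ = _ := by rw [nsmul_eq_mul]; ring

/-- Mean value inequality along the segment from `b` to `a`, for the `n`-th derivative as a function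
of the translation; its gradient is a derivative of order `n + 1` of a translate. -/
theorem schwartzSeminorm_translate_sub_le (k n : ℕ) {a b : E} {f : 𝓢(E, ℂ)} {B : ℝ}
    (hB : ∀ c ∈ segment ℝ b a, SchwartzMap.seminorm ℝ k (n + 1) (translate c f) ≤ B) :
    SchwartzMap.seminorm ℝ k n (translate a f - translate b f) ≤ ‖a - b‖ * B := by
  have hB0 : 0 ≤ B := (apply_nonneg _ _).trans (hB a (right_mem_segment ℝ b a))
  refine SchwartzMap.seminorm_le_bound ℝ k n _ (by positivity) fun x ↦ ?_
  have hsm : ∀ c, ContDiff ℝ n (translate c f) := fun c ↦ (translate c f).smooth n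
  have e1 : iteratedFDeriv ℝ n (⇑(translate a f - translate b f)) x =
      iteratedFDeriv ℝ n f (x - a) - iteratedFDeriv ℝ n f (x - b) := by
    have : ⇑(translate a f - translate b f) = ⇑(translate a f) - ⇑(translate b f) := rfl
    rw [this, iteratedFDeriv_sub_apply (hsm a).contDiffAt (hsm b).contDiffAt,
      iteratedFDeriv_translate, iteratedFDeriv_translate]
  rw [e1]
  let g : E → (E [×n]→L[ℝ] ℂ) := fun c ↦ iteratedFDeriv ℝ n f (x - c)
  have hd : Differentiable ℝ (iteratedFDeriv ℝ n f) :=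
    (f.smooth (n + 1 : ℕ)).differentiable_iteratedFDeriv (by exact_mod_cast Nat.lt_succ_self n)
  have hg : ∀ c, HasFDerivAt g ((fderiv ℝ (iteratedFDeriv ℝ n f) (x - c)).comp
      (-ContinuousLinearMap.id ℝ E)) c := by
    intro c
    have h1 : HasFDerivAt (fun c : E ↦ x - c) (-ContinuousLinearMap.id ℝ E) c :=
      (hasFDerivAt_id c).const_sub x
    exact (hd (x - c)).hasFDerivAt.comp c h1
  rcases (pow_nonneg (norm_nonneg x) k).eq_or_lt with hx | hx
  · rw [← hx, zero_mul]
    positivity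
  have hbound : ∀ c ∈ segment ℝ b a, ‖(fderiv ℝ (iteratedFDeriv ℝ n f) (x - c)).comp
      (-ContinuousLinearMap.id ℝ E)‖ ≤ B / ‖x‖ ^ k := by
    intro c hc
    refine (ContinuousLinearMap.opNorm_comp_le _ _).trans ?_
    rw [norm_neg, norm_fderiv_iteratedFDeriv, ← iteratedFDeriv_translate, le_div_iff₀ hx]
    calc ‖iteratedFDeriv ℝ (n + 1) (translate c f) x‖ * ‖ContinuousLinearMap.id ℝ E‖ * ‖x‖ ^ k
        ≤ ‖iteratedFDeriv ℝ (n + 1) (translate c f) x‖ * 1 * ‖x‖ ^ k := by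
          gcongr
          exact ContinuousLinearMap.norm_id_le
      _ = ‖x‖ ^ k * ‖iteratedFDeriv ℝ (n + 1) (translate c f) x‖ := by ring
      _ ≤ B := (SchwartzMap.le_seminorm ℝ k (n + 1) (translate c f) x).trans (hB c hc)
  have := (convex_segment b a).norm_image_sub_le_of_norm_hasFDerivWithin_le
    (fun c hc ↦ (hg c).hasFDerivWithinAt) hbound (left_mem_segment ℝ b a) (right_mem_segment ℝ b a)
  calc ‖x‖ ^ k * ‖g a - g b‖ ≤ ‖x‖ ^ k * (B / ‖x‖ ^ k * ‖a - b‖) := by gcongr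
    _ = ‖a - b‖ * B := by field_simp

theorem continuous_translate_right (f : 𝓢(E, ℂ)) : Continuous fun a : E ↦ translate a f := by
  refine continuous_iff_continuousAt.2 fun a₀ ↦ ?_
  refine ((schwartz_withSeminorms ℝ E ℂ).tendsto_nhds _ _).2 fun ⟨k, n⟩ ε hε ↦ ?_
  obtain ⟨N, Q, -, hQ⟩ := exists_translate_le (continuous_schwartzSeminorm (E := E) k (n + 1))
  have hB : ∀ a, ‖a - a₀‖ < 1 → SchwartzMap.seminorm ℝ k n (translate a f - translate a₀ f) ≤
      ‖a - a₀‖ * ((2 + ‖a₀‖) ^ N * Q f) := by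
    intro a ha
    refine schwartzSeminorm_translate_sub_le k n fun c hc ↦ (hQ c f).trans ?_
    have : ‖c - a₀‖ ≤ ‖a - a₀‖ := norm_sub_le_of_mem_segment hc
    have h2 : ‖c‖ ≤ ‖c - a₀‖ + ‖a₀‖ := by simpa using norm_add_le (c - a₀) a₀
    gcongr ?_ ^ N * _
    linarith
  have hlim : Tendsto (fun a ↦ ‖a - a₀‖ * ((2 + ‖a₀‖) ^ N * Q f)) (𝓝 a₀) (𝓝 0) := by
    have : Continuous fun a ↦ ‖a - a₀‖ * ((2 + ‖a₀‖) ^ N * Q f) := by fun_prop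
    simpa using this.tendsto a₀
  have h1 : ∀ᶠ a in 𝓝 a₀, ‖a - a₀‖ < 1 := by
    have : Continuous fun a ↦ ‖a - a₀‖ := by fun_prop
    exact this.tendsto' a₀ 0 (by simp) |>.eventually_lt_const one_pos
  filter_upwards [hlim.eventually_lt_const hε, h1] with a ha ha1
  exact (hB a ha1).trans_lt ha

/-- Joint continuity follows from separate continuity, because translations are equicontinuous for
bounded `a`: split `f = f₀ + (f - f₀)` and use the polynomial bound on the second part. -/
theorem continuous_translate : Continuous fun z : E × 𝓢(E, ℂ) ↦ translate z.1 z.2 := by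
  refine continuous_iff_continuousAt.2 fun ⟨a₀, f₀⟩ ↦ ?_
  have h1 : Tendsto (fun z : E × 𝓢(E, ℂ) ↦ translate z.1 f₀) (𝓝 (a₀, f₀)) (𝓝 (translate a₀ f₀)) :=
    ((continuous_translate_right f₀).comp continuous_fst).tendsto (a₀, f₀)
  have h2 : Tendsto (fun z : E × 𝓢(E, ℂ) ↦ translate z.1 (z.2 - f₀)) (𝓝 (a₀, f₀)) (𝓝 0) := by
    refine ((schwartz_withSeminorms ℝ E ℂ).tendsto_nhds _ _).2 fun ⟨k, n⟩ ε hε ↦ ?_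
    obtain ⟨N, Q, hQc, hQ⟩ := exists_translate_le (continuous_schwartzSeminorm (E := E) k n)
    have hlim : Tendsto (fun z : E × 𝓢(E, ℂ) ↦ (1 + ‖z.1‖) ^ N * Q (z.2 - f₀)) (𝓝 (a₀, f₀))
        (𝓝 0) := by
      have : Continuous fun z : E × 𝓢(E, ℂ) ↦ (1 + ‖z.1‖) ^ N * Q (z.2 - f₀) := by fun_prop
      simpa using this.tendsto (a₀, f₀)
    filter_upwards [hlim.eventually_lt_const hε] with z hz
    rw [sub_zero]
    exact (hQ _ _).trans_lt hz
  have h3 := h1.add h2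
  rw [add_zero] at h3
  refine h3.congr fun z ↦ ?_
  rw [← map_add]
  simp

end Seminorms

/-! ### Tempered distributions commute with integrals of Schwartz functions. -/

section WeakIntegral

set_option linter.unusedSectionVars false

variable {E : Type*} [NormedAddCommGroup E] [NormedSpace ℝ E]

/-- Index set of the jets of order at most `n`: an order, a point and directions. -/
def JetPoint (E : Type*) (n : ℕ) : Type _ := Σ i : Fin (n + 1), E × (Fin (i : ℕ) → E)

/-- With the discrete topology every bounded function is continuous, so bounded continuous functions
form the Banach space of all bounded functions on jet points. -/
instance (E : Type*) (n : ℕ) : TopologicalSpace (JetPoint E n) := ⊥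

instance (E : Type*) (n : ℕ) : DiscreteTopology (JetPoint E n) := ⟨rfl⟩

/-- The weighted derivative of a Schwartz function at a jet point. -/
def jetValue (K n : ℕ) (f : 𝓢(E, ℂ)) (z : JetPoint E n) : ℂ :=
  ((1 + ‖z.2.1‖) ^ K * (∏ j, ‖z.2.2 j‖)⁻¹ : ℝ) • iteratedFDeriv ℝ (z.1 : ℕ) f z.2.1 z.2.2

theorem norm_jetValue_le (K n : ℕ) (f : 𝓢(E, ℂ)) (z : JetPoint E n) :
    ‖jetValue K n f z‖ ≤
      2 ^ K * (Finset.Iic (K, n)).sup (fun m ↦ SchwartzMap.seminorm ℂ m.1 m.2) f := by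
  have h := SchwartzMap.one_add_le_sup_seminorm_apply (𝕜 := ℂ) (m := (K, n)) (k := K)
    (n := (z.1 : ℕ)) le_rfl (Nat.lt_succ_iff.1 z.1.2) f z.2.1
  have h0 : 0 ≤ ∏ j, ‖z.2.2 j‖ := Finset.prod_nonneg fun _ _ ↦ norm_nonneg _
  rw [jetValue, norm_smul, Real.norm_of_nonneg (by positivity)]
  refine le_trans ?_ h
  rw [mul_assoc]
  gcongr
  refine (mul_le_mul_of_nonneg_left ((iteratedFDeriv ℝ (z.1 : ℕ) f z.2.1).le_opNorm z.2.2)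
    (inv_nonneg.2 h0)).trans ?_
  rw [mul_left_comm]
  exact mul_le_of_le_one_right (norm_nonneg _) inv_mul_le_one

/-- The embedding of the Schwartz space into a Banach space of bounded functions
that controls the seminorms of order at most `K`, `n`. -/
def weightedJet (K n : ℕ) : 𝓢(E, ℂ) →L[ℂ] BoundedContinuousFunction (JetPoint E n) ℂ :=
  SchwartzMap.mkCLMtoNormedSpace (σ := RingHom.id ℂ)
    (fun f ↦ BoundedContinuousFunction.ofNormedAddCommGroupDiscrete (jetValue K n f) _
      (norm_jetValue_le K n f))
    (fun f g ↦ by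
      ext z
      have : ⇑(f + g) = ⇑f + ⇑g := rfl
      simp only [BoundedContinuousFunction.coe_ofNormedAddCommGroupDiscrete,
        BoundedContinuousFunction.coe_add, Pi.add_apply, jetValue, this]
      rw [iteratedFDeriv_add_apply ((f.smooth _).contDiffAt) ((g.smooth _).contDiffAt),
        _root_.add_apply, smul_add])
    (fun c f ↦ by
      ext z
      have : ⇑(c • f) = c • ⇑f := rfl
      simp only [BoundedContinuousFunction.coe_ofNormedAddCommGroupDiscrete,
        BoundedContinuousFunction.coe_smul, jetValue, this, RingHom.id_apply]
      rw [iteratedFDeriv_const_smul_apply ((f.smooth _).contDiffAt),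
        _root_.smul_apply, smul_comm])
    ⟨Finset.Iic (K, n), 2 ^ K, by positivity, fun f ↦
      (BoundedContinuousFunction.norm_le (by positivity)).2 (norm_jetValue_le K n f)⟩

theorem weightedJet_apply (K n : ℕ) (f : 𝓢(E, ℂ)) (z : JetPoint E n) :
    weightedJet K n f z = jetValue K n f z := rfl

/-- The jet values are normalised by the lengths of the directions, so their supremum recovers the
operator norms of the weighted derivatives. -/
theorem seminorm_le_norm_weightedJet {K n k l : ℕ} (hk : k ≤ K) (hl : l ≤ n) (f : 𝓢(E, ℂ)) :
    SchwartzMap.seminorm ℝ k l f ≤ ‖weightedJet K n f‖ := by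
  refine SchwartzMap.seminorm_le_bound ℝ k l _ (norm_nonneg _) fun x ↦ ?_
  have hx : 0 < (1 + ‖x‖) ^ K := by positivity
  have key : ‖iteratedFDeriv ℝ l f x‖ ≤ ‖weightedJet K n f‖ / (1 + ‖x‖) ^ K := by
    refine ContinuousMultilinearMap.opNorm_le_bound (by positivity) fun m ↦ ?_
    -- A vanishing direction makes the normalising inverse zero and carries no information, but
    -- there the multilinear map itself vanishes.
    rcases (Finset.prod_nonneg fun j (_ : j ∈ Finset.univ) ↦ norm_nonneg (m j)).eq_or_lt with h | h
    · obtain ⟨j, -, hj⟩ := Finset.prod_eq_zero_iff.1 h.symm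
      rw [← h, (iteratedFDeriv ℝ l f x).map_coord_zero j (norm_eq_zero.1 hj)]
      simp
    · have : ‖jetValue K n f ⟨⟨l, Nat.lt_succ_of_le hl⟩, x, m⟩‖ ≤ ‖weightedJet K n f‖ :=
        BoundedContinuousFunction.norm_coe_le_norm (weightedJet K n f) _
      change ‖((1 + ‖x‖) ^ K * (∏ j, ‖m j‖)⁻¹ : ℝ) • iteratedFDeriv ℝ l f x m‖ ≤ _ at this
      rw [norm_smul, Real.norm_of_nonneg (by positivity)] at this
      rw [div_mul_eq_mul_div, le_div_iff₀ hx]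
      have h2 := mul_le_mul_of_nonneg_right this h.le
      refine le_of_eq_of_le ?_ h2
      field_simp
  calc ‖x‖ ^ k * ‖iteratedFDeriv ℝ l f x‖ ≤ (1 + ‖x‖) ^ K * ‖iteratedFDeriv ℝ l f x‖ := by
        gcongr
        calc ‖x‖ ^ k ≤ (1 + ‖x‖) ^ k := by gcongr; linarith
          _ ≤ (1 + ‖x‖) ^ K := by gcongr; linarith [norm_nonneg x]
    _ ≤ (1 + ‖x‖) ^ K * (‖weightedJet K n f‖ / (1 + ‖x‖) ^ K) := by gcongr
    _ = _ := by field_simp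

theorem weightedJet_injective (K n : ℕ) :
    Function.Injective (weightedJet K n : 𝓢(E, ℂ) → BoundedContinuousFunction (JetPoint E n) ℂ) := by
  refine (injective_iff_map_eq_zero _).2 fun f h ↦ ?_
  ext x
  have h1 := seminorm_le_norm_weightedJet (K := K) (n := n) (Nat.zero_le _) (Nat.zero_le _) f
  rw [h, norm_zero] at h1
  simpa using (SchwartzMap.norm_le_seminorm ℝ f x).trans h1

/-- Every continuous functional on the Schwartz space factors through some `weightedJet`. -/
theorem exists_dual_weightedJet (f : 𝓢(E, ℂ) →L[ℂ] ℂ) :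
    ∃ (K n : ℕ) (g : StrongDual ℂ (BoundedContinuousFunction (JetPoint E n) ℂ)),
      ∀ φ, f φ = g (weightedJet K n φ) := by
  have hP : Continuous ((normSeminorm ℝ ℂ).comp ((f.restrictScalars ℝ : 𝓢(E, ℂ) →L[ℝ] ℂ) :
      𝓢(E, ℂ) →ₗ[ℝ] ℂ)) := continuous_norm.comp f.continuous
  obtain ⟨s, C, hC, h⟩ := exists_le_sum_schwartzSeminorm hP
  let K := s.sup Prod.fst
  let n := s.sup Prod.snd
  have hb : ∀ φ, ‖f φ‖ ≤ C * s.card * ‖weightedJet K n φ‖ := by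
    intro φ
    refine (h φ).trans ?_
    rw [mul_assoc, ← nsmul_eq_mul]
    gcongr
    exact Finset.sum_le_card_nsmul _ _ _ fun i hi ↦ seminorm_le_norm_weightedJet
      (Finset.le_sup (f := Prod.fst) hi) (Finset.le_sup (f := Prod.snd) hi) φ
  -- By injectivity and the bound `hb`, the functional descends to the range of the embedding;
  -- Hahn–Banach extends it to the whole Banach space.
  let ι := (weightedJet K n : 𝓢(E, ℂ) →L[ℂ] BoundedContinuousFunction (JetPoint E n) ℂ).toLinearMap
  let e := LinearEquiv.ofInjective ι (weightedJet_injective K n)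
  have he : ∀ y, weightedJet K n (e.symm y) = y := fun y ↦
    congrArg Subtype.val (e.apply_symm_apply y)
  let g₀ : LinearMap.range ι →L[ℂ] ℂ := LinearMap.mkContinuous
    (f.toLinearMap ∘ₗ e.symm.toLinearMap) (C * s.card) (by
      intro y
      have h1 := hb (e.symm y)
      rw [he y] at h1
      exact h1)
  obtain ⟨g, hg, -⟩ := exists_extension_norm_eq _ g₀
  refine ⟨K, n, g, fun φ ↦ ?_⟩
  have h1 : g₀ (e φ) = f (e.symm (e φ)) := rfl
  rw [e.symm_apply_apply] at h1
  rw [← h1, ← hg]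
  rfl

variable {Z : Type*} [TopologicalSpace Z] [SecondCountableTopology Z] [MeasurableSpace Z]
  [OpensMeasurableSpace Z] {μ : Measure Z}

/-- `ψ` is the integral of the family `Φ` of Schwartz functions. -/
structure IsSchwartzIntegral (μ : Measure Z) (Φ : Z → 𝓢(E, ℂ)) (ψ : 𝓢(E, ℂ)) : Prop where
  continuous : Continuous Φ
  integrable : ∀ P : Seminorm ℝ 𝓢(E, ℂ), Continuous P → Integrable (fun z ↦ P (Φ z)) μ
  eq_integral : ∀ x, ψ x = ∫ z, Φ z x ∂μ

open LineDeriv in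
-- Differentiation under the integral sign. `IsSchwartzIntegral` only compares values, whereas the
-- Banach space embedding sees derivatives; the sup seminorm of the derivative provides the
-- integrable majorant.
theorem IsSchwartzIntegral.lineDeriv {Φ : Z → 𝓢(E, ℂ)} {ψ : 𝓢(E, ℂ)}
    (h : IsSchwartzIntegral μ Φ ψ) (v : E) :
    IsSchwartzIntegral μ (fun z ↦ ∂_{v} (Φ z)) (∂_{v} ψ) := by
  have hc : Continuous fun z ↦ ∂_{v} (Φ z) := (continuous_lineDerivOp v).comp h.continuous
  refine ⟨hc, fun P hP ↦ ?_, fun x ↦ ?_⟩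
  · exact h.integrable (P.comp (lineDerivOpCLM ℝ 𝓢(E, ℂ) v : 𝓢(E, ℂ) →ₗ[ℝ] 𝓢(E, ℂ)))
      (hP.comp (continuous_lineDerivOp v))
  · have heval : ∀ y, Continuous fun φ : 𝓢(E, ℂ) ↦ φ y := fun y ↦
      (TemperedDistribution.delta y : 𝓢(E, ℂ) →L[ℂ] ℂ).continuous
    have hderiv : ∀ (φ : 𝓢(E, ℂ)) (t : ℝ),
        HasDerivAt (fun t : ℝ ↦ φ (x + t • v)) ((∂_{v} φ : 𝓢(E, ℂ)) (x + t • v)) t := by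
      intro φ t
      rw [SchwartzMap.lineDerivOp_apply_eq_fderiv]
      have h1 : HasDerivAt (fun t : ℝ ↦ x + t • v) ((1 : ℝ) • v) t :=
        ((hasDerivAt_id t).smul_const v).const_add x
      have := (φ.hasFDerivAt (x + t • v)).comp_hasDerivAt t h1
      rw [one_smul] at this
      exact this
    have hP0 : Continuous ((SchwartzMap.seminorm ℝ 0 0).comp
        (lineDerivOpCLM ℝ 𝓢(E, ℂ) v : 𝓢(E, ℂ) →ₗ[ℝ] 𝓢(E, ℂ))) :=
      (continuous_schwartzSeminorm 0 0).comp (continuous_lineDerivOp v)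
    have hI : Integrable (fun z ↦ Φ z x) μ := by
      refine (h.integrable _ (continuous_schwartzSeminorm 0 0)).mono'
        ((heval x).comp h.continuous).aestronglyMeasurable (.of_forall fun z ↦ ?_)
      exact SchwartzMap.norm_le_seminorm ℝ _ _
    have := (hasDerivAt_integral_of_dominated_loc_of_deriv_le (μ := μ) (x₀ := (0 : ℝ))
      (F := fun t z ↦ Φ z (x + t • v)) (F' := fun t z ↦ (∂_{v} (Φ z) : 𝓢(E, ℂ)) (x + t • v))
      (s := univ) univ_mem
      (.of_forall fun t ↦ ((heval _).comp h.continuous).aestronglyMeasurable)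
      (by simpa using hI) ((heval _).comp hc).aestronglyMeasurable
      (.of_forall fun z t _ ↦ SchwartzMap.norm_le_seminorm ℝ _ _) (h.integrable _ hP0)
      (.of_forall fun z t _ ↦ hderiv (Φ z) t)).2
    simp_rw [← h.eq_integral] at this
    have h2 := (hderiv ψ 0).unique this
    simpa using h2

open LineDeriv in
theorem IsSchwartzIntegral.iteratedLineDeriv {Φ : Z → 𝓢(E, ℂ)} {ψ : 𝓢(E, ℂ)}
    (h : IsSchwartzIntegral μ Φ ψ) {n : ℕ} (m : Fin n → E) :
    IsSchwartzIntegral μ (fun z ↦ ∂^{m} (Φ z)) (∂^{m} ψ) := by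
  induction n with
  | zero => simpa using! h
  | succ n ih =>
    simp only [iteratedLineDerivOp_succ_left]
    exact (ih _).lineDeriv _

/-- A tempered distribution commutes with integrals of Schwartz functions. -/
theorem IsSchwartzIntegral.map {Φ : Z → 𝓢(E, ℂ)} {ψ : 𝓢(E, ℂ)}
    (h : IsSchwartzIntegral μ Φ ψ) (f : 𝓢(E, ℂ) →L[ℂ] ℂ) :
    f ψ = ∫ z, f (Φ z) ∂μ := by
  obtain ⟨K, n, g, hg⟩ := exists_dual_weightedJet f
  -- In the Banach space of jets a Bochner integral is available. Coordinate evaluations identify it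
  -- with the jet of `ψ`, and the extended functional commutes with it.
  have hint : Integrable (fun z ↦ weightedJet K n (Φ z)) μ := by
    let J : 𝓢(E, ℂ) →L[ℂ] BoundedContinuousFunction (JetPoint E n) ℂ := weightedJet K n
    have hP : Continuous ((normSeminorm ℝ (BoundedContinuousFunction (JetPoint E n) ℂ)).comp
        (J.restrictScalars ℝ).toLinearMap) := continuous_norm.comp J.continuous
    exact (h.integrable _ hP).mono' (J.continuous.comp h.continuous).aestronglyMeasurable
      (.of_forall fun z ↦ le_rfl)
  have key : weightedJet K n ψ = ∫ z, weightedJet K n (Φ z) ∂μ := by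
    ext w
    have h1 := (BoundedContinuousFunction.evalCLM ℝ w).integral_comp_comm hint
    simp only [BoundedContinuousFunction.evalCLM_apply] at h1
    rw [← h1]
    simp only [weightedJet_apply, jetValue, ← SchwartzMap.iteratedLineDerivOp_eq_iteratedFDeriv]
    rw [(h.iteratedLineDeriv _).eq_integral, integral_smul]
  rw [hg, key, ← g.integral_comp_comm hint]
  exact integral_congr_ae (.of_forall fun z ↦ (hg _).symm)

end WeakIntegral

/-! ### Products of Schwartz functions with translates. -/

section SchwartzProducts

set_option linter.unusedSectionVars false

variable {E : Type*} [NormedAddCommGroup E] [NormedSpace ℝ E]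

/-- The sum of the seminorms of order at most `(k, n)`, normalised to control weighted
derivatives. -/
def jetSeminorm (k n : ℕ) : Seminorm ℝ 𝓢(E, ℂ) :=
  (2 ^ k : ℝ≥0) • ∑ i ∈ Finset.Iic (k, n), SchwartzMap.seminorm ℝ i.1 i.2

theorem continuous_jetSeminorm (k n : ℕ) : Continuous (jetSeminorm (E := E) k n) :=
  continuous_sum_schwartzSeminorm _ _

theorem one_add_pow_mul_le_jetSeminorm (k : ℕ) {i n : ℕ} (hi : i ≤ n) (f : 𝓢(E, ℂ)) (x : E) :
    (1 + ‖x‖) ^ k * ‖iteratedFDeriv ℝ i f x‖ ≤ jetSeminorm k n f := by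
  refine (SchwartzMap.one_add_le_sup_seminorm_apply (𝕜 := ℝ) (m := (k, n)) le_rfl hi f x).trans ?_
  rw [jetSeminorm, smul_apply, NNReal.smul_def, smul_eq_mul, NNReal.coe_pow, NNReal.coe_ofNat]
  exact mul_le_mul_of_nonneg_left
    (Seminorm.finset_sup_le_sum (fun m : ℕ × ℕ ↦ SchwartzMap.seminorm ℝ m.1 m.2) _ f)
    (by positivity)

theorem one_add_pow_mul_norm_le_jetSeminorm (k : ℕ) (f : 𝓢(E, ℂ)) (x : E) :
    (1 + ‖x‖) ^ k * ‖f x‖ ≤ jetSeminorm k 0 f := by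
  simpa using one_add_pow_mul_le_jetSeminorm k (le_refl 0) f x

/-- The pointwise product of Schwartz functions. -/
def mulS (f g : 𝓢(E, ℂ)) : 𝓢(E, ℂ) := SchwartzMap.pairing (ContinuousLinearMap.mul ℂ ℂ) f g

@[simp]
theorem mulS_apply (f g : 𝓢(E, ℂ)) (x : E) : mulS f g x = f x * g x := by
  simp [mulS]

theorem continuous_mulS_right (f : 𝓢(E, ℂ)) : Continuous fun g ↦ mulS f g :=
  (SchwartzMap.pairing (ContinuousLinearMap.mul ℂ ℂ) f).continuous

theorem one_add_norm_le_mul_sub (x y : E) : 1 + ‖y‖ ≤ (1 + ‖x‖) * (1 + ‖x - y‖) := by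
  have : ‖y‖ ≤ ‖x‖ + ‖x - y‖ := by
    simpa using norm_sub_le x (x - y)
  nlinarith [norm_nonneg x, norm_nonneg (x - y)]

/-- Leibniz' rule, with the weight `(1 + |y|)^M` distributed over the two factors through `1 + |y| ≤
(1 + |x|)(1 + |x - y|)`. -/
theorem schwartzSeminorm_mul_translate_le (k n M : ℕ) (f g : 𝓢(E, ℂ)) (y : E) :
    (1 + ‖y‖) ^ M * SchwartzMap.seminorm ℝ k n (mulS f (translate y g)) ≤
      2 ^ n * jetSeminorm M n g * jetSeminorm (k + M) n f := by
  have h0 : 0 < (1 + ‖y‖) ^ M := by positivity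
  have hp := mul_nonneg (mul_nonneg (pow_nonneg zero_le_two n) (apply_nonneg (jetSeminorm M n) g))
    (apply_nonneg (jetSeminorm (k + M) n) f)
  rw [mul_comm, ← le_div_iff₀ h0]
  refine SchwartzMap.seminorm_le_bound ℝ k n _ (by positivity) fun x ↦ ?_
  rw [le_div_iff₀ h0]
  have h1 := norm_iteratedFDeriv_mul_le (𝕜 := ℝ) (f.smooth ⊤) ((translate y g).smooth ⊤) x
    (n := n) (by exact_mod_cast le_top)
  have h2 : ∀ i ∈ Finset.range (n + 1), (n.choose i : ℝ) * ‖iteratedFDeriv ℝ i f x‖ *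
      ‖iteratedFDeriv ℝ (n - i) (translate y g) x‖ * ((1 + ‖x‖) ^ (k + M) * (1 + ‖x - y‖) ^ M) ≤
      n.choose i * (jetSeminorm M n g * jetSeminorm (k + M) n f) := by
    intro i hi
    have hin : i ≤ n := Nat.lt_succ_iff.1 (Finset.mem_range.1 hi)
    have h3 := one_add_pow_mul_le_jetSeminorm (k + M) hin f x
    have h4 := one_add_pow_mul_le_jetSeminorm M (Nat.sub_le n i) g (x - y)
    rw [iteratedFDeriv_translate]
    calc _ = n.choose i * (((1 + ‖x - y‖) ^ M * ‖iteratedFDeriv ℝ (n - i) g (x - y)‖) *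
          ((1 + ‖x‖) ^ (k + M) * ‖iteratedFDeriv ℝ i f x‖)) := by ring
      _ ≤ _ := by gcongr
  have h5 : ‖x‖ ^ k * (1 + ‖y‖) ^ M ≤ (1 + ‖x‖) ^ (k + M) * (1 + ‖x - y‖) ^ M := by
    calc ‖x‖ ^ k * (1 + ‖y‖) ^ M ≤ (1 + ‖x‖) ^ k * ((1 + ‖x‖) * (1 + ‖x - y‖)) ^ M := by
          gcongr
          · linarith
          · exact one_add_norm_le_mul_sub x y
      _ = _ := by rw [mul_pow, pow_add, mul_assoc]
  calc ‖x‖ ^ k * ‖iteratedFDeriv ℝ n (mulS f (translate y g)) x‖ * (1 + ‖y‖) ^ M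
      = ‖iteratedFDeriv ℝ n (fun x ↦ f x * translate y g x) x‖ * (‖x‖ ^ k * (1 + ‖y‖) ^ M) := by
        have : ⇑(mulS f (translate y g)) = fun x ↦ f x * translate y g x := by
          ext; simp
        rw [this]
        ring
    _ ≤ (∑ i ∈ Finset.range (n + 1), (n.choose i : ℝ) * ‖iteratedFDeriv ℝ i f x‖ *
      ‖iteratedFDeriv ℝ (n - i) (translate y g) x‖) * ((1 + ‖x‖) ^ (k + M) * (1 + ‖x - y‖) ^ M) := by
        gcongr
    _ ≤ ∑ i ∈ Finset.range (n + 1), n.choose i * (jetSeminorm M n g * jetSeminorm (k + M) n f) := by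
        rw [Finset.sum_mul]
        exact Finset.sum_le_sum h2
    _ = _ := by
        rw [← Finset.sum_mul, ← Nat.cast_sum, Nat.sum_range_choose]
        push_cast
        ring

/-- The product of a Schwartz function with a translate decays rapidly in the translation. -/
theorem exists_mul_translate_le {Q : Seminorm ℝ 𝓢(E, ℂ)} (hQ : Continuous Q) (g : 𝓢(E, ℂ))
    (M : ℕ) : ∃ P : Seminorm ℝ 𝓢(E, ℂ), Continuous P ∧
      ∀ f y, (1 + ‖y‖) ^ M * Q (mulS f (translate y g)) ≤ P f := by
  obtain ⟨s, C, hC, h⟩ := exists_le_sum_schwartzSeminorm hQ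
  have hc : ∀ i : ℕ × ℕ, 0 ≤ C * (2 ^ i.2 * jetSeminorm M i.2 g) := fun i ↦
    mul_nonneg hC (mul_nonneg (by positivity) (apply_nonneg _ _))
  let P : Seminorm ℝ 𝓢(E, ℂ) :=
    ∑ i ∈ s, (C * (2 ^ i.2 * jetSeminorm M i.2 g)).toNNReal • jetSeminorm (i.1 + M) i.2
  have hP : ∀ f, P f = ∑ i ∈ s, C * (2 ^ i.2 * jetSeminorm M i.2 g) *
      jetSeminorm (i.1 + M) i.2 f := by
    intro f
    simp only [P]
    generalize s = s'
    induction s' using Finset.cons_induction with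
    | empty => simp
    | cons a s ha ih =>
      rw [Finset.sum_cons, Finset.sum_cons, add_apply, ih, smul_apply, NNReal.smul_def,
        smul_eq_mul, Real.coe_toNNReal _ (hc a)]
  refine ⟨P, ?_, fun f y ↦ ?_⟩
  · have : ⇑P = fun f ↦ ∑ i ∈ s, C * (2 ^ i.2 * jetSeminorm M i.2 g) *
      jetSeminorm (i.1 + M) i.2 f := funext hP
    rw [this]
    exact continuous_finsetSum s fun i _ ↦ continuous_const.mul (continuous_jetSeminorm _ _)
  · rw [hP]
    calc (1 + ‖y‖) ^ M * Q (mulS f (translate y g))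
        ≤ (1 + ‖y‖) ^ M * (C * ∑ i ∈ s, SchwartzMap.seminorm ℝ i.1 i.2 (mulS f (translate y g))) := by
          gcongr
          exact h _
      _ = ∑ i ∈ s, C * ((1 + ‖y‖) ^ M * SchwartzMap.seminorm ℝ i.1 i.2 (mulS f (translate y g))) := by
          rw [Finset.mul_sum, Finset.mul_sum]
          exact Finset.sum_congr rfl fun _ _ ↦ by ring
      _ ≤ _ := by
          refine Finset.sum_le_sum fun i _ ↦ ?_
          rw [mul_assoc]
          exact mul_le_mul_of_nonneg_left (schwartzSeminorm_mul_translate_le i.1 i.2 M f g y) hC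

end SchwartzProducts

/-! ### Time-frequency shifts and the reproducing formula. -/

section TimeFrequency

open FourierTransform

variable {d : ℕ}

theorem norm_character (ξ y : Space d) : ‖character ξ y‖ = 1 := by
  rw [character, Complex.norm_exp_ofReal_mul_I]

theorem character_add_left (ξ η y : Space d) :
    character (ξ + η) y = character ξ y * character η y := by
  rw [character, character, character, ← Complex.exp_add, inner_add_left]
  congr 1
  push_cast
  ring

theorem character_add_right (ξ y z : Space d) :
    character ξ (y + z) = character ξ y * character ξ z := by
  rw [character, character, character, ← Complex.exp_add, inner_add_right]
  congr 1
  push_cast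
  ring

theorem fourier_eq_character (f : 𝓢(Space d, ℂ)) (ξ : Space d) :
    𝓕 f ξ = ∫ y, character ξ y * f y := by
  rw [SchwartzMap.fourier_coe, Real.fourier_eq']
  refine integral_congr_ae (.of_forall fun y ↦ ?_)
  simp only [character, smul_eq_mul, real_inner_comm]
  congr 3
  push_cast
  ring

theorem fourierInv_eq_character (f : 𝓢(Space d, ℂ)) (y : Space d) :
    𝓕⁻ f y = ∫ ξ, character (-ξ) y * f ξ := by
  rw [SchwartzMap.fourierInv_coe, Real.fourierInv_eq']
  refine integral_congr_ae (.of_forall fun y ↦ ?_)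
  simp only [character, smul_eq_mul, inner_neg_left]
  congr 3
  push_cast
  ring

/-- The time-frequency shift `M_ξ T_x ψ`. -/
def tfShift (ψ : 𝓢(Space d, ℂ)) (x ξ : Space d) : 𝓢(Space d, ℂ) :=
  SchwartzMap.smulLeftCLM ℂ (character ξ) (translate x ψ)

@[simp]
theorem tfShift_apply (ψ : 𝓢(Space d, ℂ)) (x ξ y : Space d) :
    tfShift ψ x ξ y = character ξ y * ψ (y - x) := by
  simp [tfShift, SchwartzMap.smulLeftCLM_apply_apply (character_hasTemperateGrowth ξ)]

/-- Complex conjugation of Schwartz functions. -/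
def conjS (g : 𝓢(Space d, ℂ)) : 𝓢(Space d, ℂ) :=
  SchwartzMap.postcompCLM (𝕜 := ℝ) (Complex.conjCLE : ℂ →L[ℝ] ℂ) g

@[simp]
theorem conjS_apply (g : 𝓢(Space d, ℂ)) (x : Space d) : conjS g x = (starRingEnd ℂ) (g x) := rfl

theorem conjShift_eq_tfShift (g : 𝓢(Space d, ℂ)) (x ξ : Space d) :
    conjShift g x ξ = tfShift (conjS g) x ξ := rfl

/-- Modulation is translation on the Fourier side. Hence continuity and polynomial growth of
time-frequency shifts reduce to the results on translations. -/
theorem tfShift_eq_fourier (ψ : 𝓢(Space d, ℂ)) (x ξ : Space d) :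
    tfShift ψ x ξ = 𝓕⁻ (translate (-ξ) (𝓕 (translate x ψ))) := by
  have h : 𝓕 (tfShift ψ x ξ) = translate (-ξ) (𝓕 (translate x ψ)) := by
    ext η
    rw [translate_apply, fourier_eq_character, fourier_eq_character, sub_neg_eq_add]
    refine integral_congr_ae (.of_forall fun y ↦ ?_)
    simp only [tfShift_apply, translate_apply, character_add_left]
    ring
  rw [← h, FourierTransform.fourierInv_fourier_eq]

theorem continuous_tfShift (ψ : 𝓢(Space d, ℂ)) :
    Continuous fun z : Space d × Space d ↦ tfShift ψ z.1 z.2 := by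
  simp_rw [tfShift_eq_fourier]
  have h1 : Continuous fun z : Space d × Space d ↦ 𝓕 (translate z.1 ψ) :=
    continuous_fourier.comp ((continuous_translate_right ψ).comp continuous_fst)
  exact continuous_fourierInv.comp (continuous_translate.comp (continuous_snd.neg.prodMk h1))

theorem exists_tfShift_le {P : Seminorm ℝ 𝓢(Space d, ℂ)} (hP : Continuous P) :
    ∃ (N : ℕ) (Q : Seminorm ℝ 𝓢(Space d, ℂ)), Continuous Q ∧
      ∀ ψ x ξ, P (tfShift ψ x ξ) ≤ (1 + ‖x‖) ^ N * (1 + ‖ξ‖) ^ N * Q ψ := by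
  obtain ⟨N₁, Q₁, hQ₁, h₁⟩ := exists_translate_le
    (P := P.comp (fourierInvCLM ℝ 𝓢(Space d, ℂ)).toLinearMap) (hP.comp continuous_fourierInv)
  obtain ⟨N₂, Q₂, hQ₂, h₂⟩ := exists_translate_le
    (P := Q₁.comp (fourierCLM ℝ 𝓢(Space d, ℂ)).toLinearMap) (hQ₁.comp continuous_fourier)
  refine ⟨max N₁ N₂, Q₂, hQ₂, fun ψ x ξ ↦ ?_⟩
  rw [tfShift_eq_fourier]
  calc _ ≤ (1 + ‖-ξ‖) ^ N₁ * Q₁ (𝓕 (translate x ψ)) := h₁ _ _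
    _ ≤ (1 + ‖-ξ‖) ^ N₁ * ((1 + ‖x‖) ^ N₂ * Q₂ ψ) := by
        gcongr
        exact h₂ _ _
    _ = (1 + ‖x‖) ^ N₂ * (1 + ‖ξ‖) ^ N₁ * Q₂ ψ := by rw [norm_neg]; ring
    _ ≤ _ := by
        gcongr
        · linarith [norm_nonneg x]
        · exact le_max_right _ _
        · linarith [norm_nonneg ξ]
        · exact le_max_left _ _

/-- The cross transform `∫ exp (-2πi η·w) ψ(w) g(w - y) dw`. -/
def cross (ψ g : 𝓢(Space d, ℂ)) (y η : Space d) : ℂ := 𝓕 (mulS ψ (translate y g)) η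

theorem cross_eq (ψ g : 𝓢(Space d, ℂ)) (y η : Space d) :
    cross ψ g y η = ∫ w, character η w * (ψ w * g (w - y)) := by
  rw [cross, fourier_eq_character]
  simp

theorem exists_cross_le (g : 𝓢(Space d, ℂ)) (M : ℕ) :
    ∃ P : Seminorm ℝ 𝓢(Space d, ℂ), Continuous P ∧
      ∀ ψ y η, (1 + ‖y‖) ^ M * (1 + ‖η‖) ^ M * ‖cross ψ g y η‖ ≤ P ψ := by
  obtain ⟨P, hP, h⟩ := exists_mul_translate_le
    (Q := (jetSeminorm M 0).comp (fourierCLM ℝ 𝓢(Space d, ℂ)).toLinearMap)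
    ((continuous_jetSeminorm M 0).comp continuous_fourier) g M
  refine ⟨P, hP, fun ψ y η ↦ (le_trans ?_ (h ψ y))⟩
  rw [mul_assoc]
  gcongr
  exact one_add_pow_mul_norm_le_jetSeminorm M (𝓕 (mulS ψ (translate y g))) η

theorem continuous_eval : Continuous fun z : 𝓢(Space d, ℂ) × Space d ↦ z.1 z.2 := by
  have h : ∀ z : 𝓢(Space d, ℂ) × Space d,
      z.1 z.2 = (TemperedDistribution.delta (0 : Space d)) (translate (-z.2) z.1) := by
    intro z
    simp
  simp_rw [h]
  exact (map_continuous (TemperedDistribution.delta (0 : Space d))).comp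
    (continuous_translate.comp (continuous_snd.neg.prodMk continuous_fst))

theorem continuous_cross (ψ g : 𝓢(Space d, ℂ)) :
    Continuous fun z : Space d × Space d ↦ cross ψ g z.1 z.2 :=
  continuous_eval.comp ((continuous_fourier.comp ((continuous_mulS_right ψ).comp
    ((continuous_translate_right g).comp continuous_fst))).prodMk continuous_snd)

/-- Covariance: up to a unimodular factor a shift of `ψ` only moves the arguments. This turns the
decay of the cross transform at the origin into a convolution kernel. -/
theorem cross_tfShift (ψ g : 𝓢(Space d, ℂ)) (x ξ y η : Space d) :
    cross (tfShift ψ x ξ) g y η = character (ξ + η) x * cross ψ g (y - x) (ξ + η) := by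
  rw [cross_eq, cross_eq, ← integral_const_mul]
  rw [← integral_add_right_eq_self (fun w ↦ character η w * (tfShift ψ x ξ w * g (w - y))) x]
  refine integral_congr_ae (.of_forall fun w ↦ ?_)
  have : w + x - y = w - (y - x) := by abel
  simp only [tfShift_apply, add_sub_cancel_right, this, character_add_left, character_add_right]
  ring

theorem integrable_inv_one_add_norm_pow {M : ℕ} (hM : d < M) :
    Integrable (fun x : Space d ↦ ((1 + ‖x‖) ^ M)⁻¹) := by
  have := integrable_one_add_norm (E := Space d) (μ := volume) (r := M) (by simpa using hM)
  refine this.congr (.of_forall fun x ↦ ?_)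
  simp only
  rw [Real.rpow_neg (by positivity), Real.rpow_natCast]

theorem integral_norm_sq_pos {g : 𝓢(Space d, ℂ)} (hg : g ≠ 0) : 0 < ∫ x, ‖g x‖ ^ 2 := by
  have hc : Continuous fun x ↦ ‖g x‖ ^ 2 := by fun_prop
  have hi : Integrable fun x ↦ ‖g x‖ ^ 2 := by
    have := (mulS g (conjS g)).integrable (μ := volume)
    refine this.norm.congr (.of_forall fun x ↦ ?_)
    simp [sq]
  obtain ⟨x, hx⟩ : ∃ x, g x ≠ 0 := by
    by_contra! h
    exact hg (SchwartzMap.ext h)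
  exact integral_pos_of_integrable_nonneg_nonzero hc hi (fun _ ↦ by positivity) (x := x)
    (by simpa using hx)

theorem integrable_prod_decay {M : ℕ} (hM : d < M) :
    Integrable fun z : Space d × Space d ↦ ((1 + ‖z.1‖) ^ M)⁻¹ * ((1 + ‖z.2‖) ^ M)⁻¹ := by
  rw [Measure.volume_eq_prod]
  exact (integrable_inv_one_add_norm_pow hM).mul_prod (integrable_inv_one_add_norm_pow hM)

theorem integrable_seminorm_of_standard {Z : Type*} [TopologicalSpace Z] [MeasurableSpace Z]
    [OpensMeasurableSpace Z] {μ : Measure Z} {Φ : Z → 𝓢(Space d, ℂ)} (hc : Continuous Φ)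
    (h : ∀ k n, Integrable (fun z ↦ SchwartzMap.seminorm ℝ k n (Φ z)) μ)
    {P : Seminorm ℝ 𝓢(Space d, ℂ)} (hP : Continuous P) : Integrable (fun z ↦ P (Φ z)) μ := by
  obtain ⟨s, C, hC, hs⟩ := exists_le_sum_schwartzSeminorm hP
  refine ((integrable_finsetSum s fun i _ ↦ h i.1 i.2).const_mul C).mono'
    (hP.comp hc).aestronglyMeasurable (.of_forall fun z ↦ ?_)
  rw [Real.norm_of_nonneg (apply_nonneg _ _)]
  exact hs _

theorem schwartzSeminorm_smul (k n : ℕ) (c : ℂ) (f : 𝓢(Space d, ℂ)) :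
    SchwartzMap.seminorm ℝ k n (c • f) = ‖c‖ * SchwartzMap.seminorm ℝ k n f :=
  map_smul_eq_mul (SchwartzMap.seminorm ℂ k n) c f

/-- Fourier inversion in the frequency variable, with `y` frozen. -/
theorem integral_cross_mul_character (ψ g : 𝓢(Space d, ℂ)) (y w : Space d) :
    ∫ η, cross ψ g y (-η) * character η w = ψ w * g (w - y) := by
  have h1 : ∫ η, cross ψ g y (-η) * character η w =
      ∫ η, cross ψ g y η * character (-η) w := by
    rw [← integral_neg_eq_self fun η ↦ cross ψ g y η * character (-η) w]
    simp
  rw [h1]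
  have h2 := fourierInv_eq_character (𝓕 (mulS ψ (translate y g))) w
  rw [FourierTransform.fourierInv_fourier_eq] at h2
  simp only [mulS_apply, translate_apply] at h2
  rw [h2]
  exact integral_congr_ae (.of_forall fun η ↦ mul_comm _ _)

theorem continuous_cross_neg (g ψ : 𝓢(Space d, ℂ)) :
    Continuous fun z : Space d × Space d ↦ cross ψ g z.1 (-z.2) := by
  have h : Continuous fun z : Space d × Space d ↦ ((z.1, -z.2) : Space d × Space d) := by
    fun_prop
  have h2 := (continuous_cross ψ g).comp h
  exact h2

theorem continuous_conjShift (g : 𝓢(Space d, ℂ)) :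
    Continuous fun z : Space d × Space d ↦ conjShift g z.1 z.2 := by
  simp_rw [conjShift_eq_tfShift]
  exact continuous_tfShift (conjS g)

theorem continuous_cross_smul_conjShift (g ψ : 𝓢(Space d, ℂ)) :
    Continuous fun z : Space d × Space d ↦ cross ψ g z.1 (-z.2) • conjShift g z.1 z.2 := by
  have hs : Continuous fun w : ℂ × 𝓢(Space d, ℂ) ↦ w.1 • w.2 := continuous_smul
  have := hs.comp ((continuous_cross_neg g ψ).prodMk (continuous_conjShift g))
  exact this

/-- Seminorms of the shifted window grow polynomially, of some degree `N`, while the cross transform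
decays to any order; decay of order `N + d + 1` leaves an integrable function. -/
theorem integrable_schwartzSeminorm_cross_smul_conjShift (g ψ : 𝓢(Space d, ℂ)) (k n : ℕ) :
    Integrable (fun z : Space d × Space d ↦
      SchwartzMap.seminorm ℝ k n (cross ψ g z.1 (-z.2) • conjShift g z.1 z.2)) := by
  have hc := continuous_cross_smul_conjShift g ψ
  obtain ⟨N, Q, -, hQ⟩ := exists_tfShift_le (d := d) (continuous_schwartzSeminorm k n)
  obtain ⟨P, -, hP⟩ := exists_cross_le g (N + (d + 1))
  refine ((integrable_prod_decay (d := d) (Nat.lt_succ_self d)).const_mul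
    (P ψ * Q (conjS g))).mono'
    ((continuous_schwartzSeminorm k n).comp hc).aestronglyMeasurable (.of_forall fun z ↦ ?_)
  rw [Real.norm_of_nonneg (apply_nonneg _ _), schwartzSeminorm_smul]
  have h1 := hP ψ z.1 (-z.2)
  have h2 := hQ (conjS g) z.1 z.2
  rw [← conjShift_eq_tfShift] at h2
  rw [norm_neg] at h1
  set a := 1 + ‖z.1‖
  set b := 1 + ‖z.2‖
  have ha : 0 < a := by positivity
  have hb : 0 < b := by positivity
  have hPψ : 0 ≤ P ψ := apply_nonneg _ _
  calc ‖cross ψ g z.1 (-z.2)‖ * SchwartzMap.seminorm ℝ k n (conjShift g z.1 z.2)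
      ≤ ‖cross ψ g z.1 (-z.2)‖ * (a ^ N * b ^ N * Q (conjS g)) := by gcongr
    _ = (a ^ (N + (d + 1)) * b ^ (N + (d + 1)) * ‖cross ψ g z.1 (-z.2)‖) * Q (conjS g) *
        ((a ^ (d + 1))⁻¹ * (b ^ (d + 1))⁻¹) := by
        have ha' : a ^ (d + 1) * (a ^ (d + 1))⁻¹ = 1 := mul_inv_cancel₀ (by positivity)
        have hb' : b ^ (d + 1) * (b ^ (d + 1))⁻¹ = 1 := mul_inv_cancel₀ (by positivity)
        rw [pow_add, pow_add]
        linear_combination (-(‖cross ψ g z.1 (-z.2)‖ * a ^ N * b ^ N * Q (conjS g))) *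
          (ha' * (b ^ (d + 1) * (b ^ (d + 1))⁻¹) + hb')
    _ ≤ P ψ * Q (conjS g) * ((a ^ (d + 1))⁻¹ * (b ^ (d + 1))⁻¹) := by
        gcongr

/-- A Schwartz function is a superposition of time-frequency shifts of a window. -/
theorem isSchwartzIntegral_reproducing (g ψ : 𝓢(Space d, ℂ)) :
    IsSchwartzIntegral (volume : Measure (Space d × Space d))
      (fun z ↦ cross ψ g z.1 (-z.2) • conjShift g z.1 z.2)
      (((∫ x, ‖g x‖ ^ 2 : ℝ) : ℂ) • ψ) := by
  have hc := continuous_cross_smul_conjShift g ψ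
  have hint := integrable_schwartzSeminorm_cross_smul_conjShift g ψ
  refine ⟨hc, fun P hP ↦ integrable_seminorm_of_standard hc hint hP, fun w ↦ ?_⟩
  have hw : Integrable (fun z : Space d × Space d ↦
      (cross ψ g z.1 (-z.2) • conjShift g z.1 z.2) w) := by
    have hm : Continuous fun z : Space d × Space d ↦
        (cross ψ g z.1 (-z.2) • conjShift g z.1 z.2) w :=
      continuous_eval.comp (hc.prodMk continuous_const)
    exact (hint 0 0).mono' hm.aestronglyMeasurable
      (.of_forall fun z ↦ SchwartzMap.norm_le_seminorm ℝ _ _)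
  rw [Measure.volume_eq_prod] at hw ⊢
  rw [integral_prod _ hw]
  -- Inversion in `η` produces the second copy of the window; the remaining integral in `y` is the
  -- squared `L²` norm of `g`.
  have h1 : ∀ y, ∫ η, (cross ψ g y (-η) • conjShift g y η) w = ψ w * (‖g (w - y)‖ ^ 2 : ℝ) := by
    intro y
    have : ∀ η, (cross ψ g y (-η) • conjShift g y η) w =
        (cross ψ g y (-η) * character η w) * (starRingEnd ℂ) (g (w - y)) := by
      intro η
      rw [smul_apply, conjShift_apply, smul_eq_mul, mul_assoc]
    simp_rw [this]
    rw [integral_mul_const, integral_cross_mul_character, mul_assoc, Complex.mul_conj,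
      Complex.normSq_eq_norm_sq]
  simp_rw [h1]
  rw [integral_const_mul, integral_complex_ofReal, integral_sub_left_eq_self (fun y ↦ ‖g y‖ ^ 2),
    smul_apply, smul_eq_mul, mul_comm]

/-- The reproducing formula for tempered distributions. -/
theorem reproducing (g ψ : 𝓢(Space d, ℂ)) (f : 𝓢'(Space d, ℂ)) :
    ((∫ x, ‖g x‖ ^ 2 : ℝ) : ℂ) * f ψ =
      ∫ z : Space d × Space d, cross ψ g z.1 (-z.2) * stft g f z.1 z.2 := by
  let f' : 𝓢(Space d, ℂ) →L[ℂ] ℂ := f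
  have h := (isSchwartzIntegral_reproducing g ψ).map f'
  simp only [map_smul, smul_eq_mul] at h
  exact h

theorem continuous_stft (g : 𝓢(Space d, ℂ)) (f : 𝓢'(Space d, ℂ)) :
    Continuous fun z : Space d × Space d ↦ stft g f z.1 z.2 :=
  (map_continuous f).comp (continuous_tfShift (conjS g))

/-- The weight `(1 + |z|)^{-M}`. -/
def decay (M : ℕ) (z : Space d) : ℝ≥0∞ := ENNReal.ofReal (((1 + ‖z‖) ^ M)⁻¹)

theorem measurable_decay (M : ℕ) : Measurable (decay M : Space d → ℝ≥0∞) := by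
  unfold decay
  fun_prop

/-- The integral operator with kernel `(1 + |x - y|)^{-M} (1 + |ξ - η|)^{-M}`. -/
def kernelOp (M : ℕ) (W : Space d → Space d → ℝ≥0∞) (x ξ : Space d) : ℝ≥0∞ :=
  ∫⁻ η, (∫⁻ y, W y η * decay M (x - y)) * decay M (ξ - η)

/-- A tempered distribution is controlled by its short-time Fourier transform. -/
theorem exists_enorm_apply_tfShift_le {g : 𝓢(Space d, ℂ)} (hg : g ≠ 0) (M : ℕ) :
    ∃ P : Seminorm ℝ 𝓢(Space d, ℂ), Continuous P ∧
      ∀ (f : 𝓢'(Space d, ℂ)) ψ x ξ, ‖f (tfShift ψ x ξ)‖ₑ ≤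
        ENNReal.ofReal (P ψ) * kernelOp M (fun y η ↦ ‖stft g f y η‖ₑ) x ξ := by
  obtain ⟨P, hP, h⟩ := exists_cross_le g M
  set G := ∫ x, ‖g x‖ ^ 2 with hGdef
  have hG : 0 < G := integral_norm_sq_pos hg
  -- The reproducing formula carries the factor `‖g‖²_{L²}`, hence the division by `G`.
  refine ⟨(G⁻¹.toNNReal) • P, ?_, fun f ψ x ξ ↦ ?_⟩
  · have : ⇑((G⁻¹.toNNReal) • P) = fun f ↦ (G⁻¹.toNNReal : ℝ) * P f := rfl
    rw [this]
    exact continuous_const.mul hP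
  have hPG : ((G⁻¹.toNNReal) • P) ψ = G⁻¹ * P ψ := by
    rw [smul_apply, NNReal.smul_def, smul_eq_mul, Real.coe_toNNReal _ (by positivity)]
  have hrep : f (tfShift ψ x ξ) = ((G⁻¹ : ℝ) : ℂ) *
      ∫ z : Space d × Space d, cross (tfShift ψ x ξ) g z.1 (-z.2) * stft g f z.1 z.2 := by
    rw [← reproducing, ← mul_assoc, ← Complex.ofReal_mul, ← hGdef, inv_mul_cancel₀ hG.ne']
    simp
  have hmeas : Measurable fun z : Space d × Space d ↦ ‖stft g f z.1 z.2‖ₑ :=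
    (continuous_stft g f).enorm.measurable
  have hx : Measurable fun z : Space d × Space d ↦ decay M (x - z.1) :=
    (measurable_decay M).comp (by fun_prop)
  have hξ : Measurable fun z : Space d × Space d ↦ decay M (ξ - z.2) :=
    (measurable_decay M).comp (by fun_prop)
  have hprod : Measurable fun z : Space d × Space d ↦
      ‖stft g f z.1 z.2‖ₑ * decay M (x - z.1) * decay M (ξ - z.2) := (hmeas.mul hx).mul hξ
  have hprod₁ : Measurable fun z : Space d × Space d ↦
      ‖stft g f z.1 z.2‖ₑ * decay M (x - z.1) := hmeas.mul hx
  -- By covariance the cross transform is evaluated at `(y - x, ξ - η)`, where its decay of order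
  -- `M` is exactly the kernel.
  have hbound : ∀ z : Space d × Space d,
      ‖cross (tfShift ψ x ξ) g z.1 (-z.2) * stft g f z.1 z.2‖ₑ ≤
      ENNReal.ofReal (P ψ) * (‖stft g f z.1 z.2‖ₑ * decay M (x - z.1) * decay M (ξ - z.2)) := by
    intro z
    rw [enorm_mul, cross_tfShift, enorm_mul]
    have h1 : ‖character (ξ + -z.2) x‖ₑ = 1 := by
      rw [← ofReal_norm, norm_character, ENNReal.ofReal_one]
    have h2 : ‖cross ψ g (z.1 - x) (ξ + -z.2)‖ₑ ≤
        ENNReal.ofReal (P ψ) * (decay M (x - z.1) * decay M (ξ - z.2)) := by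
      rw [← ofReal_norm, decay, decay, ← ENNReal.ofReal_mul (by positivity),
        ← ENNReal.ofReal_mul (apply_nonneg _ _)]
      refine ENNReal.ofReal_le_ofReal ?_
      have h3 := h ψ (z.1 - x) (ξ + -z.2)
      rw [← sub_eq_add_neg, norm_sub_rev] at h3
      rw [← sub_eq_add_neg]
      rw [← mul_inv, ← div_eq_mul_inv, le_div_iff₀ (by positivity), mul_comm]
      exact h3
    rw [h1, one_mul]
    calc _ ≤ ENNReal.ofReal (P ψ) * (decay M (x - z.1) * decay M (ξ - z.2)) *
          ‖stft g f z.1 z.2‖ₑ := by gcongr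
      _ = _ := by ring
  calc ‖f (tfShift ψ x ξ)‖ₑ
      ≤ ENNReal.ofReal G⁻¹ *
        ∫⁻ z : Space d × Space d, ‖cross (tfShift ψ x ξ) g z.1 (-z.2) * stft g f z.1 z.2‖ₑ := by
        rw [hrep, enorm_mul, ← ofReal_norm, Complex.norm_real,
          Real.norm_of_nonneg (by positivity)]
        gcongr
        exact enorm_integral_le_lintegral_enorm _
    _ ≤ ENNReal.ofReal G⁻¹ * ∫⁻ z : Space d × Space d, ENNReal.ofReal (P ψ) *
          (‖stft g f z.1 z.2‖ₑ * decay M (x - z.1) * decay M (ξ - z.2)) := by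
        gcongr with z
        exact hbound z
    _ = _ := by
        rw [lintegral_const_mul _ hprod, ← mul_assoc,
          ← ENNReal.ofReal_mul (by positivity), hPG, kernelOp, Measure.volume_eq_prod,
          lintegral_prod_symm' _ hprod]
        congr 1
        refine lintegral_congr fun η ↦ ?_
        exact lintegral_mul_const (decay M (ξ - η))
          (hprod₁.comp (measurable_prodMk_right (y := η)))

end TimeFrequency

/-! ### Weights and weighted mixed norms. -/

section MixedNorm

variable {d : ℕ}

/-- The weight `⟨ξ⟩^s`. -/
def weight (s : ℝ) (ξ : Space d) : ℝ≥0∞ := ENNReal.ofReal ((1 + ‖ξ‖ ^ 2) ^ (s / 2))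

theorem measurable_weight (s : ℝ) : Measurable (weight s : Space d → ℝ≥0∞) := by
  unfold weight
  fun_prop

theorem weight_add (s t : ℝ) (ξ : Space d) : weight (s + t) ξ = weight s ξ * weight t ξ := by
  rw [weight, weight, weight, ← ENNReal.ofReal_mul (by positivity),
    ← Real.rpow_add (by positivity), add_div]

theorem weight_ne_top (s : ℝ) (ξ : Space d) : weight s ξ ≠ ∞ := ENNReal.ofReal_ne_top

@[simp]
theorem weight_zero_left (ξ : Space d) : weight 0 ξ = 1 := by simp [weight]

theorem weight_mono {s t : ℝ} (h : s ≤ t) (ξ : Space d) : weight s ξ ≤ weight t ξ := by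
  refine ENNReal.ofReal_le_ofReal (Real.rpow_le_rpow_of_exponent_le ?_ (by linarith))
  nlinarith [sq_nonneg ‖ξ‖]

theorem decay_add (a b : ℕ) (z : Space d) : decay (a + b) z = decay a z * decay b z := by
  rw [decay, decay, decay, ← ENNReal.ofReal_mul (by positivity), pow_add, mul_inv]

theorem decay_neg (a : ℕ) (z : Space d) : decay a (-z) = decay a z := by
  rw [decay, decay, norm_neg]

theorem decay_le_one (a : ℕ) (z : Space d) : decay a z ≤ 1 := by
  rw [decay, ENNReal.ofReal_le_one]
  exact inv_le_one_of_one_le₀ (one_le_pow₀ (by linarith [norm_nonneg z]))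

theorem lintegral_decay_lt_top {M : ℕ} (hM : d < M) : ∫⁻ z : Space d, decay M z < ∞ := by
  have h := (integrable_inv_one_add_norm_pow hM).lintegral_lt_top
  exact h

theorem eLpNorm_decay_lt_top {M : ℕ} (hM : d < M) {b : ℝ≥0∞} (hb : 1 ≤ b) :
    eLpNorm (decay M : Space d → ℝ≥0∞) b volume < ∞ := by
  rcases eq_or_ne b ∞ with rfl | ht
  · exact (eLpNorm_top_le (.of_forall (decay_le_one M))).trans_lt ENNReal.one_lt_top
  · have h0 : b ≠ 0 := (zero_lt_one.trans_le hb).ne'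
    have h1 : 1 ≤ b.toReal := by
      simpa using ENNReal.toReal_mono ht hb
    rw [eLpNorm_ennreal h0 ht]
    refine ENNReal.rpow_lt_top_of_nonneg (by positivity) (ne_of_lt ?_)
    refine lt_of_le_of_lt (lintegral_mono fun z ↦ ?_) (lintegral_decay_lt_top hM)
    calc decay M z ^ b.toReal ≤ decay M z ^ (1 : ℝ) :=
          ENNReal.rpow_le_rpow_of_exponent_ge (decay_le_one M z) h1
      _ = decay M z := ENNReal.rpow_one _

theorem one_add_norm_sq_le (ξ η : Space d) :
    1 + ‖ξ‖ ^ 2 ≤ 2 * (1 + ‖η‖ ^ 2) * (1 + ‖ξ - η‖) ^ 2 := by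
  have h : ‖ξ‖ ≤ ‖ξ - η‖ + ‖η‖ := by simpa using norm_add_le (ξ - η) η
  have h2 : ‖ξ‖ ^ 2 ≤ (‖ξ - η‖ + ‖η‖) ^ 2 := by gcongr
  nlinarith [norm_nonneg (ξ - η), norm_nonneg η, sq_nonneg (‖ξ - η‖ - ‖η‖),
    mul_nonneg (sq_nonneg ‖η‖) (norm_nonneg (ξ - η)), mul_nonneg (sq_nonneg ‖η‖) (sq_nonneg ‖ξ - η‖)]

/-- Peetre's inequality. -/
theorem weight_real_le (s : ℝ) {n : ℕ} (hn : |s| ≤ n) (ξ η : Space d) :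
    (1 + ‖ξ‖ ^ 2) ^ (s / 2) ≤ 2 ^ (|s| / 2) * (1 + ‖η‖ ^ 2) ^ (s / 2) * (1 + ‖ξ - η‖) ^ n := by
  have hz : 1 ≤ 1 + ‖ξ - η‖ := by linarith [norm_nonneg (ξ - η)]
  have hpow : ((1 + ‖ξ - η‖) ^ 2) ^ (|s| / 2) ≤ (1 + ‖ξ - η‖) ^ n := by
    rw [← Real.rpow_natCast, ← Real.rpow_mul (by positivity), ← Real.rpow_natCast]
    refine Real.rpow_le_rpow_of_exponent_le hz ?_
    push_cast
    linarith
  rcases le_total 0 s with hs | hs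
  · rw [abs_of_nonneg hs] at hpow ⊢
    calc (1 + ‖ξ‖ ^ 2) ^ (s / 2) ≤ (2 * (1 + ‖η‖ ^ 2) * (1 + ‖ξ - η‖) ^ 2) ^ (s / 2) :=
          Real.rpow_le_rpow (by positivity) (one_add_norm_sq_le ξ η) (by positivity)
      _ = 2 ^ (s / 2) * (1 + ‖η‖ ^ 2) ^ (s / 2) * ((1 + ‖ξ - η‖) ^ 2) ^ (s / 2) := by
          rw [Real.mul_rpow (by positivity) (by positivity),
            Real.mul_rpow (by positivity) (by positivity)]
      _ ≤ _ := by gcongr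
  · rw [abs_of_nonpos hs] at hpow ⊢
    have h1 := one_add_norm_sq_le η ξ
    rw [norm_sub_rev] at h1
    have h2 : (1 + ‖η‖ ^ 2) ^ (-s / 2) ≤
        2 ^ (-s / 2) * (1 + ‖ξ‖ ^ 2) ^ (-s / 2) * (1 + ‖ξ - η‖) ^ n := by
      calc (1 + ‖η‖ ^ 2) ^ (-s / 2) ≤ (2 * (1 + ‖ξ‖ ^ 2) * (1 + ‖ξ - η‖) ^ 2) ^ (-s / 2) :=
            Real.rpow_le_rpow (by positivity) h1 (by linarith)
        _ = 2 ^ (-s / 2) * (1 + ‖ξ‖ ^ 2) ^ (-s / 2) * ((1 + ‖ξ - η‖) ^ 2) ^ (-s / 2) := by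
            rw [Real.mul_rpow (by positivity) (by positivity),
              Real.mul_rpow (by positivity) (by positivity)]
        _ ≤ _ := by gcongr
    have e : ∀ x : ℝ, 0 < x → x ^ (s / 2) = (x ^ (-s / 2))⁻¹ := by
      intro x hx
      rw [← Real.rpow_neg hx.le]
      congr 1
      ring
    rw [e _ (by positivity), e (1 + ‖η‖ ^ 2) (by positivity)]
    have hA : 0 < (1 + ‖ξ‖ ^ 2) ^ (-s / 2) := by positivity
    have hB : 0 < (1 + ‖η‖ ^ 2) ^ (-s / 2) := by positivity
    rw [inv_le_iff_one_le_mul₀ hA]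
    calc (1 : ℝ) = ((1 + ‖η‖ ^ 2) ^ (-s / 2))⁻¹ * (1 + ‖η‖ ^ 2) ^ (-s / 2) :=
          (inv_mul_cancel₀ hB.ne').symm
      _ ≤ ((1 + ‖η‖ ^ 2) ^ (-s / 2))⁻¹ *
          (2 ^ (-s / 2) * (1 + ‖ξ‖ ^ 2) ^ (-s / 2) * (1 + ‖ξ - η‖) ^ n) := by gcongr
      _ = _ := by ring

/-- Peetre's inequality in the form used under convolutions: `n` powers of decay pay for moving the
weight from `ξ` to `η`, and `m` powers survive. -/
theorem weight_mul_decay_le (s : ℝ) {n : ℕ} (hn : |s| ≤ n) (m : ℕ) (ξ η : Space d) :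
    weight s ξ * decay (n + m) (ξ - η) ≤
      ENNReal.ofReal (2 ^ (|s| / 2)) * (weight s η * decay m (ξ - η)) := by
  have h := weight_real_le s hn ξ η
  have h0 : 0 < (1 + ‖ξ - η‖) ^ n := by positivity
  rw [decay_add, ← mul_assoc, ← mul_assoc]
  refine mul_le_mul_left ?_ _
  rw [weight, weight, decay, ← ENNReal.ofReal_mul (by positivity),
    ← ENNReal.ofReal_mul (by positivity)]
  refine ENNReal.ofReal_le_ofReal ?_
  rwa [← div_eq_mul_inv, div_le_iff₀ h0]

/-- From `⟨ξ⟩² ≤ 2⟨η⟩²⟨ξ - η⟩²`, raised to a nonnegative power. The sign of `s` enters the product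
estimates here. -/
theorem weight_le_weight_mul_weight {s : ℝ} (hs : 0 ≤ s) (ξ η : Space d) :
    weight s ξ ≤ ENNReal.ofReal (2 ^ (s / 2)) * (weight s η * weight s (ξ - η)) := by
  rw [weight, weight, weight, ← ENNReal.ofReal_mul (by positivity),
    ← ENNReal.ofReal_mul (by positivity)]
  refine ENNReal.ofReal_le_ofReal ?_
  rw [← Real.mul_rpow (by positivity) (by positivity),
    ← Real.mul_rpow (by positivity) (by positivity)]
  refine Real.rpow_le_rpow (by positivity) ?_ (by positivity)
  have h : ‖ξ‖ ≤ ‖η‖ + ‖ξ - η‖ := by simpa using norm_add_le η (ξ - η)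
  have h2 : ‖ξ‖ ^ 2 ≤ (‖η‖ + ‖ξ - η‖) ^ 2 := by gcongr
  nlinarith [sq_nonneg (‖ξ - η‖ - ‖η‖), mul_nonneg (sq_nonneg ‖η‖) (sq_nonneg ‖ξ - η‖)]

theorem weight_mul_decay_le_decay {s : ℝ} {n : ℕ} (hn : |s| ≤ n) (m : ℕ) (ξ : Space d) :
    weight s ξ * decay (n + m) ξ ≤ ENNReal.ofReal (2 ^ (|s| / 2)) * decay m ξ := by
  have h := weight_mul_decay_le s hn m ξ 0
  have h0 : weight s (0 : Space d) = 1 := by simp [weight]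
  rwa [sub_zero, h0, one_mul] at h

/-- The mixed norm `‖⟨ξ⟩^s ‖W(x, ξ)‖_{L^p_x}‖_{L^q_ξ}`. -/
def mixNorm (p q : ℝ≥0∞) (s : ℝ) (W : Space d → Space d → ℝ≥0∞) : ℝ≥0∞ :=
  eLpNorm (fun ξ ↦ weight s ξ * eLpNorm (fun x ↦ W x ξ) p volume) q volume

theorem modNorm_eq_mixNorm (g : 𝓢(Space d, ℂ)) (p q : ℝ≥0∞) (s : ℝ) (f : 𝓢'(Space d, ℂ)) :
    modNorm g p q s f = mixNorm p q s fun x ξ ↦ ‖stft g f x ξ‖ₑ := by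
  simp only [modNorm, mixNorm, weight, eLpNorm_enorm]

theorem mixNorm_mono {p q : ℝ≥0∞} {s : ℝ} {V W : Space d → Space d → ℝ≥0∞}
    (h : ∀ x ξ, V x ξ ≤ W x ξ) : mixNorm p q s V ≤ mixNorm p q s W := by
  refine eLpNorm_mono_ennreal _ fun ξ ↦ ?_
  gcongr
  exact eLpNorm_mono_ennreal _ fun x ↦ h x ξ

theorem mixNorm_weight_mul_le {p q : ℝ≥0∞} {s t : ℝ} {W : Space d → Space d → ℝ≥0∞} (hp : p ≠ 0)
    (hW : Measurable (Function.uncurry W)) :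
    mixNorm p q s (fun x ξ ↦ weight t ξ * W x ξ) ≤ mixNorm p q (s + t) W := by
  refine eLpNorm_mono_ennreal _ fun ξ ↦ ?_
  rw [weight_add, mul_assoc]
  gcongr
  exact eLpNorm_const_mul_ennreal (hW.comp (measurable_prodMk_right (y := ξ))) _ hp

theorem measurable_weight_mul_eLpNorm {W : Space d → Space d → ℝ≥0∞}
    (hW : Measurable (Function.uncurry W)) (p : ℝ≥0∞) (s : ℝ) :
    Measurable fun ξ ↦ weight s ξ * eLpNorm (fun x ↦ W x ξ) p volume :=
  (measurable_weight s).mul (measurable_eLpNorm_section hW p)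

theorem mixNorm_const_mul_le {p q : ℝ≥0∞} {s : ℝ} {W : Space d → Space d → ℝ≥0∞} (hp : p ≠ 0)
    (hq : q ≠ 0) (hW : Measurable (Function.uncurry W)) (c : ℝ≥0∞) :
    mixNorm p q s (fun x ξ ↦ c * W x ξ) ≤ c * mixNorm p q s W := by
  refine le_trans (eLpNorm_mono_ennreal _ fun ξ ↦ ?_)
    (eLpNorm_const_mul_ennreal (measurable_weight_mul_eLpNorm hW p s) c hq)
  rw [mul_left_comm]
  gcongr
  exact eLpNorm_const_mul_ennreal (hW.comp (measurable_prodMk_right (y := ξ))) _ hp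

theorem measurable_kernelOp_inner {M : ℕ} {W : Space d → Space d → ℝ≥0∞}
    (hW : Measurable (Function.uncurry W)) :
    Measurable (Function.uncurry fun x η ↦ ∫⁻ y, W y η * decay M (x - y)) := by
  have : Measurable (Function.uncurry fun (z : Space d × Space d) (y : Space d) ↦
      W y z.2 * decay M (z.1 - y)) := by
    have h1 : Measurable fun w : (Space d × Space d) × Space d ↦ W w.2 w.1.2 :=
      hW.comp (measurable_snd.prodMk (measurable_snd.comp measurable_fst))
    have h2 : Measurable fun w : (Space d × Space d) × Space d ↦ w.1.1 - w.2 := by fun_prop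
    exact h1.mul ((measurable_decay M).comp h2)
  exact this.lintegral_prod_right'

theorem measurable_kernelOp {M : ℕ} {W : Space d → Space d → ℝ≥0∞}
    (hW : Measurable (Function.uncurry W)) :
    Measurable (Function.uncurry (kernelOp M W)) := by
  have : Measurable (Function.uncurry fun (z : Space d × Space d) (η : Space d) ↦
      (∫⁻ y, W y η * decay M (z.1 - y)) * decay M (z.2 - η)) := by
    have h1 : Measurable fun w : (Space d × Space d) × Space d ↦
        ∫⁻ y, W y w.2 * decay M (w.1.1 - y) :=
      (measurable_kernelOp_inner hW).comp
        ((measurable_fst.comp measurable_fst).prodMk measurable_snd)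
    have h2 : Measurable fun w : (Space d × Space d) × Space d ↦ w.1.2 - w.2 := by fun_prop
    exact h1.mul ((measurable_decay M).comp h2)
  exact this.lintegral_prod_right'

/-- Minkowski brings the norm in `x` inside the `η`-integral, and Young in `x` handles the inner
convolution. Since the kernel lies in every `L^b`, the exponent may be raised from `p` to `r`. -/
theorem eLpNorm_kernelOp_le {M : ℕ} {W : Space d → Space d → ℝ≥0∞}
    (hW : Measurable (Function.uncurry W)) {p b r : ℝ≥0∞} (hp : 1 ≤ p) (hb : 1 ≤ b) (hr : 1 ≤ r)
    (h : p⁻¹ + b⁻¹ = 1 + r⁻¹) (ξ : Space d) :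
    eLpNorm (fun x ↦ kernelOp M W x ξ) r volume ≤
      eLpNorm (decay M : Space d → ℝ≥0∞) b volume *
        ∫⁻ η, eLpNorm (fun x ↦ W x η) p volume * decay M (ξ - η) := by
  have hdec : Measurable fun η : Space d ↦ decay M (ξ - η) :=
    (measurable_decay M).comp (by fun_prop)
  have hm : Measurable (Function.uncurry fun x η ↦
      (∫⁻ y, W y η * decay M (x - y)) * decay M (ξ - η)) :=
    (measurable_kernelOp_inner hW).mul (hdec.comp measurable_snd)
  refine (eLpNorm_lintegral_le hm hr).trans ?_
  have hpd : Measurable fun η ↦ eLpNorm (fun x ↦ W x η) p volume * decay M (ξ - η) :=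
    (measurable_eLpNorm_section hW p).mul hdec
  rw [← lintegral_const_mul _ hpd]
  refine lintegral_mono fun η ↦ ?_
  have hWη : Measurable fun y ↦ W y η := hW.comp (measurable_prodMk_right (y := η))
  have hIn : Measurable fun x ↦ ∫⁻ y, W y η * decay M (x - y) :=
    (measurable_kernelOp_inner hW).comp (measurable_prodMk_right (y := η))
  calc eLpNorm (fun x ↦ (∫⁻ y, W y η * decay M (x - y)) * decay M (ξ - η)) r volume
      = eLpNorm (fun x ↦ decay M (ξ - η) * (∫⁻ y, W y η * decay M (x - y))) r volume := by
        simp_rw [mul_comm]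
    _ ≤ decay M (ξ - η) * eLpNorm (fun x ↦ ∫⁻ y, W y η * decay M (x - y)) r volume :=
        eLpNorm_const_mul_ennreal hIn _ (zero_lt_one.trans_le hr).ne'
    _ ≤ decay M (ξ - η) * (eLpNorm (fun y ↦ W y η) p volume * eLpNorm (decay M) b volume) := by
        gcongr
        exact eLpNorm_conv_le hWη (measurable_decay M) hp hb h
    _ = _ := by
        ring

/-- The kernel operator is bounded between mixed norm spaces. -/
theorem exists_mixNorm_kernelOp_le (s : ℝ) {n : ℕ} (hn : |s| ≤ n) {p b r q : ℝ≥0∞} (hp : 1 ≤ p)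
    (hb : 1 ≤ b) (hr : 1 ≤ r) (h : p⁻¹ + b⁻¹ = 1 + r⁻¹) (hq : 1 ≤ q) :
    ∃ C : ℝ≥0, ∀ W : Space d → Space d → ℝ≥0∞, Measurable (Function.uncurry W) →
      mixNorm r q s (kernelOp (n + (d + 1)) W) ≤ C * mixNorm p q s W := by
  -- Of the `M` powers of decay in frequency, `n` absorb the weight and `d + 1` keep the kernel
  -- integrable for Young's inequality in `ξ`.
  set M := n + (d + 1) with hM
  have hD : eLpNorm (decay M : Space d → ℝ≥0∞) b volume ≠ ∞ :=
    (eLpNorm_decay_lt_top (by omega) hb).ne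
  have hD1 : eLpNorm (decay (d + 1) : Space d → ℝ≥0∞) 1 volume ≠ ∞ :=
    (eLpNorm_decay_lt_top (by omega) le_rfl).ne
  set c := ENNReal.ofReal (2 ^ (|s| / 2)) with hc
  set D := eLpNorm (decay M : Space d → ℝ≥0∞) b volume
  set D1 := eLpNorm (decay (d + 1) : Space d → ℝ≥0∞) 1 volume
  have hcD : c * D * D1 ≠ ∞ :=
    ENNReal.mul_ne_top (ENNReal.mul_ne_top ENNReal.ofReal_ne_top hD) hD1
  refine ⟨(c * D * D1).toNNReal, fun W hW ↦ ?_⟩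
  rw [ENNReal.coe_toNNReal hcD]
  have hH : Measurable fun ξ ↦ weight s ξ * eLpNorm (fun x ↦ W x ξ) p volume :=
    measurable_weight_mul_eLpNorm hW p s
  have hconv : Measurable fun ξ ↦ ∫⁻ η, (weight s η * eLpNorm (fun x ↦ W x η) p volume) *
      decay (d + 1) (ξ - η) :=
    (measurable_uncurry_sub hH (measurable_decay (d + 1))).lintegral_prod_right'
  have hpt : ∀ ξ, weight s ξ * eLpNorm (fun x ↦ kernelOp M W x ξ) r volume ≤
      (c * D) * ∫⁻ η, (weight s η * eLpNorm (fun x ↦ W x η) p volume) * decay (d + 1) (ξ - η) := by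
    intro ξ
    calc weight s ξ * eLpNorm (fun x ↦ kernelOp M W x ξ) r volume
        ≤ weight s ξ * (D * ∫⁻ η, eLpNorm (fun x ↦ W x η) p volume * decay M (ξ - η)) := by
          gcongr
          exact eLpNorm_kernelOp_le hW hp hb hr h ξ
      _ = D * ∫⁻ η, weight s ξ * (eLpNorm (fun x ↦ W x η) p volume * decay M (ξ - η)) := by
          rw [lintegral_const_mul' _ _ (weight_ne_top s ξ), mul_left_comm]
      _ ≤ D * ∫⁻ η, c * ((weight s η * eLpNorm (fun x ↦ W x η) p volume) *
            decay (d + 1) (ξ - η)) := by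
          refine mul_le_mul_right (lintegral_mono fun η ↦ ?_) _
          calc weight s ξ * (eLpNorm (fun x ↦ W x η) p volume * decay M (ξ - η))
              = (weight s ξ * decay M (ξ - η)) * eLpNorm (fun x ↦ W x η) p volume := by ring
            _ ≤ (c * (weight s η * decay (d + 1) (ξ - η))) * eLpNorm (fun x ↦ W x η) p volume := by
                exact mul_le_mul_left (weight_mul_decay_le s hn (d + 1) ξ η) _
            _ = _ := by ring
      _ = _ := by
          rw [lintegral_const_mul' _ _ ENNReal.ofReal_ne_top]
          ring
  calc mixNorm r q s (kernelOp M W)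
      ≤ eLpNorm (fun ξ ↦ (c * D) * ∫⁻ η, (weight s η * eLpNorm (fun x ↦ W x η) p volume) *
          decay (d + 1) (ξ - η)) q volume := eLpNorm_mono_ennreal _ hpt
    _ ≤ (c * D) * eLpNorm (fun ξ ↦ ∫⁻ η, (weight s η * eLpNorm (fun x ↦ W x η) p volume) *
          decay (d + 1) (ξ - η)) q volume :=
        eLpNorm_const_mul_ennreal hconv _ (zero_lt_one.trans_le hq).ne'
    _ ≤ (c * D) * (mixNorm p q s W * D1) := by
        gcongr
        exact eLpNorm_conv_le hH (measurable_decay (d + 1)) hq le_rfl (by simp [add_comm])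
    _ = _ := by ring

/-- Pointwise bound for the kernel operator by the mixed norm. -/
theorem exists_kernelOp_zero_le (s : ℝ) {n : ℕ} (hn : |s| ≤ n) {p p' q q' : ℝ≥0∞}
    (hpp : p⁻¹ + p'⁻¹ = 1) (hqq : q⁻¹ + q'⁻¹ = 1) :
    ∃ C : ℝ≥0, ∀ W : Space d → Space d → ℝ≥0∞, Measurable (Function.uncurry W) →
      kernelOp (n + (d + 1)) W 0 0 ≤ C * mixNorm p q s W := by
  set M := n + (d + 1) with hM
  have one_le : ∀ {a b : ℝ≥0∞}, a⁻¹ + b⁻¹ = 1 → 1 ≤ b := fun {a b} h ↦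
    ENNReal.inv_le_one.1 (h ▸ le_add_self)
  set D := eLpNorm (decay M : Space d → ℝ≥0∞) p' volume
  set D1 := eLpNorm (decay (d + 1) : Space d → ℝ≥0∞) q' volume
  have hD : D ≠ ∞ := (eLpNorm_decay_lt_top (by omega) (one_le hpp)).ne
  have hD1 : D1 ≠ ∞ := (eLpNorm_decay_lt_top (by omega) (one_le hqq)).ne
  set c := ENNReal.ofReal (2 ^ (|s| / 2)) with hc
  have hcD : c * D * D1 ≠ ∞ :=
    ENNReal.mul_ne_top (ENNReal.mul_ne_top ENNReal.ofReal_ne_top hD) hD1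
  refine ⟨(c * D * D1).toNNReal, fun W hW ↦ ?_⟩
  rw [ENNReal.coe_toNNReal hcD]
  have hH : Measurable fun ξ ↦ weight s ξ * eLpNorm (fun x ↦ W x ξ) p volume :=
    measurable_weight_mul_eLpNorm hW p s
  have hinner : ∀ η, ∫⁻ y, W y η * decay M (0 - y) ≤ eLpNorm (fun y ↦ W y η) p volume * D := by
    intro η
    simp_rw [zero_sub, decay_neg]
    exact lintegral_mul_le_eLpNorm hpp (hW.comp (measurable_prodMk_right (y := η)))
      (measurable_decay M)
  calc kernelOp M W 0 0 ≤ ∫⁻ η, (c * D) *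
        ((weight s η * eLpNorm (fun y ↦ W y η) p volume) * decay (d + 1) η) := by
        refine lintegral_mono fun η ↦ ?_
        have h1 := weight_mul_decay_le s hn (d + 1) 0 η
        have h0 : weight s (0 : Space d) = 1 := by simp [weight]
        rw [h0, one_mul, zero_sub, decay_neg, decay_neg] at h1
        rw [zero_sub, decay_neg]
        calc _ ≤ (eLpNorm (fun y ↦ W y η) p volume * D) * (c * (weight s η * decay (d + 1) η)) := by
              gcongr
              exact hinner η
          _ = _ := by ring
    _ = (c * D) * ∫⁻ η, (weight s η * eLpNorm (fun y ↦ W y η) p volume) * decay (d + 1) η :=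
        lintegral_const_mul' _ _ (ENNReal.mul_ne_top ENNReal.ofReal_ne_top hD)
    _ ≤ (c * D) * (mixNorm p q s W * D1) := by
        gcongr
        exact lintegral_mul_le_eLpNorm hqq hH (measurable_decay (d + 1))
    _ = _ := by ring

theorem mixNorm_add_le {p q : ℝ≥0∞} (hp : 1 ≤ p) (hq : 1 ≤ q) {s : ℝ}
    {V W : Space d → Space d → ℝ≥0∞} (hV : Measurable (Function.uncurry V))
    (hW : Measurable (Function.uncurry W)) :
    mixNorm p q s (fun x ξ ↦ V x ξ + W x ξ) ≤ mixNorm p q s V + mixNorm p q s W := by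
  have hin : ∀ ξ, eLpNorm (fun x ↦ V x ξ + W x ξ) p volume ≤
      eLpNorm (fun x ↦ V x ξ) p volume + eLpNorm (fun x ↦ W x ξ) p volume := fun ξ ↦
    eLpNorm_add_le (hV.comp (measurable_prodMk_right (y := ξ))).aestronglyMeasurable
      (hW.comp (measurable_prodMk_right (y := ξ))).aestronglyMeasurable hp
  refine le_trans (eLpNorm_mono_ennreal (g := fun ξ ↦
    weight s ξ * eLpNorm (fun x ↦ V x ξ) p volume +
    weight s ξ * eLpNorm (fun x ↦ W x ξ) p volume) _ fun ξ ↦ ?_) ?_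
  · rw [← mul_add]
    exact mul_le_mul_right (hin ξ) _
  · exact eLpNorm_add_le (measurable_weight_mul_eLpNorm hV p s).aestronglyMeasurable
      (measurable_weight_mul_eLpNorm hW p s).aestronglyMeasurable hq

end MixedNorm

/-! ### Basic properties of modulation norms. -/

section ModNorm

variable {d : ℕ}

theorem measurable_enorm_stft (g : 𝓢(Space d, ℂ)) (f : 𝓢'(Space d, ℂ)) :
    Measurable (Function.uncurry fun x ξ ↦ ‖stft g f x ξ‖ₑ) :=
  (continuous_stft g f).enorm.measurable

theorem exists_nat_abs_le (s : ℝ) : ∃ n : ℕ, |s| ≤ n := exists_nat_ge |s|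

/-- A distribution whose short-time Fourier transform is dominated by the kernel operator. -/
theorem exists_modNorm_le_of_stft_le (s t : ℝ) {n : ℕ} (hn : |s + t| ≤ n) {p b r q : ℝ≥0∞}
    (hp : 1 ≤ p) (hb : 1 ≤ b) (hr : 1 ≤ r) (h : p⁻¹ + b⁻¹ = 1 + r⁻¹) (hq : 1 ≤ q) :
    ∃ C : ℝ≥0, ∀ (g h : 𝓢(Space d, ℂ)) (F f : 𝓢'(Space d, ℂ)) (A : ℝ≥0∞),
      (∀ x ξ, ‖stft h F x ξ‖ₑ ≤ A * (weight t ξ *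
        kernelOp (n + (d + 1)) (fun y η ↦ ‖stft g f y η‖ₑ) x ξ)) →
      modNorm h r q s F ≤ A * (C * modNorm g p q (s + t) f) := by
  obtain ⟨C, hC⟩ := exists_mixNorm_kernelOp_le (d := d) (s + t) hn hp hb hr h hq
  refine ⟨C, fun g h F f A hF ↦ ?_⟩
  have hr0 : r ≠ 0 := (zero_lt_one.trans_le hr).ne'
  have hq0 : q ≠ 0 := (zero_lt_one.trans_le hq).ne'
  have hm := measurable_enorm_stft g f
  have hk := measurable_kernelOp (M := n + (d + 1)) hm
  have hwk : Measurable (Function.uncurry fun (x ξ : Space d) ↦ weight t ξ *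
        kernelOp (n + (d + 1)) (fun y η ↦ ‖stft g f y η‖ₑ) x ξ) :=
    ((measurable_weight t).comp measurable_snd).mul hk
  rw [modNorm_eq_mixNorm, modNorm_eq_mixNorm]
  calc _ ≤ _ := mixNorm_mono hF
    _ ≤ _ := mixNorm_const_mul_le hr0 hq0 hwk A
    _ ≤ _ := by
      gcongr
      exact (mixNorm_weight_mul_le hr0 hk).trans (hC _ hm)

/-- Independence of the window, and monotonicity in the first exponent. -/
theorem exists_modNorm_le_modNorm {g : 𝓢(Space d, ℂ)} (hg : g ≠ 0) (h : 𝓢(Space d, ℂ)) (s : ℝ)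
    {p b r q : ℝ≥0∞} (hp : 1 ≤ p) (hb : 1 ≤ b) (hr : 1 ≤ r) (hpbr : p⁻¹ + b⁻¹ = 1 + r⁻¹)
    (hq : 1 ≤ q) :
    ∃ C : ℝ≥0, ∀ f : 𝓢'(Space d, ℂ), modNorm h r q s f ≤ C * modNorm g p q s f := by
  obtain ⟨n, hn⟩ := exists_nat_abs_le (s + 0)
  obtain ⟨C, hC⟩ := exists_modNorm_le_of_stft_le (d := d) s 0 hn hp hb hr hpbr hq
  obtain ⟨P, -, hP⟩ := exists_enorm_apply_tfShift_le hg (n + (d + 1))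
  refine ⟨(P (conjS h)).toNNReal * C, fun f ↦ ?_⟩
  have := hC g h f f (ENNReal.ofReal (P (conjS h))) fun x ξ ↦ by
    rw [weight_zero_left, one_mul]
    exact hP f (conjS h) x ξ
  rwa [add_zero, ← mul_assoc] at this

theorem exists_modNorm_window_le {g : 𝓢(Space d, ℂ)} (hg : g ≠ 0) (h : 𝓢(Space d, ℂ)) (s : ℝ)
    {p q : ℝ≥0∞} (hp : 1 ≤ p) (hq : 1 ≤ q) :
    ∃ C : ℝ≥0, ∀ f : 𝓢'(Space d, ℂ), modNorm h p q s f ≤ C * modNorm g p q s f :=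
  exists_modNorm_le_modNorm hg h s hp le_rfl hp (by simp [add_comm]) hq

/-- Young's inequality with `b` the conjugate exponent of `p`. It supplies the `L^∞_x` factor when
two functions are multiplied. -/
theorem exists_modNorm_top_le {g : 𝓢(Space d, ℂ)} (hg : g ≠ 0) (s : ℝ)
    {p q : ℝ≥0∞} (hp : 1 ≤ p) (hq : 1 ≤ q) :
    ∃ C : ℝ≥0, ∀ f : 𝓢'(Space d, ℂ), modNorm g ∞ q s f ≤ C * modNorm g p q s f := by
  have h1 : p⁻¹ ≤ 1 := ENNReal.inv_le_one.2 hp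
  refine exists_modNorm_le_modNorm (b := (1 - p⁻¹)⁻¹) hg g s hp ?_ le_top ?_ hq
  · rw [ENNReal.one_le_inv]
    exact tsub_le_self
  · rw [inv_inv, add_tsub_cancel_of_le h1]
    simp

/-- The modulation norm controls the action of a distribution. -/
theorem exists_enorm_apply_le {g : 𝓢(Space d, ℂ)} (hg : g ≠ 0) (s : ℝ) {p q : ℝ≥0∞} (hp : 1 ≤ p)
    (hq : 1 ≤ q) :
    ∃ P : Seminorm ℝ 𝓢(Space d, ℂ), Continuous P ∧ ∀ (f : 𝓢'(Space d, ℂ)) ψ,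
      ‖f ψ‖ₑ ≤ ENNReal.ofReal (P ψ) * modNorm g p q s f := by
  obtain ⟨n, hn⟩ := exists_nat_abs_le s
  have conj : ∀ {a : ℝ≥0∞}, 1 ≤ a → a⁻¹ + ((1 - a⁻¹)⁻¹)⁻¹ = 1 := fun h ↦ by
    rw [inv_inv, add_tsub_cancel_of_le (ENNReal.inv_le_one.2 h)]
  obtain ⟨C, hC⟩ := exists_kernelOp_zero_le (d := d) s hn (conj hp) (conj hq)
  obtain ⟨P, hPc, hP⟩ := exists_enorm_apply_tfShift_le hg (n + (d + 1))
  refine ⟨C • P, ?_, fun f ψ ↦ ?_⟩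
  · have : ⇑(C • P) = fun f ↦ (C : ℝ) * P f := rfl
    rw [this]
    exact continuous_const.mul hPc
  · have h0 : tfShift ψ 0 0 = ψ := by
      ext y
      simp [character]
    have h1 := hP f ψ 0 0
    rw [h0] at h1
    have h2 : (C • P) ψ = C * P ψ := rfl
    rw [h2, ENNReal.ofReal_mul C.coe_nonneg, ENNReal.ofReal_coe_nnreal]
    calc ‖f ψ‖ₑ ≤ _ := h1
      _ ≤ ENNReal.ofReal (P ψ) * (C * mixNorm p q s fun y η ↦ ‖stft g f y η‖ₑ) := by
          gcongr
          exact hC _ (measurable_enorm_stft g f)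
      _ = _ := by
          rw [modNorm_eq_mixNorm]
          ring

theorem stft_ofSchwartz (g φ : 𝓢(Space d, ℂ)) (x ξ : Space d) :
    stft g (ofSchwartz φ) x ξ = cross φ (conjS g) x ξ := by
  rw [stft, ofSchwartz_apply, cross_eq]
  refine integral_congr_ae (.of_forall fun y ↦ ?_)
  simp only [conjShift_apply, conjS_apply]
  ring

theorem stft_add (g : 𝓢(Space d, ℂ)) (f h : 𝓢'(Space d, ℂ)) (x ξ : Space d) :
    stft g (f + h) x ξ = stft g f x ξ + stft g h x ξ := rfl

theorem stft_smul (g : 𝓢(Space d, ℂ)) (c : ℂ) (f : 𝓢'(Space d, ℂ)) (x ξ : Space d) :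
    stft g (c • f) x ξ = c * stft g f x ξ := rfl

/-- The modulation norm of a Schwartz function is finite. -/
theorem modNorm_ofSchwartz_lt_top (g : 𝓢(Space d, ℂ)) {p q : ℝ≥0∞} (hp : 1 ≤ p) (hq : 1 ≤ q)
    (s : ℝ) (φ : 𝓢(Space d, ℂ)) : modNorm g p q s (ofSchwartz φ) < ∞ := by
  obtain ⟨n, hn⟩ := exists_nat_abs_le s
  obtain ⟨P, -, hP⟩ := exists_cross_le (conjS g) (n + (d + 1))
  set M := n + (d + 1) with hM
  set c := ENNReal.ofReal (2 ^ (|s| / 2)) with hc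
  set D := eLpNorm (decay M : Space d → ℝ≥0∞) p volume with hDdef
  have hD : D ≠ ∞ := (eLpNorm_decay_lt_top (by omega) hp).ne
  have hbound : ∀ x ξ, ‖stft g (ofSchwartz φ) x ξ‖ₑ ≤
      ENNReal.ofReal (P φ) * decay M ξ * decay M x := by
    intro x ξ
    have h := hP φ x ξ
    rw [stft_ofSchwartz, ← ofReal_norm, decay, decay, ← ENNReal.ofReal_mul (apply_nonneg _ _),
      ← ENNReal.ofReal_mul (mul_nonneg (apply_nonneg _ _) (by positivity))]
    refine ENNReal.ofReal_le_ofReal ?_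
    rw [mul_assoc, ← mul_inv, ← div_eq_mul_inv, le_div_iff₀ (by positivity)]
    linarith
  have hpt : ∀ ξ, weight s ξ * eLpNorm (fun x ↦ ‖stft g (ofSchwartz φ) x ξ‖ₑ) p volume ≤
      (ENNReal.ofReal (P φ) * D * c) * decay (d + 1) ξ := by
    intro ξ
    calc _ ≤ weight s ξ * eLpNorm (fun x ↦ ENNReal.ofReal (P φ) * decay M ξ * decay M x) p
          volume := by
          gcongr
          exact eLpNorm_mono_ennreal _ fun x ↦ hbound x ξ
      _ ≤ weight s ξ * (ENNReal.ofReal (P φ) * decay M ξ * D) := by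
          gcongr
          exact eLpNorm_const_mul_ennreal (measurable_decay M) _ (zero_lt_one.trans_le hp).ne'
      _ = (ENNReal.ofReal (P φ) * D) * (weight s ξ * decay M ξ) := by ring
      _ ≤ (ENNReal.ofReal (P φ) * D) * (c * decay (d + 1) ξ) := by
          exact mul_le_mul_right (weight_mul_decay_le_decay hn (d + 1) ξ) _
      _ = _ := by ring
  rw [modNorm_eq_mixNorm]
  calc _ ≤ eLpNorm (fun ξ ↦ (ENNReal.ofReal (P φ) * D * c) * decay (d + 1) ξ) q volume :=
        eLpNorm_mono_ennreal _ hpt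
    _ ≤ (ENNReal.ofReal (P φ) * D * c) * eLpNorm (decay (d + 1)) q volume :=
        eLpNorm_const_mul_ennreal (measurable_decay _) _ (zero_lt_one.trans_le hq).ne'
    _ < ∞ := ENNReal.mul_lt_top (ENNReal.mul_lt_top (ENNReal.mul_lt_top ENNReal.ofReal_lt_top
        hD.lt_top) ENNReal.ofReal_lt_top) (eLpNorm_decay_lt_top (by omega) hq)

theorem modNorm_add_le (g : 𝓢(Space d, ℂ)) {p q : ℝ≥0∞} (hp : 1 ≤ p) (hq : 1 ≤ q) (s : ℝ)
    (f h : 𝓢'(Space d, ℂ)) :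
    modNorm g p q s (f + h) ≤ modNorm g p q s f + modNorm g p q s h := by
  rw [modNorm_eq_mixNorm, modNorm_eq_mixNorm, modNorm_eq_mixNorm]
  refine le_trans (mixNorm_mono fun x ξ ↦ ?_)
    (mixNorm_add_le hp hq (measurable_enorm_stft g f) (measurable_enorm_stft g h))
  rw [stft_add]
  exact enorm_add_le _ _

theorem modNorm_smul_le (g : 𝓢(Space d, ℂ)) {p q : ℝ≥0∞} (hp : 1 ≤ p) (hq : 1 ≤ q) (s : ℝ)
    (c : ℂ) (f : 𝓢'(Space d, ℂ)) : modNorm g p q s (c • f) ≤ ‖c‖ₑ * modNorm g p q s f := by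
  simp_rw [modNorm_eq_mixNorm, stft_smul, enorm_mul]
  exact mixNorm_const_mul_le (zero_lt_one.trans_le hp).ne' (zero_lt_one.trans_le hq).ne'
    (measurable_enorm_stft g f) _

@[simp]
theorem modNorm_zero (g : 𝓢(Space d, ℂ)) (p q : ℝ≥0∞) (s : ℝ) :
    modNorm g p q s (0 : 𝓢'(Space d, ℂ)) = 0 := by
  have : ∀ x ξ, stft g (0 : 𝓢'(Space d, ℂ)) x ξ = 0 := fun _ _ ↦ rfl
  simp [modNorm, this]

theorem modNorm_neg (g : 𝓢(Space d, ℂ)) (p q : ℝ≥0∞) (s : ℝ) (f : 𝓢'(Space d, ℂ)) :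
    modNorm g p q s (-f) = modNorm g p q s f := by
  have : ∀ x ξ, ‖stft g (-f) x ξ‖ₑ = ‖stft g f x ξ‖ₑ := fun x ξ ↦ enorm_neg (stft g f x ξ)
  simp_rw [modNorm_eq_mixNorm, this]

theorem modNorm_sub_comm (g : 𝓢(Space d, ℂ)) (p q : ℝ≥0∞) (s : ℝ) (f h : 𝓢'(Space d, ℂ)) :
    modNorm g p q s (f - h) = modNorm g p q s (h - f) := by
  rw [← modNorm_neg, neg_sub]

/-- Fatou's lemma for finite `q`; for `q = ∞` the countably many exceptional null sets are merged.
No measurability of `F` is asked for, since it is only dominated by the limit inferior. -/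
theorem eLpNorm_le_of_le_liminf {α : Type*} [MeasurableSpace α] {μ : Measure α} {q : ℝ≥0∞}
    (hq : q ≠ 0) {F : α → ℝ≥0∞} {G : ℕ → α → ℝ≥0∞} (hG : ∀ n, Measurable (G n)) {C : ℝ≥0∞}
    (hC : ∀ n, eLpNorm (G n) q μ ≤ C) (h : ∀ x, F x ≤ liminf (fun n ↦ G n x) atTop) :
    eLpNorm F q μ ≤ C := by
  rcases eq_or_ne q ∞ with rfl | ht
  · refine eLpNorm_top_le ?_
    have : ∀ᵐ x ∂μ, ∀ n, G n x ≤ C := ae_all_iff.2 fun n ↦ eLpNorm_top_le_iff.1 (hC n)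
    filter_upwards [this] with x hx
    refine (h x).trans ?_
    exact liminf_le_of_frequently_le' (.of_forall hx)
  · have hq' : 0 < q.toReal := ENNReal.toReal_pos hq ht
    rw [eLpNorm_ennreal hq ht, one_div, ENNReal.rpow_inv_le_iff hq']
    have hC' : ∀ n, ∫⁻ x, G n x ^ q.toReal ∂μ ≤ C ^ q.toReal := fun n ↦ by
      have := hC n
      rwa [eLpNorm_ennreal hq ht, one_div, ENNReal.rpow_inv_le_iff hq'] at this
    calc ∫⁻ x, F x ^ q.toReal ∂μ ≤ ∫⁻ x, liminf (fun n ↦ G n x ^ q.toReal) atTop ∂μ := by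
          refine lintegral_mono fun x ↦ ?_
          have h1 := (ENNReal.orderIsoRpow q.toReal hq').liminf_apply (f := atTop)
            (u := fun n ↦ G n x)
          simp only [ENNReal.orderIsoRpow_apply] at h1
          rw [← h1]
          exact ENNReal.rpow_le_rpow (h x) hq'.le
      _ ≤ liminf (fun n ↦ ∫⁻ x, G n x ^ q.toReal ∂μ) atTop :=
          lintegral_liminf_le fun n ↦ (hG n).pow_const _
      _ ≤ _ := liminf_le_of_frequently_le' (.of_forall hC')

/-- Bounds for the modulation norm pass to weak limits. -/
theorem modNorm_le_of_tendsto (g : 𝓢(Space d, ℂ)) {p q : ℝ≥0∞} (hq : 1 ≤ q) (s : ℝ)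
    {f : ℕ → 𝓢'(Space d, ℂ)} {F : 𝓢'(Space d, ℂ)} (hF : ∀ ψ, Tendsto (fun n ↦ f n ψ) atTop (𝓝 (F ψ)))
    {C : ℝ≥0∞} (hC : ∀ n, modNorm g p q s (f n) ≤ C) : modNorm g p q s F ≤ C := by
  simp_rw [modNorm_eq_mixNorm] at hC ⊢
  refine eLpNorm_le_of_le_liminf (zero_lt_one.trans_le hq).ne'
    (fun n ↦ measurable_weight_mul_eLpNorm (measurable_enorm_stft g (f n)) p s) hC fun ξ ↦ ?_
  simp_rw [eLpNorm_enorm]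
  rw [ENNReal.liminf_const_mul_of_ne_top (weight_ne_top s ξ)]
  gcongr
  refine Lp.eLpNorm_lim_le_liminf_eLpNorm (fun n ↦ ?_) _ (.of_forall fun x ↦ hF _)
  exact ((continuous_stft g (f n)).comp
    (Continuous.prodMk_left ξ)).aestronglyMeasurable

end ModNorm

/-! ### The entire function `cos (2π√r)` and the decay of its derivatives. -/

section CosSqrt

open scoped ContDiff Nat

/-- The coefficients of the power series of `r ↦ cos (2π √r)`. -/
def cosSqrtCoeff (n : ℕ) : ℝ := (-1) ^ n * (2 * Real.pi) ^ (2 * n) / (2 * n)!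

/-- The entire function `r ↦ cos (2π √r)`. -/
def cosSqrt (r : ℝ) : ℝ := FormalMultilinearSeries.ofScalarsSum cosSqrtCoeff r

theorem cosSqrt_sq (x : ℝ) : cosSqrt (x ^ 2) = Real.cos (2 * Real.pi * x) := by
  rw [cosSqrt, FormalMultilinearSeries.ofScalars_sum_eq, ← (Real.hasSum_cos _).tsum_eq]
  refine tsum_congr fun n ↦ ?_
  rw [cosSqrtCoeff, smul_eq_mul, mul_pow (2 * Real.pi) x, ← pow_mul]
  ring

theorem cosSqrtCoeff_ne_zero (n : ℕ) : cosSqrtCoeff n ≠ 0 := by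
  have := Real.pi_pos
  rw [cosSqrtCoeff]
  positivity

/-- The ratio test gives infinite radius of convergence. As a function of `|ξ|²` the wave symbol is
therefore smooth at the origin as well, where `|ξ|` is not. -/
theorem contDiff_cosSqrt : ContDiff ℝ ∞ cosSqrt := by
  have hr : (FormalMultilinearSeries.ofScalars ℝ cosSqrtCoeff).radius = ⊤ := by
    refine FormalMultilinearSeries.ofScalars_radius_eq_top_of_tendsto ℝ cosSqrtCoeff
      (.of_forall cosSqrtCoeff_ne_zero) ?_
    have h : ∀ n, ‖cosSqrtCoeff n.succ‖ / ‖cosSqrtCoeff n‖ =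
        (2 * Real.pi) ^ 2 * (1 / ((2 * n + 2 : ℝ) * (2 * n + 1))) := by
      intro n
      have hpi := Real.pi_pos
      have hf : ((2 * n)! : ℝ) ≠ 0 := by positivity
      have h2 : ((2 * (n + 1))! : ℝ) = (2 * n + 2) * ((2 * n + 1) * (2 * n)!) := by
        rw [show 2 * (n + 1) = 2 * n + 1 + 1 by ring, Nat.factorial_succ, Nat.factorial_succ]
        push_cast
        ring
      simp only [cosSqrtCoeff, norm_div, norm_mul, norm_pow, norm_neg, norm_one, one_pow, one_mul,
        Nat.succ_eq_add_one, Real.norm_natCast, h2]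
      rw [Real.norm_of_nonneg (by positivity : (0 : ℝ) ≤ 2), Real.norm_of_nonneg hpi.le,
        show 2 * (n + 1) = 2 * n + 2 by ring, pow_add,
        Real.norm_of_nonneg (by positivity : (0 : ℝ) ≤ 2 * n + 2),
        Real.norm_of_nonneg (by positivity : (0 : ℝ) ≤ 2 * n + 1)]
      field_simp
    simp_rw [h]
    have hlim : Tendsto (fun n : ℕ ↦ 1 / ((2 * n + 2 : ℝ) * (2 * n + 1))) atTop (𝓝 0) := ?_
    · simpa using hlim.const_mul ((2 * Real.pi) ^ 2)
    refine squeeze_zero (fun n ↦ by positivity) (fun n ↦ ?_) tendsto_one_div_add_atTop_nhds_zero_nat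
    refine one_div_le_one_div_of_le (by positivity) ?_
    nlinarith [(Nat.cast_nonneg n : (0 : ℝ) ≤ n)]
  have hb := (FormalMultilinearSeries.ofScalars ℝ cosSqrtCoeff).hasFPowerSeriesOnBall
    (by rw [hr]; exact ENNReal.zero_lt_top)
  rw [hr] at hb
  have ha : AnalyticOnNhd ℝ cosSqrt univ := fun x _ ↦ hb.analyticAt_of_mem (by simp)
  exact ha.contDiff

theorem hasDerivAt_iteratedDeriv_cosSqrt (k : ℕ) (r : ℝ) :
    HasDerivAt (iteratedDeriv k cosSqrt) (iteratedDeriv (k + 1) cosSqrt r) r := by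
  rw [iteratedDeriv_succ]
  exact ((contDiff_cosSqrt.of_le (by exact_mod_cast le_top)).differentiable_iteratedDeriv k
    (n := (k + 1 : ℕ)) (by exact_mod_cast Nat.lt_succ_self k) r).hasDerivAt

theorem hasDerivAt_iteratedDeriv_cosSqrt_sq (k : ℕ) (x : ℝ) :
    HasDerivAt (fun x ↦ iteratedDeriv k cosSqrt (x ^ 2))
      (iteratedDeriv (k + 1) cosSqrt (x ^ 2) * (2 * x)) x := by
  have h : HasDerivAt (fun x : ℝ ↦ x ^ 2) (2 * x) x := by simpa using hasDerivAt_pow 2 x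
  exact (hasDerivAt_iteratedDeriv_cosSqrt k (x ^ 2)).comp x h

theorem iteratedDeriv_one_cosSqrt_sq (x : ℝ) :
    iteratedDeriv 1 cosSqrt (x ^ 2) * (2 * x) = -(2 * Real.pi * Real.sin (2 * Real.pi * x)) := by
  have h1 := hasDerivAt_iteratedDeriv_cosSqrt_sq 0 x
  simp only [iteratedDeriv_zero, cosSqrt_sq] at h1
  have h2 := ((hasDerivAt_id x).const_mul (2 * Real.pi)).cos
  rw [h1.unique h2]
  simp
  ring

/-- Differentiating `2x G'(x²) = -2π sin(2πx)` once more gives the equation `4r G'' + 2G' + 4π² G =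
0` at `r = x²`. -/
theorem iteratedDeriv_two_cosSqrt_sq (x : ℝ) :
    4 * x ^ 2 * iteratedDeriv 2 cosSqrt (x ^ 2) + 2 * iteratedDeriv 1 cosSqrt (x ^ 2) +
      4 * Real.pi ^ 2 * cosSqrt (x ^ 2) = 0 := by
  have h1 := (hasDerivAt_iteratedDeriv_cosSqrt_sq 1 x).mul ((hasDerivAt_id x).const_mul 2)
  have h2 := ((((hasDerivAt_id x).const_mul (2 * Real.pi)).sin).const_mul (2 * Real.pi)).neg
  have h3 : ((fun x ↦ iteratedDeriv 1 cosSqrt (x ^ 2)) * fun y ↦ 2 * id y) =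
      -fun x ↦ 2 * Real.pi * Real.sin (2 * Real.pi * id x) :=
    funext fun x ↦ iteratedDeriv_one_cosSqrt_sq x
  rw [h3] at h1
  have h4 := h1.unique h2
  rw [cosSqrt_sq]
  simp only [id, mul_one] at h4
  linarith

/-- The `k`-th derivative of the differential equation. The open half-line `r > 0` allows both the
substitution `r = x²` and the differentiation of an identity that vanishes near `r`. -/
theorem iteratedDeriv_cosSqrt_recurrence (k : ℕ) {r : ℝ} (hr : 0 < r) :
    4 * r * iteratedDeriv (k + 2) cosSqrt r + (4 * k + 2) * iteratedDeriv (k + 1) cosSqrt r +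
      4 * Real.pi ^ 2 * iteratedDeriv k cosSqrt r = 0 := by
  induction k generalizing r with
  | zero =>
    have := iteratedDeriv_two_cosSqrt_sq (Real.sqrt r)
    rw [Real.sq_sqrt hr.le] at this
    simpa using this
  | succ k ih =>
    have h1 : HasDerivAt (fun r ↦ 4 * r * iteratedDeriv (k + 2) cosSqrt r +
        (4 * k + 2) * iteratedDeriv (k + 1) cosSqrt r + 4 * Real.pi ^ 2 * iteratedDeriv k cosSqrt r)
        ((4 * 1) * iteratedDeriv (k + 2) cosSqrt r + 4 * r * iteratedDeriv (k + 3) cosSqrt r +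
        (4 * k + 2) * iteratedDeriv (k + 2) cosSqrt r +
        4 * Real.pi ^ 2 * iteratedDeriv (k + 1) cosSqrt r) r :=
      ((((hasDerivAt_id r).const_mul 4).mul (hasDerivAt_iteratedDeriv_cosSqrt (k + 2) r)).add
        ((hasDerivAt_iteratedDeriv_cosSqrt (k + 1) r).const_mul _)).add
        ((hasDerivAt_iteratedDeriv_cosSqrt k r).const_mul _)
    have h2 : HasDerivAt (fun _ : ℝ ↦ (0 : ℝ)) 0 r := hasDerivAt_const r 0
    have h3 := h1.unique (h2.congr_of_eventuallyEq
      ((eventually_gt_nhds hr).mono fun y hy ↦ ih hy))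
    push_cast
    linarith

/-- The recurrence expresses `x²` times derivative `k + 2` by the two preceding derivatives, so a
two-step induction starting from the boundedness of cosine and sine gives one power of decay per
derivative. -/
theorem exists_pow_mul_iteratedDeriv_cosSqrt_le (k : ℕ) :
    ∃ c, ∀ x : ℝ, 1 ≤ x → x ^ k * |iteratedDeriv k cosSqrt (x ^ 2)| ≤ c := by
  induction k using Nat.twoStepInduction with
  | zero =>
    refine ⟨1, fun x _ ↦ ?_⟩
    rw [iteratedDeriv_zero, cosSqrt_sq, pow_zero, one_mul]
    exact Real.abs_cos_le_one _
  | one =>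
    refine ⟨Real.pi, fun x hx ↦ ?_⟩
    have h := congrArg abs (iteratedDeriv_one_cosSqrt_sq x)
    rw [abs_neg, abs_mul, abs_mul (2 * Real.pi), abs_of_nonneg (by linarith : 0 ≤ 2 * x),
      abs_of_pos Real.two_pi_pos] at h
    have h2 : 2 * Real.pi * |Real.sin (2 * Real.pi * x)| ≤ 2 * Real.pi * 1 := by
      gcongr
      exact Real.abs_sin_le_one _
    rw [pow_one]
    linarith
  | more k ih1 ih2 =>
    obtain ⟨c₁, h₁⟩ := ih1
    obtain ⟨c₂, h₂⟩ := ih2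
    refine ⟨((4 * k + 2) * c₂ + 4 * Real.pi ^ 2 * c₁) / 4, fun x hx ↦ ?_⟩
    have hx0 : 0 < x := by linarith
    have h := iteratedDeriv_cosSqrt_recurrence k (pow_pos hx0 2)
    set a := iteratedDeriv (k + 2) cosSqrt (x ^ 2)
    set b := iteratedDeriv (k + 1) cosSqrt (x ^ 2)
    set e := iteratedDeriv k cosSqrt (x ^ 2)
    have h3 : 4 * x ^ 2 * |a| ≤ (4 * k + 2) * |b| + 4 * Real.pi ^ 2 * |e| := by
      have h4 : 4 * x ^ 2 * a = -((4 * k + 2) * b + 4 * Real.pi ^ 2 * e) := by linarith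
      have h5 := congrArg abs h4
      rw [abs_neg, abs_mul, abs_of_pos (by positivity : 0 < 4 * x ^ 2)] at h5
      rw [h5]
      refine (abs_add_le _ _).trans ?_
      rw [abs_mul, abs_mul, abs_of_pos (by positivity : (0 : ℝ) < 4 * k + 2),
        abs_of_nonneg (by positivity : (0 : ℝ) ≤ 4 * Real.pi ^ 2)]
    -- The term of order `k + 1` has a power of `x` to spare; `1 ≤ x` is used here.
    have h6 : x ^ k * |b| ≤ x ^ (k + 1) * |b| := by
      gcongr
      · exact Nat.le_succ k
    have h7 : x ^ k * (4 * x ^ 2 * |a|) ≤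
        x ^ k * ((4 * k + 2) * |b| + 4 * Real.pi ^ 2 * |e|) := by gcongr
    have h8 : (4 * k + 2) * (x ^ k * |b|) ≤ (4 * k + 2) * c₂ := by
      gcongr
      exact h6.trans (h₂ x hx)
    have h9 : 4 * Real.pi ^ 2 * (x ^ k * |e|) ≤ 4 * Real.pi ^ 2 * c₁ := by
      gcongr
      exact h₁ x hx
    rw [pow_add, le_div_iff₀ (by norm_num)]
    linarith

/-- `G` is smooth and `G^(k) (x²) = O (x^(-k-m))`. -/
def HasRadialDecay (m : ℕ) (G : ℝ → ℝ) : Prop :=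
  ContDiff ℝ ∞ G ∧
    ∀ k, ∃ c, 0 ≤ c ∧ ∀ x, 0 ≤ x → |iteratedDeriv k G (x ^ 2)| ≤ c * ((1 + x) ^ (m + k))⁻¹

theorem HasRadialDecay.deriv {m : ℕ} {G : ℝ → ℝ} (h : HasRadialDecay m G) :
    HasRadialDecay (m + 1) (deriv G) := by
  refine ⟨(contDiff_infty_iff_deriv.1 h.1).2, fun k ↦ ?_⟩
  obtain ⟨c, hc, hk⟩ := h.2 (k + 1)
  refine ⟨c, hc, fun x hx ↦ ?_⟩
  rw [← iteratedDeriv_succ', add_right_comm, add_assoc]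
  exact hk x hx

theorem HasRadialDecay.const_mul {m : ℕ} {G : ℝ → ℝ} (h : HasRadialDecay m G) (a : ℝ) :
    HasRadialDecay m fun r ↦ a * G r := by
  refine ⟨contDiff_const.mul h.1, fun k ↦ ?_⟩
  obtain ⟨c, hc, hk⟩ := h.2 k
  refine ⟨|a| * c, by positivity, fun x hx ↦ ?_⟩
  rw [iteratedDeriv_const_mul_field, abs_mul, mul_assoc]
  gcongr
  exact hk x hx

/-- Compactness for `x ≤ 1` and the recurrence bounds for `x ≥ 1`, where `1 + x ≤ 2x`. -/
theorem hasRadialDecay_cosSqrt : HasRadialDecay 0 cosSqrt := by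
  refine ⟨contDiff_cosSqrt, fun k ↦ ?_⟩
  obtain ⟨c₁, h₁⟩ := exists_pow_mul_iteratedDeriv_cosSqrt_le k
  have hcont : Continuous fun x : ℝ ↦ iteratedDeriv k cosSqrt (x ^ 2) :=
    (contDiff_cosSqrt.continuous_iteratedDeriv k (by exact_mod_cast le_top)).comp (by fun_prop)
  obtain ⟨c₂, h₂⟩ := (isCompact_Icc (a := (0 : ℝ)) (b := 1)).exists_bound_of_continuousOn
    hcont.continuousOn
  refine ⟨2 ^ k * max |c₁| |c₂|, by positivity, fun x hx ↦ ?_⟩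
  rw [zero_add, ← div_eq_mul_inv, le_div_iff₀ (by positivity)]
  rcases le_total x 1 with h | h
  · have h3 := h₂ x ⟨hx, h⟩
    rw [Real.norm_eq_abs] at h3
    calc _ ≤ max |c₁| |c₂| * 2 ^ k := by
          gcongr
          · exact h3.trans ((le_abs_self _).trans (le_max_right _ _))
          · linarith
      _ = _ := mul_comm _ _
  · calc |iteratedDeriv k cosSqrt (x ^ 2)| * (1 + x) ^ k
        ≤ |iteratedDeriv k cosSqrt (x ^ 2)| * (2 * x) ^ k := by
          gcongr
          linarith
      _ = 2 ^ k * (x ^ k * |iteratedDeriv k cosSqrt (x ^ 2)|) := by rw [mul_pow]; ring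
      _ ≤ _ := by
          gcongr
          exact (h₁ x h).trans ((le_abs_self _).trans (le_max_left _ _))

/-- Expressing the sine propagator through `G'` is what yields its gain of one order: every
derivative of `G` decays by one more power. -/
theorem sinc_eq_deriv_cosSqrt (x : ℝ) :
    Real.sinc (2 * Real.pi * x) = -(2 * Real.pi ^ 2)⁻¹ * deriv cosSqrt (x ^ 2) := by
  have hpi := Real.pi_ne_zero
  rw [← iteratedDeriv_one]
  -- At `x = 0` the first-order identity is void; the differential equation gives the value `G'(0) =
  -- -2π²` instead.
  rcases eq_or_ne x 0 with rfl | hx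
  · have h := iteratedDeriv_two_cosSqrt_sq 0
    rw [cosSqrt_sq] at h
    simp only [mul_zero, Real.cos_zero, Real.sinc_zero] at h ⊢
    field_simp
    linarith
  · have h := iteratedDeriv_one_cosSqrt_sq x
    rw [Real.sinc_of_ne_zero (by positivity)]
    field_simp
    linarith

end CosSqrt

/-! ### Symbol estimates for the wave propagators. -/

section Symbols

open scoped ContDiff

variable {E : Type*} [NormedAddCommGroup E] [InnerProductSpace ℝ E]

theorem norm_iteratedFDeriv_clm_le {F : Type*} [NormedAddCommGroup F] [NormedSpace ℝ F]
    (L : E →L[ℝ] F) (j : ℕ) (x : E) : ‖iteratedFDeriv ℝ j L x‖ ≤ ‖L‖ * (1 + ‖x‖) := by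
  have h0 := norm_nonneg x
  have hL := norm_nonneg L
  rcases j with _ | j
  · rw [norm_iteratedFDeriv_zero]
    exact (L.le_opNorm x).trans (by gcongr; linarith)
  · rw [← norm_iteratedFDeriv_fderiv]
    have : fderiv ℝ L = fun _ ↦ L := funext fun x ↦ L.fderiv
    rw [this]
    rcases j with _ | j
    · rw [norm_iteratedFDeriv_zero]
      nlinarith
    · rw [iteratedFDeriv_const_of_ne (Nat.succ_ne_zero j)]
      simp only [Pi.zero_apply, norm_zero]
      positivity

/-- The gradient of `G(|ξ|²)` is `G'(|ξ|²) · 2⟨ξ, ·⟩`: the extra order of decay of `G'` compensates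
the linear growth of the second factor, so no order is lost. Leibniz' rule needs all lower
derivatives of `G'(|ξ|²)`, hence strong induction over all `G` and `m`. -/
theorem HasRadialDecay.exists_norm_iteratedFDeriv_le (n : ℕ) :
    ∀ {m : ℕ} {G : ℝ → ℝ}, HasRadialDecay m G → ∃ B, 0 ≤ B ∧
      ∀ ξ : E, ‖iteratedFDeriv ℝ n (fun ξ ↦ G (‖ξ‖ ^ 2)) ξ‖ ≤ B * ((1 + ‖ξ‖) ^ m)⁻¹ := by
  induction n using Nat.strong_induction_on with
  | _ n ih =>
  intro m G hG
  rcases n with _ | n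
  · obtain ⟨c, hc, h⟩ := hG.2 0
    refine ⟨c, hc, fun ξ ↦ ?_⟩
    rw [norm_iteratedFDeriv_zero, Real.norm_eq_abs]
    simpa using h ‖ξ‖ (norm_nonneg _)
  · choose! B hB0 hB using fun i (hi : i < n + 1) ↦ ih i hi hG.deriv
    let L : E →L[ℝ] (E →L[ℝ] ℝ) := (2 : ℝ) • innerSL ℝ
    have hfd : fderiv ℝ (fun ξ : E ↦ G (‖ξ‖ ^ 2)) = fun ξ ↦ _root_.deriv G (‖ξ‖ ^ 2) • L ξ := by
      funext ξ
      have h1 : HasFDerivAt (fun ξ : E ↦ ‖ξ‖ ^ 2) (L ξ) ξ := by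
        have := (hasStrictFDerivAt_norm_sq ξ).hasFDerivAt
        convert! this using 1
        ext
        simp only [L, smul_apply, two_smul, add_apply]
      have h2 : HasDerivAt G (_root_.deriv G (‖ξ‖ ^ 2)) (‖ξ‖ ^ 2) :=
        (hG.1.differentiable (by simp) _).hasDerivAt
      exact (h2.comp_hasFDerivAt ξ h1).fderiv
    have hc1 : ContDiff ℝ ∞ fun ξ : E ↦ _root_.deriv G (‖ξ‖ ^ 2) :=
      hG.deriv.1.comp (contDiff_norm_sq ℝ)
    refine ⟨∑ i ∈ Finset.range (n + 1), n.choose i * (B i * ‖L‖), ?_, fun ξ ↦ ?_⟩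
    · exact Finset.sum_nonneg fun i hi ↦ mul_nonneg (by positivity)
        (mul_nonneg (hB0 i (Finset.mem_range.1 hi)) (ContinuousLinearMap.opNorm_nonneg L))
    · rw [← norm_iteratedFDeriv_fderiv, hfd]
      refine (norm_iteratedFDeriv_smul_le (N := ∞) hc1 L.contDiff ξ
        (by exact_mod_cast le_top)).trans ?_
      rw [Finset.sum_mul]
      refine Finset.sum_le_sum fun i hi ↦ ?_
      have hi' := Finset.mem_range.1 hi
      have hpos : 0 < 1 + ‖ξ‖ := by positivity
      calc (n.choose i : ℝ) * ‖iteratedFDeriv ℝ i (fun ξ : E ↦ _root_.deriv G (‖ξ‖ ^ 2)) ξ‖ *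
            ‖iteratedFDeriv ℝ (n - i) L ξ‖
          ≤ n.choose i * (B i * ((1 + ‖ξ‖) ^ (m + 1))⁻¹) * (‖L‖ * (1 + ‖ξ‖)) := by
            have := hB0 i hi'
            gcongr
            · exact hB i hi' ξ
            · exact norm_iteratedFDeriv_clm_le L _ ξ
        _ = _ := by
            rw [pow_succ, mul_inv]
            field_simp

/-- Smooth symbols whose derivatives are all `O ((1 + |ξ|)^(-m))`. -/
def IsSymbol (m : ℕ) (σ : E → ℂ) : Prop :=
  ContDiff ℝ ∞ σ ∧
    ∀ n, ∃ B, 0 ≤ B ∧ ∀ ξ, ‖iteratedFDeriv ℝ n σ ξ‖ ≤ B * ((1 + ‖ξ‖) ^ m)⁻¹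

theorem HasRadialDecay.isSymbol {m : ℕ} {G : ℝ → ℝ} (h : HasRadialDecay m G) :
    IsSymbol m fun ξ : E ↦ (G (‖ξ‖ ^ 2) : ℂ) := by
  refine ⟨Complex.ofRealCLM.contDiff.comp (h.1.comp (contDiff_norm_sq ℝ)), fun n ↦ ?_⟩
  obtain ⟨B, hB0, hB⟩ := h.exists_norm_iteratedFDeriv_le (E := E) n
  refine ⟨B, hB0, fun ξ ↦ ?_⟩
  have h1 : ContDiffAt ℝ n (fun ξ : E ↦ G (‖ξ‖ ^ 2)) ξ :=
    ((h.1.comp (contDiff_norm_sq ℝ)).of_le (by exact_mod_cast le_top)).contDiffAt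
  have h2 := Complex.ofRealLI.norm_iteratedFDeriv_comp_left h1 le_rfl
  exact h2.trans_le (hB ξ)

theorem IsSymbol.hasTemperateGrowth {m : ℕ} {σ : E → ℂ} (h : IsSymbol m σ) :
    σ.HasTemperateGrowth := by
  refine ⟨h.1, fun n ↦ ?_⟩
  obtain ⟨B, hB0, hB⟩ := h.2 n
  refine ⟨0, B, fun ξ ↦ (hB ξ).trans ?_⟩
  rw [pow_zero]
  gcongr
  exact inv_le_one_of_one_le₀ (one_le_pow₀ (by linarith [norm_nonneg ξ]))

theorem IsSymbol.norm_iteratedFDeriv_comp_smul_le {m : ℕ} {σ : E → ℂ} (h : IsSymbol m σ) (t : ℝ)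
    (n : ℕ) (ξ : E) :
    ‖iteratedFDeriv ℝ n (fun ξ ↦ σ (t • ξ)) ξ‖ ≤ |t| ^ n * ‖iteratedFDeriv ℝ n σ (t • ξ)‖ := by
  let L : E →L[ℝ] E := t • ContinuousLinearMap.id ℝ E
  have h1 : (fun ξ ↦ σ (t • ξ)) = σ ∘ L := rfl
  have hL : ‖L‖ ≤ |t| := by
    refine ContinuousLinearMap.opNorm_le_bound _ (abs_nonneg _) fun x ↦ ?_
    simp [L, norm_smul]
  rw [h1, L.iteratedFDeriv_comp_right h.1 ξ (i := n) (by exact_mod_cast le_top)]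
  refine (ContinuousMultilinearMap.norm_compContinuousLinearMap_le _ _).trans ?_
  rw [Finset.prod_const, Finset.card_univ, Fintype.card_fin, mul_comm]
  have : L ξ = t • ξ := rfl
  rw [this]
  gcongr

/-- The symbol `cos (2π |ξ|)`. -/
def cosSymbol (ξ : E) : ℂ := ((cosSqrt (‖ξ‖ ^ 2) : ℝ) : ℂ)

/-- The symbol `sinc (2π |ξ|)`. -/
def sincSymbol (ξ : E) : ℂ := ((-(2 * Real.pi ^ 2)⁻¹ * deriv cosSqrt (‖ξ‖ ^ 2) : ℝ) : ℂ)

theorem isSymbol_cosSymbol : IsSymbol 0 (cosSymbol : E → ℂ) := hasRadialDecay_cosSqrt.isSymbol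

theorem isSymbol_sincSymbol : IsSymbol 1 (sincSymbol : E → ℂ) :=
  (hasRadialDecay_cosSqrt.deriv.const_mul (-(2 * Real.pi ^ 2)⁻¹)).isSymbol

theorem cosSymbol_smul (t : ℝ) (ξ : E) :
    cosSymbol (t • ξ) = ((Real.cos (2 * Real.pi * t * ‖ξ‖) : ℝ) : ℂ) := by
  rw [cosSymbol, cosSqrt_sq, norm_smul, Real.norm_eq_abs, mul_assoc (2 * Real.pi)]
  congr 1
  rw [← Real.cos_abs, ← Real.cos_abs (2 * Real.pi * (t * ‖ξ‖))]
  simp [abs_mul]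

theorem sincSymbol_smul (t : ℝ) (ξ : E) :
    sincSymbol (t • ξ) = ((Real.sinc (2 * Real.pi * t * ‖ξ‖) : ℝ) : ℂ) := by
  rw [sincSymbol, ← sinc_eq_deriv_cosSqrt, norm_smul, Real.norm_eq_abs, mul_assoc (2 * Real.pi)]
  congr 1
  rcases abs_choice t with h | h <;> rw [h]
  rw [neg_mul, mul_neg, Real.sinc_neg]

theorem IsSymbol.comp_smul {m : ℕ} {σ : E → ℂ} (h : IsSymbol m σ) (t : ℝ) :
    IsSymbol 0 fun ξ ↦ σ (t • ξ) := by
  refine ⟨h.1.comp (contDiff_const.smul contDiff_id), fun n ↦ ?_⟩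
  obtain ⟨B, hB0, hB⟩ := h.2 n
  refine ⟨|t| ^ n * B, by positivity, fun ξ ↦ (h.norm_iteratedFDeriv_comp_smul_le t n ξ).trans ?_⟩
  rw [pow_zero, inv_one, mul_one]
  gcongr
  refine (hB _).trans (mul_le_of_le_one_right hB0 ?_)
  exact inv_le_one_of_one_le₀ (one_le_pow₀ (by linarith [norm_nonneg (t • ξ)]))

/-- Uniform symbol bounds for the family `cos (2πt|ξ|)`. -/
theorem exists_cosSymbol_smul_le (n : ℕ) : ∃ B, 0 ≤ B ∧ ∀ t : ℝ, |t| ≤ 1 → ∀ ξ : E,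
    ‖iteratedFDeriv ℝ n (fun ξ : E ↦ cosSymbol (t • ξ)) ξ‖ ≤ B := by
  obtain ⟨B, hB0, hB⟩ := (isSymbol_cosSymbol (E := E)).2 n
  refine ⟨B, hB0, fun t ht ξ ↦
    (isSymbol_cosSymbol.norm_iteratedFDeriv_comp_smul_le t n ξ).trans ?_⟩
  have h := hB (t • ξ)
  rw [pow_zero, inv_one, mul_one] at h
  calc _ ≤ 1 * ‖iteratedFDeriv ℝ n (cosSymbol : E → ℂ) (t • ξ)‖ := by
        gcongr
        exact pow_le_one₀ (abs_nonneg t) ht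
    _ ≤ B := by rwa [one_mul]

theorem iteratedFDeriv_const_mul_sincSymbol (t : ℝ) (n : ℕ) (ξ : E) :
    ‖iteratedFDeriv ℝ n (fun ξ : E ↦ (t : ℂ) * sincSymbol (t • ξ)) ξ‖ =
      |t| * ‖iteratedFDeriv ℝ n (fun ξ : E ↦ sincSymbol (t • ξ)) ξ‖ := by
  have h : (fun ξ : E ↦ (t : ℂ) * sincSymbol (t • ξ)) =
      (t : ℂ) • fun ξ : E ↦ sincSymbol (t • ξ) := rfl
  rw [h, iteratedFDeriv_const_smul_apply ((isSymbol_sincSymbol.comp_smul t).1.of_le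
    (by exact_mod_cast le_top)).contDiffAt, norm_smul, Complex.norm_real, Real.norm_eq_abs]

/-- Uniform symbol bounds for the family `sin (2πt|ξ|) / (2π|ξ|)`. -/
theorem exists_sincSymbol_smul_le (n : ℕ) : ∃ B, 0 ≤ B ∧ ∀ t : ℝ, |t| ≤ 1 → ∀ ξ : E,
    ‖iteratedFDeriv ℝ n (fun ξ : E ↦ (t : ℂ) * sincSymbol (t • ξ)) ξ‖ ≤ B * |t| ∧
    ‖iteratedFDeriv ℝ n (fun ξ : E ↦ (t : ℂ) * sincSymbol (t • ξ)) ξ‖ ≤ B * (1 + ‖ξ‖)⁻¹ := by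
  obtain ⟨B, hB0, hB⟩ := (isSymbol_sincSymbol (E := E)).2 n
  refine ⟨B, hB0, fun t ht ξ ↦ ?_⟩
  have h0 : 0 < 1 + ‖ξ‖ := by positivity
  have h1 : ‖iteratedFDeriv ℝ n (fun ξ : E ↦ (t : ℂ) * sincSymbol (t • ξ)) ξ‖ ≤
      |t| * (B * (1 + ‖t • ξ‖)⁻¹) := by
    rw [iteratedFDeriv_const_mul_sincSymbol]
    gcongr
    refine (isSymbol_sincSymbol.norm_iteratedFDeriv_comp_smul_le t n ξ).trans ?_
    have h := hB (t • ξ)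
    rw [pow_one] at h
    calc _ ≤ 1 * ‖iteratedFDeriv ℝ n (sincSymbol : E → ℂ) (t • ξ)‖ := by
          gcongr
          exact pow_le_one₀ (abs_nonneg t) ht
      _ ≤ _ := by rwa [one_mul]
  have hz : 0 < 1 + ‖t • ξ‖ := by positivity
  constructor
  · refine h1.trans ?_
    rw [mul_comm]
    gcongr
    exact mul_le_of_le_one_right hB0 (inv_le_one_of_one_le₀ (by linarith [norm_nonneg (t • ξ)]))
  · refine h1.trans ?_
    rw [mul_left_comm]
    gcongr
    -- What remains is `|t| (1 + |ξ|) ≤ 1 + |t||ξ|`, that is, `|t| ≤ 1`: the prefactor `t` makes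
    -- decay in `tξ` as good as decay in `ξ`.
    rw [← div_eq_mul_inv, div_le_iff₀ hz, ← div_eq_inv_mul, le_div_iff₀ h0, norm_smul,
      Real.norm_eq_abs]
    nlinarith [norm_nonneg ξ]

end Symbols

/-! ### Fourier multipliers and wave propagators on modulation spaces. -/

section Multipliers

open FourierTransform

variable {d : ℕ}

theorem character_comm (ξ y : Space d) : character ξ y = character y ξ := by
  rw [character, character, real_inner_comm]

theorem fourierInv_tfShift (ψ : 𝓢(Space d, ℂ)) (x ξ η : Space d) :
    𝓕⁻ (tfShift ψ x ξ) η = character (ξ - η) x * 𝓕⁻ ψ (η - ξ) := by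
  rw [fourierInv_eq_character, fourierInv_eq_character, ← integral_const_mul,
    ← integral_add_right_eq_self (fun y ↦ character (-y) η * tfShift ψ x ξ y) x]
  refine integral_congr_ae (.of_forall fun y ↦ ?_)
  have h1 : ∀ z : Space d, character (-z) η * character ξ z = character (ξ - η) z := by
    intro z
    rw [sub_eq_add_neg, character_add_left, mul_comm]
    congr 1
    rw [character, character, inner_neg_left, inner_neg_left, real_inner_comm]
  have h2 : character (-y) (η - ξ) = character (ξ - η) y := by
    rw [character, character, inner_neg_left, ← inner_neg_right, neg_sub, real_inner_comm]
  simp only [tfShift_apply, add_sub_cancel_right, h2]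
  rw [← mul_assoc, h1, character_add_right]
  ring

theorem hasTemperateGrowth_comp_add {σ : Space d → ℂ} (hσ : σ.HasTemperateGrowth) (ξ : Space d) :
    (fun η ↦ σ (η + ξ)).HasTemperateGrowth := by
  have h : (fun η : Space d ↦ η + ξ).HasTemperateGrowth := by fun_prop
  exact hσ.comp h

/-- Commuting a multiplier past a time-frequency shift translates its symbol by `ξ`. Testing `σ(D)f`
with a shifted window thus amounts to testing `f` with the same shift of a window depending on `ξ`
alone. -/
theorem multiplier_tfShift {σ : Space d → ℂ} (hσ : σ.HasTemperateGrowth) (ψ : 𝓢(Space d, ℂ))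
    (x ξ : Space d) :
    𝓕 (SchwartzMap.smulLeftCLM ℂ σ (𝓕⁻ (tfShift ψ x ξ))) =
      tfShift (𝓕 (SchwartzMap.smulLeftCLM ℂ (fun η ↦ σ (η + ξ)) (𝓕⁻ ψ))) x ξ := by
  set Φ := SchwartzMap.smulLeftCLM ℂ (fun η ↦ σ (η + ξ)) (𝓕⁻ ψ) with hΦ
  have h : SchwartzMap.smulLeftCLM ℂ σ (𝓕⁻ (tfShift ψ x ξ)) = 𝓕⁻ (tfShift (𝓕 Φ) x ξ) := by
    ext η
    rw [SchwartzMap.smulLeftCLM_apply_apply hσ, fourierInv_tfShift, fourierInv_tfShift,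
      FourierTransform.fourierInv_fourier_eq, hΦ,
      SchwartzMap.smulLeftCLM_apply_apply (hasTemperateGrowth_comp_add hσ ξ), sub_add_cancel,
      smul_eq_mul, smul_eq_mul]
    ring
  rw [h, FourierTransform.fourier_fourierInv_eq]

/-- Leibniz' rule together with `(1 + |x + ξ|)^{-m} ≤ (1 + |x|)^m (1 + |ξ|)^{-m}`; the growth in `x`
is absorbed by `γ`. The modified windows are therefore of size `⟨ξ⟩^{-m}`, which is the gain of `m`
derivatives. -/
theorem schwartzSeminorm_smulLeft_le {σ : Space d → ℂ} (hσ : σ.HasTemperateGrowth) (m k n : ℕ)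
    {B : ℝ} (hB0 : 0 ≤ B)
    (hB : ∀ i ≤ n, ∀ ξ, ‖iteratedFDeriv ℝ i σ ξ‖ ≤ B * ((1 + ‖ξ‖) ^ m)⁻¹) (γ : 𝓢(Space d, ℂ))
    (ξ : Space d) :
    SchwartzMap.seminorm ℝ k n (SchwartzMap.smulLeftCLM ℂ (fun η ↦ σ (η + ξ)) γ) ≤
      B * ((1 + ‖ξ‖) ^ m)⁻¹ * (2 ^ n * jetSeminorm (k + m) n γ) := by
  have hj : 0 ≤ jetSeminorm (k + m) n γ := apply_nonneg _ _
  have hσξ := hasTemperateGrowth_comp_add hσ ξ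
  refine SchwartzMap.seminorm_le_bound ℝ k n _ (by positivity) fun x ↦ ?_
  have h1 := norm_iteratedFDeriv_mul_le (𝕜 := ℝ) hσξ.1 (γ.smooth ⊤) x (n := n)
    (by exact_mod_cast le_top)
  have h2 : ∀ i ∈ Finset.range (n + 1), ‖x‖ ^ k * ((n.choose i : ℝ) *
      ‖iteratedFDeriv ℝ i (fun η ↦ σ (η + ξ)) x‖ * ‖iteratedFDeriv ℝ (n - i) γ x‖) ≤
      n.choose i * (B * ((1 + ‖ξ‖) ^ m)⁻¹ * jetSeminorm (k + m) n γ) := by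
    intro i hi
    have hin : i ≤ n := Nat.lt_succ_iff.1 (Finset.mem_range.1 hi)
    have h3 := one_add_pow_mul_le_jetSeminorm (k + m) (Nat.sub_le n i) γ x
    have h4 := hB i hin (x + ξ)
    rw [iteratedFDeriv_comp_add_right]
    have h5 : ((1 + ‖x + ξ‖) ^ m)⁻¹ ≤ (1 + ‖x‖) ^ m * ((1 + ‖ξ‖) ^ m)⁻¹ := by
      rw [← div_eq_mul_inv, inv_eq_one_div, div_le_div_iff₀ (by positivity) (by positivity),
        one_mul, ← mul_pow]
      gcongr
      have := norm_sub_le (x + ξ) x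
      rw [add_sub_cancel_left] at this
      nlinarith [norm_nonneg x, norm_nonneg (x + ξ)]
    have h6 : ‖x‖ ^ k ≤ (1 + ‖x‖) ^ k := by
      gcongr
      linarith
    calc _ ≤ (1 + ‖x‖) ^ k * ((n.choose i : ℝ) *
          (B * ((1 + ‖x‖) ^ m * ((1 + ‖ξ‖) ^ m)⁻¹)) * ‖iteratedFDeriv ℝ (n - i) γ x‖) := by
          gcongr
          exact h4.trans (by gcongr)
      _ = n.choose i * (B * ((1 + ‖ξ‖) ^ m)⁻¹ *
          ((1 + ‖x‖) ^ (k + m) * ‖iteratedFDeriv ℝ (n - i) γ x‖)) := by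
          rw [pow_add]
          ring
      _ ≤ _ := by gcongr
  have h7 : ⇑(SchwartzMap.smulLeftCLM ℂ (fun η ↦ σ (η + ξ)) γ) = fun x ↦ σ (x + ξ) * γ x := by
    ext x
    rw [SchwartzMap.smulLeftCLM_apply_apply hσξ, smul_eq_mul]
  rw [h7]
  calc _ ≤ ‖x‖ ^ k * ∑ i ∈ Finset.range (n + 1), (n.choose i : ℝ) *
        ‖iteratedFDeriv ℝ i (fun η ↦ σ (η + ξ)) x‖ * ‖iteratedFDeriv ℝ (n - i) γ x‖ := by
        gcongr
    _ ≤ ∑ i ∈ Finset.range (n + 1),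
        n.choose i * (B * ((1 + ‖ξ‖) ^ m)⁻¹ * jetSeminorm (k + m) n γ) := by
        rw [Finset.mul_sum]
        exact Finset.sum_le_sum h2
    _ = _ := by
        rw [← Finset.sum_mul, ← Nat.cast_sum, Nat.sum_range_choose]
        push_cast
        ring

theorem exists_seminorm_smulLeft_le {Q : Seminorm ℝ 𝓢(Space d, ℂ)} (hQ : Continuous Q) (m : ℕ)
    (γ : 𝓢(Space d, ℂ)) : ∃ (N : ℕ) (C : ℝ≥0), ∀ (σ : Space d → ℂ) (B : ℝ),
      σ.HasTemperateGrowth → 0 ≤ B →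
      (∀ i ≤ N, ∀ ξ, ‖iteratedFDeriv ℝ i σ ξ‖ ≤ B * ((1 + ‖ξ‖) ^ m)⁻¹) →
      ∀ ξ, Q (SchwartzMap.smulLeftCLM ℂ (fun η ↦ σ (η + ξ)) γ) ≤ B * ((1 + ‖ξ‖) ^ m)⁻¹ * C := by
  obtain ⟨s, c, hc, h⟩ := exists_le_sum_schwartzSeminorm hQ
  have hC : 0 ≤ c * ∑ i ∈ s, 2 ^ i.2 * jetSeminorm (i.1 + m) i.2 γ :=
    mul_nonneg hc (Finset.sum_nonneg fun i _ ↦ mul_nonneg (by positivity) (apply_nonneg _ _))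
  refine ⟨s.sup Prod.snd, (c * ∑ i ∈ s, 2 ^ i.2 * jetSeminorm (i.1 + m) i.2 γ).toNNReal,
    fun σ B hσ hB0 hB ξ ↦ ?_⟩
  rw [Real.coe_toNNReal _ hC]
  refine (h _).trans ?_
  rw [mul_left_comm, Finset.mul_sum (a := B * ((1 + ‖ξ‖) ^ m)⁻¹)]
  gcongr with i hi
  exact schwartzSeminorm_smulLeft_le hσ m i.1 i.2 hB0
    (fun j hj ↦ hB j (hj.trans (Finset.le_sup (f := Prod.snd) hi))) γ ξ

theorem ofReal_inv_one_add_pow_le_weight (m : ℕ) (ξ : Space d) :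
    ENNReal.ofReal (((1 + ‖ξ‖) ^ m)⁻¹) ≤ weight (-m) ξ := by
  refine ENNReal.ofReal_le_ofReal ?_
  have h : (1 + ‖ξ‖ ^ 2) ^ ((m : ℝ) / 2) ≤ (1 + ‖ξ‖) ^ m := by
    calc (1 + ‖ξ‖ ^ 2) ^ ((m : ℝ) / 2) ≤ ((1 + ‖ξ‖) ^ 2) ^ ((m : ℝ) / 2) := by
          refine Real.rpow_le_rpow (by positivity) ?_ (by positivity)
          nlinarith [norm_nonneg ξ]
      _ = _ := by
          rw [← Real.rpow_natCast (1 + ‖ξ‖) 2, ← Real.rpow_mul (by positivity),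
            ← Real.rpow_natCast]
          congr 1
          push_cast
          ring
  rw [neg_div, Real.rpow_neg (by positivity)]
  gcongr

/-- Fourier multipliers of order `-m` are bounded between modulation spaces. -/
theorem exists_modNorm_fourierMultiplier_le {g : 𝓢(Space d, ℂ)} (hg : g ≠ 0) {p q : ℝ≥0∞}
    (hp : 1 ≤ p) (hq : 1 ≤ q) (s : ℝ) (m : ℕ) :
    ∃ (N : ℕ) (C : ℝ≥0), ∀ (σ : Space d → ℂ) (B : ℝ), σ.HasTemperateGrowth → 0 ≤ B →
      (∀ i ≤ N, ∀ ξ, ‖iteratedFDeriv ℝ i σ ξ‖ ≤ B * ((1 + ‖ξ‖) ^ m)⁻¹) →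
      ∀ f, modNorm g p q s (TemperedDistribution.fourierMultiplierCLM ℂ σ f) ≤
        ENNReal.ofReal B * (C * modNorm g p q (s - m) f) := by
  obtain ⟨n, hn⟩ := exists_nat_abs_le (s + -m)
  obtain ⟨C, hC⟩ := exists_modNorm_le_of_stft_le (d := d) s (-m) hn hp le_rfl hp
    (by simp [add_comm]) hq
  obtain ⟨P, hPc, hP⟩ := exists_enorm_apply_tfShift_le hg (n + (d + 1))
  obtain ⟨N, C', hC'⟩ := exists_seminorm_smulLeft_le
    (Q := P.comp (fourierCLM ℝ 𝓢(Space d, ℂ)).toLinearMap) (hPc.comp continuous_fourier) m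
    (𝓕⁻ (conjS g))
  refine ⟨N, C' * C, fun σ B hσ hB0 hB f ↦ ?_⟩
  have := hC g g (TemperedDistribution.fourierMultiplierCLM ℂ σ f) f
    (ENNReal.ofReal B * C') fun x ξ ↦ by
    rw [stft, TemperedDistribution.fourierMultiplierCLM_apply_apply, conjShift_eq_tfShift,
      multiplier_tfShift hσ]
    refine (hP f _ x ξ).trans ?_
    rw [← mul_assoc]
    gcongr
    have h2 := hC' σ B hσ hB0 hB ξ
    refine (ENNReal.ofReal_le_ofReal h2).trans ?_
    rw [ENNReal.ofReal_mul (by positivity), ENNReal.ofReal_mul hB0, ENNReal.ofReal_coe_nnreal,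
      mul_right_comm]
    gcongr
    exact ofReal_inv_one_add_pow_le_weight m ξ
  rw [← sub_eq_add_neg] at this
  refine this.trans_eq ?_
  push_cast
  ring

theorem exists_forall_le_bound {N : ℕ} {B : ℕ → ℝ} (hB : ∀ i, 0 ≤ B i) :
    ∃ b, 0 ≤ b ∧ ∀ i ≤ N, B i ≤ b :=
  ⟨∑ i ∈ Finset.range (N + 1), B i, Finset.sum_nonneg fun i _ ↦ hB i, fun _ hi ↦
    Finset.single_le_sum (fun i _ ↦ hB i) (Finset.mem_range.2 (Nat.lt_succ_of_le hi))⟩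

theorem propCos_eq (t : ℝ) : propCos (d := d) t =
    TemperedDistribution.fourierMultiplierCLM ℂ fun ξ : Space d ↦ cosSymbol (t • ξ) := by
  simp_rw [cosSymbol_smul]
  rfl

theorem propSin_eq (t : ℝ) : propSin (d := d) t =
    TemperedDistribution.fourierMultiplierCLM ℂ
      fun ξ : Space d ↦ (t : ℂ) * sincSymbol (t • ξ) := by
  simp_rw [sincSymbol_smul, ← Complex.ofReal_mul]
  rfl

theorem hasTemperateGrowth_cosSymbol_smul (t : ℝ) :
    (fun ξ : Space d ↦ cosSymbol (t • ξ)).HasTemperateGrowth :=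
  (isSymbol_cosSymbol.comp_smul t).hasTemperateGrowth

theorem hasTemperateGrowth_sincSymbol_smul (t : ℝ) :
    (fun ξ : Space d ↦ (t : ℂ) * sincSymbol (t • ξ)).HasTemperateGrowth := by
  have h : (fun ξ : Space d ↦ sincSymbol (t • ξ)).HasTemperateGrowth :=
    (isSymbol_sincSymbol.comp_smul t).hasTemperateGrowth
  fun_prop

variable {g : 𝓢(Space d, ℂ)} {p q : ℝ≥0∞}

theorem exists_modNorm_propCos_le (hg : g ≠ 0) (hp : 1 ≤ p) (hq : 1 ≤ q) (s : ℝ) :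
    ∃ C : ℝ≥0, ∀ t : ℝ, |t| ≤ 1 → ∀ f : 𝓢'(Space d, ℂ),
      modNorm g p q s (propCos t f) ≤ C * modNorm g p q s f := by
  obtain ⟨N, C, hC⟩ := exists_modNorm_fourierMultiplier_le hg hp hq s 0
  choose B hB0 hB using exists_cosSymbol_smul_le (E := Space d)
  obtain ⟨b, hb0, hb⟩ := exists_forall_le_bound (N := N) hB0
  refine ⟨b.toNNReal * C, fun t ht f ↦ ?_⟩
  have := hC _ b (hasTemperateGrowth_cosSymbol_smul t) hb0
    (fun i hi ξ ↦ by simpa using (hB i t ht ξ).trans (hb i hi)) f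
  rw [propCos_eq]
  simpa [mul_assoc] using! this

theorem exists_modNorm_propSin_le (hg : g ≠ 0) (hp : 1 ≤ p) (hq : 1 ≤ q) (s : ℝ) :
    ∃ C : ℝ≥0, ∀ t : ℝ, |t| ≤ 1 → ∀ f : 𝓢'(Space d, ℂ),
      modNorm g p q s (propSin t f) ≤ C * modNorm g p q (s - 1) f := by
  obtain ⟨N, C, hC⟩ := exists_modNorm_fourierMultiplier_le hg hp hq s 1
  choose B hB0 hB using exists_sincSymbol_smul_le (E := Space d)
  obtain ⟨b, hb0, hb⟩ := exists_forall_le_bound (N := N) hB0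
  refine ⟨b.toNNReal * C, fun t ht f ↦ ?_⟩
  have := hC _ b (hasTemperateGrowth_sincSymbol_smul t) hb0
    (fun i hi ξ ↦ by
      rw [pow_one]
      refine (hB i t ht ξ).2.trans ?_
      gcongr
      exact hb i hi) f
  rw [propSin_eq]
  rw [Nat.cast_one] at this
  simpa [mul_assoc] using! this

/-- The sine symbol is also of order zero with bounds proportional to `|t|`. Giving up the smoothing
in exchange for this smallness yields Lipschitz continuity in time. -/
theorem exists_modNorm_propSin_le_abs (hg : g ≠ 0) (hp : 1 ≤ p) (hq : 1 ≤ q) (s : ℝ) :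
    ∃ C : ℝ≥0, ∀ t : ℝ, |t| ≤ 1 → ∀ f : 𝓢'(Space d, ℂ),
      modNorm g p q s (propSin t f) ≤ ENNReal.ofReal |t| * (C * modNorm g p q s f) := by
  obtain ⟨N, C, hC⟩ := exists_modNorm_fourierMultiplier_le hg hp hq s 0
  choose B hB0 hB using exists_sincSymbol_smul_le (E := Space d)
  obtain ⟨b, hb0, hb⟩ := exists_forall_le_bound (N := N) hB0
  refine ⟨b.toNNReal * C, fun t ht f ↦ ?_⟩
  have := hC _ (|t| * b) (hasTemperateGrowth_sincSymbol_smul t) (by positivity)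
    (fun i hi ξ ↦ by
      rw [pow_zero, inv_one, mul_one]
      refine (hB i t ht ξ).1.trans ?_
      rw [mul_comm]
      gcongr
      exact hb i hi) f
  rw [propSin_eq]
  rw [ENNReal.ofReal_mul (abs_nonneg t), Nat.cast_zero, sub_zero, mul_assoc] at this
  refine this.trans_eq ?_
  rw [ENNReal.coe_mul]
  simp only [mul_assoc]
  rfl

theorem fourierMultiplier_ofSchwartz {σ : Space d → ℂ} (hσ : σ.HasTemperateGrowth)
    (φ : 𝓢(Space d, ℂ)) : TemperedDistribution.fourierMultiplierCLM ℂ σ (ofSchwartz φ) =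
      ofSchwartz (SchwartzMap.fourierMultiplierCLM ℂ σ φ) :=
  TemperedDistribution.fourierMultiplierCLM_toTemperedDistributionCLM_eq hσ φ

/-- Sum-to-product: the difference contains the sine symbol at time `(t - t₀)/2`, which is small, at
the price of a factor `r²`, a Laplacian. -/
theorem cos_sub_cos_eq_sinc (t t₀ r : ℝ) :
    Real.cos (2 * Real.pi * t * r) - Real.cos (2 * Real.pi * t₀ * r) =
      ((t + t₀) / 2 * Real.sinc (2 * Real.pi * ((t + t₀) / 2) * r)) *
      (((t - t₀) / 2 * Real.sinc (2 * Real.pi * ((t - t₀) / 2) * r)) *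
        (-8 * Real.pi ^ 2 * r ^ 2)) := by
  rcases eq_or_ne r 0 with rfl | hr
  · simp
  · rw [propSin_symbol _ _ hr, propSin_symbol _ _ hr, Real.cos_sub_cos]
    have hpi := Real.pi_ne_zero
    field_simp
    ring_nf

theorem sinc_sub_sinc_eq (t t₀ r : ℝ) :
    t * Real.sinc (2 * Real.pi * t * r) - t₀ * Real.sinc (2 * Real.pi * t₀ * r) =
      ((t - t₀) / 2 * Real.sinc (2 * Real.pi * ((t - t₀) / 2) * r)) *
        (2 * Real.cos (2 * Real.pi * ((t + t₀) / 2) * r)) := by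
  rcases eq_or_ne r 0 with rfl | hr
  · simp
  · rw [propSin_symbol _ _ hr, propSin_symbol _ _ hr, propSin_symbol _ _ hr]
    have hpi := Real.pi_ne_zero
    have h := Real.sin_sub_sin (2 * Real.pi * t * r) (2 * Real.pi * t₀ * r)
    rw [div_sub_div_same, h]
    have e1 : (2 * Real.pi * t * r - 2 * Real.pi * t₀ * r) / 2 =
      2 * Real.pi * ((t - t₀) / 2) * r := by ring
    have e2 : (2 * Real.pi * t * r + 2 * Real.pi * t₀ * r) / 2 =
      2 * Real.pi * ((t + t₀) / 2) * r := by ring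
    rw [e1, e2]
    field_simp

theorem fourierMultiplier_sub_eq {σ₁ σ₂ a b : Space d → ℂ} (h₁ : σ₁.HasTemperateGrowth)
    (h₂ : σ₂.HasTemperateGrowth) (ha : a.HasTemperateGrowth) (hb : b.HasTemperateGrowth)
    (h : ∀ ξ, σ₁ ξ - σ₂ ξ = a ξ * b ξ) (f : 𝓢'(Space d, ℂ)) :
    TemperedDistribution.fourierMultiplierCLM ℂ σ₁ f -
      TemperedDistribution.fourierMultiplierCLM ℂ σ₂ f =
    TemperedDistribution.fourierMultiplierCLM ℂ a
      (TemperedDistribution.fourierMultiplierCLM ℂ b f) := by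
  ext ψ
  let f' : 𝓢(Space d, ℂ) →L[ℂ] ℂ := f
  change f' (𝓕 (SchwartzMap.smulLeftCLM ℂ σ₁ (𝓕⁻ ψ))) -
    f' (𝓕 (SchwartzMap.smulLeftCLM ℂ σ₂ (𝓕⁻ ψ))) =
    f' (𝓕 (SchwartzMap.smulLeftCLM ℂ b (𝓕⁻ (𝓕 (SchwartzMap.smulLeftCLM ℂ a (𝓕⁻ ψ))))))
  have hF : ∀ u v : 𝓢(Space d, ℂ), 𝓕 u - 𝓕 v = 𝓕 (u - v) := fun u v ↦
    (map_sub (fourierCLM ℂ 𝓢(Space d, ℂ)) u v).symm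
  rw [FourierTransform.fourierInv_fourier_eq, ← map_sub, hF]
  refine congrArg (fun u ↦ f' (𝓕 u)) ?_
  ext ξ
  have hs : ∀ u v : 𝓢(Space d, ℂ), (u - v) ξ = u ξ - v ξ := fun _ _ ↦ rfl
  rw [hs, SchwartzMap.smulLeftCLM_apply_apply h₁, SchwartzMap.smulLeftCLM_apply_apply h₂,
    SchwartzMap.smulLeftCLM_apply_apply hb, SchwartzMap.smulLeftCLM_apply_apply ha]
  simp only [smul_eq_mul]
  rw [← sub_mul, h]
  ring

theorem hasTemperateGrowth_norm_sq_symbol (c : ℝ) :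
    (fun ξ : Space d ↦ ((c * ‖ξ‖ ^ 2 : ℝ) : ℂ)).HasTemperateGrowth := by
  fun_prop

theorem propCos_sub_propCos (t t₀ : ℝ) (f : 𝓢'(Space d, ℂ)) :
    propCos t f - propCos t₀ f = propSin ((t + t₀) / 2) (propSin ((t - t₀) / 2)
      (TemperedDistribution.fourierMultiplierCLM ℂ
        (fun ξ : Space d ↦ ((-8 * Real.pi ^ 2 * ‖ξ‖ ^ 2 : ℝ) : ℂ)) f)) := by
  have hl := hasTemperateGrowth_norm_sq_symbol (d := d) (-8 * Real.pi ^ 2)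
  have hb := hasTemperateGrowth_sincSymbol_smul (d := d) ((t - t₀) / 2)
  rw [propCos_eq, propCos_eq, propSin_eq, propSin_eq,
    TemperedDistribution.fourierMultiplierCLM_fourierMultiplierCLM_apply hl hb]
  refine fourierMultiplier_sub_eq (hasTemperateGrowth_cosSymbol_smul t)
    (hasTemperateGrowth_cosSymbol_smul t₀) (hasTemperateGrowth_sincSymbol_smul ((t + t₀) / 2))
    (hl.mul hb) (fun ξ ↦ ?_) f
  rw [cosSymbol_smul, cosSymbol_smul, sincSymbol_smul, Pi.mul_apply, sincSymbol_smul,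
    ← Complex.ofReal_sub, cos_sub_cos_eq_sinc]
  push_cast
  ring

theorem propSin_sub_propSin (t t₀ : ℝ) (f : 𝓢'(Space d, ℂ)) :
    propSin t f - propSin t₀ f =
      propSin ((t - t₀) / 2) ((2 : ℂ) • propCos ((t + t₀) / 2) f) := by
  have hc := hasTemperateGrowth_cosSymbol_smul (d := d) ((t + t₀) / 2)
  have h2 : (2 : ℂ) • TemperedDistribution.fourierMultiplierCLM ℂ
      (fun ξ : Space d ↦ cosSymbol (((t + t₀) / 2) • ξ)) f =
      TemperedDistribution.fourierMultiplierCLM ℂ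
      ((2 : ℂ) • fun ξ : Space d ↦ cosSymbol (((t + t₀) / 2) • ξ)) f := by
    rw [TemperedDistribution.fourierMultiplierCLM_smul hc]
    rfl
  have hc2 : ((2 : ℂ) • fun ξ : Space d ↦
      cosSymbol (((t + t₀) / 2) • ξ)).HasTemperateGrowth := by
    have : (fun ξ : Space d ↦ (2 : ℂ) * cosSymbol (((t + t₀) / 2) • ξ)).HasTemperateGrowth := by
      fun_prop
    exact this
  rw [propSin_eq, propSin_eq, propSin_eq, propCos_eq, h2]
  refine fourierMultiplier_sub_eq (hasTemperateGrowth_sincSymbol_smul t)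
    (hasTemperateGrowth_sincSymbol_smul t₀) (hasTemperateGrowth_sincSymbol_smul ((t - t₀) / 2))
    hc2 (fun ξ ↦ ?_) f
  rw [sincSymbol_smul, sincSymbol_smul, sincSymbol_smul, Pi.smul_apply, cosSymbol_smul,
    ← Complex.ofReal_mul, ← Complex.ofReal_mul, ← Complex.ofReal_sub, sinc_sub_sinc_eq, smul_eq_mul]
  push_cast
  ring

/-- The Laplacian in `propCos_sub_propCos` costs two derivatives, harmless on a Schwartz function
but not on the whole space. Strong continuity there will follow by density and uniform boundedness.
-/
theorem exists_modNorm_propCos_sub_le (hg : g ≠ 0) (hp : 1 ≤ p) (hq : 1 ≤ q) (s : ℝ)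
    (φ : 𝓢(Space d, ℂ)) : ∃ K : ℝ≥0, ∀ t t₀ : ℝ, |t| ≤ 1 → |t₀| ≤ 1 →
      modNorm g p q s (propCos t (ofSchwartz φ) - propCos t₀ (ofSchwartz φ)) ≤
        K * ENNReal.ofReal |t - t₀| := by
  obtain ⟨C, hC⟩ := exists_modNorm_propSin_le_abs hg hp hq s
  set w := TemperedDistribution.fourierMultiplierCLM ℂ
    (fun ξ : Space d ↦ ((-8 * Real.pi ^ 2 * ‖ξ‖ ^ 2 : ℝ) : ℂ)) (ofSchwartz φ) with hw
  have hfin : modNorm g p q s w ≠ ∞ := by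
    rw [hw, fourierMultiplier_ofSchwartz (hasTemperateGrowth_norm_sq_symbol _)]
    exact (modNorm_ofSchwartz_lt_top g hp hq s _).ne
  refine ⟨C * (C * (modNorm g p q s w).toNNReal), fun t t₀ ht ht₀ ↦ ?_⟩
  rw [abs_le] at ht ht₀
  have h1 : |(t + t₀) / 2| ≤ 1 := abs_le.2 ⟨by linarith, by linarith⟩
  have h2 : |(t - t₀) / 2| ≤ 1 := abs_le.2 ⟨by linarith, by linarith⟩
  have h3 : |(t - t₀) / 2| ≤ |t - t₀| := by
    rw [abs_div, abs_two]
    linarith [abs_nonneg (t - t₀)]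
  rw [propCos_sub_propCos, ← hw]
  calc _ ≤ ENNReal.ofReal |(t + t₀) / 2| *
        (C * (ENNReal.ofReal |(t - t₀) / 2| * (C * modNorm g p q s w))) :=
        (hC _ h1 _).trans (by gcongr; exact hC _ h2 _)
    _ ≤ 1 * (C * (ENNReal.ofReal |t - t₀| * (C * modNorm g p q s w))) := by
        gcongr
        exact ENNReal.ofReal_le_one.2 h1
    _ = _ := by
        push_cast
        rw [ENNReal.coe_toNNReal hfin]
        ring

theorem exists_modNorm_propSin_sub_le (hg : g ≠ 0) (hp : 1 ≤ p) (hq : 1 ≤ q) (s : ℝ)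
    (φ : 𝓢(Space d, ℂ)) : ∃ K : ℝ≥0, ∀ t t₀ : ℝ, |t| ≤ 1 → |t₀| ≤ 1 →
      modNorm g p q s (propSin t (ofSchwartz φ) - propSin t₀ (ofSchwartz φ)) ≤
        K * ENNReal.ofReal |t - t₀| := by
  obtain ⟨C, hC⟩ := exists_modNorm_propSin_le_abs hg hp hq s
  obtain ⟨C', hC'⟩ := exists_modNorm_propCos_le hg hp hq s
  have hfin : modNorm g p q s (ofSchwartz φ) ≠ ∞ := (modNorm_ofSchwartz_lt_top g hp hq s _).ne
  refine ⟨C * (2 * (C' * (modNorm g p q s (ofSchwartz φ)).toNNReal)), fun t t₀ ht ht₀ ↦ ?_⟩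
  rw [abs_le] at ht ht₀
  have h1 : |(t + t₀) / 2| ≤ 1 := abs_le.2 ⟨by linarith, by linarith⟩
  have h2 : |(t - t₀) / 2| ≤ 1 := abs_le.2 ⟨by linarith, by linarith⟩
  have h3 : |(t - t₀) / 2| ≤ |t - t₀| := by
    rw [abs_div, abs_two]
    linarith [abs_nonneg (t - t₀)]
  have h4 : ‖(2 : ℂ)‖ₑ = 2 := by
    rw [← ofReal_norm]
    norm_num
  rw [propSin_sub_propSin]
  calc _ ≤ ENNReal.ofReal |(t - t₀) / 2| *
        (C * (2 * (C' * modNorm g p q s (ofSchwartz φ)))) := by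
        refine (hC _ h2 _).trans ?_
        gcongr
        refine (modNorm_smul_le g hp hq s _ _).trans ?_
        rw [h4]
        gcongr
        exact hC' _ h1 _
    _ ≤ ENNReal.ofReal |t - t₀| * (C * (2 * (C' * modNorm g p q s (ofSchwartz φ)))) := by
        gcongr
    _ = _ := by
        push_cast
        rw [ENNReal.coe_toNNReal hfin]
        ring

theorem propCos_mem_modSpace (hg : g ≠ 0) (hp : 1 ≤ p) (hq : 1 ≤ q) {s t : ℝ} (ht : |t| ≤ 1)
    {f : 𝓢'(Space d, ℂ)} (hf : f ∈ modSpace g p q s) : propCos t f ∈ modSpace g p q s := by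
  intro ε hε
  obtain ⟨C, hC⟩ := exists_modNorm_propCos_le hg hp hq s
  -- The multiplier maps Schwartz functions to Schwartz functions, so an approximation of `f` is
  -- carried to one of its image; `C + 1` avoids dividing by zero.
  obtain ⟨φ, hφ⟩ := hf (ε / (C + 1)) (ENNReal.div_pos hε.ne' (by simp))
  refine ⟨SchwartzMap.fourierMultiplierCLM ℂ (fun ξ : Space d ↦ cosSymbol (t • ξ)) φ, ?_⟩
  rw [propCos_eq, ← fourierMultiplier_ofSchwartz (hasTemperateGrowth_cosSymbol_smul t),
    ← propCos_eq, ← map_sub]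
  refine (hC t ht _).trans_lt ?_
  calc (C : ℝ≥0∞) * modNorm g p q s (f - ofSchwartz φ)
      ≤ (C + 1) * modNorm g p q s (f - ofSchwartz φ) := by gcongr; exact le_self_add
    _ < ε := by
      rw [mul_comm]
      exact (ENNReal.lt_div_iff_mul_lt (by simp) (by simp)).1 hφ

theorem propSin_mem_modSpace (hg : g ≠ 0) (hp : 1 ≤ p) (hq : 1 ≤ q) {s t : ℝ} (ht : |t| ≤ 1)
    {f : 𝓢'(Space d, ℂ)} (hf : f ∈ modSpace g p q (s - 1)) : propSin t f ∈ modSpace g p q s := by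
  intro ε hε
  obtain ⟨C, hC⟩ := exists_modNorm_propSin_le hg hp hq s
  obtain ⟨φ, hφ⟩ := hf (ε / (C + 1)) (ENNReal.div_pos hε.ne' (by simp))
  refine ⟨SchwartzMap.fourierMultiplierCLM ℂ
    (fun ξ : Space d ↦ (t : ℂ) * sincSymbol (t • ξ)) φ, ?_⟩
  rw [propSin_eq, ← fourierMultiplier_ofSchwartz (hasTemperateGrowth_sincSymbol_smul t),
    ← propSin_eq, ← map_sub]
  refine (hC t ht _).trans_lt ?_
  calc (C : ℝ≥0∞) * modNorm g p q (s - 1) (f - ofSchwartz φ)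
      ≤ (C + 1) * modNorm g p q (s - 1) (f - ofSchwartz φ) := by gcongr; exact le_self_add
    _ < ε := by
      rw [mul_comm]
      exact (ENNReal.lt_div_iff_mul_lt (by simp) (by simp)).1 hφ

end Multipliers

/-! ### Products, powers and the loss of one derivative. -/

section Products

open FourierTransform

variable {d : ℕ}

/-- The multiplication formula `∫ (𝓕⁻ u) v = ∫ u (𝓕⁻ v)` with `u = 𝓕 A` and `v` the function `B`
modulated by `ξ`. -/
theorem fourier_mulS (A B : 𝓢(Space d, ℂ)) (ξ : Space d) :
    𝓕 (mulS A B) ξ = ∫ η, 𝓕 A η * 𝓕 B (ξ - η) := by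
  have h := SchwartzMap.integral_fourierInv_mul_eq (𝓕 A) (tfShift B 0 ξ)
  rw [FourierTransform.fourierInv_fourier_eq] at h
  rw [fourier_eq_character]
  calc ∫ y, character ξ y * mulS A B y = ∫ y, A y * tfShift B 0 ξ y := by
        refine integral_congr_ae (.of_forall fun y ↦ ?_)
        simp only [mulS_apply, tfShift_apply, sub_zero]
        ring
    _ = _ := h
    _ = _ := by
        refine integral_congr_ae (.of_forall fun η ↦ ?_)
        have h1 : character (ξ - η) (0 : Space d) = 1 := by simp [character]
        have h2 : 𝓕⁻ B (η - ξ) = 𝓕 B (ξ - η) := by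
          rw [fourierInv_eq_character, fourier_eq_character]
          refine integral_congr_ae (.of_forall fun y ↦ ?_)
          simp only
          rw [character_comm, character, character, inner_neg_right, ← inner_neg_left, neg_sub]
        simp only [fourierInv_tfShift, h1, one_mul, h2]

theorem mulS_translate (φ ψ a b : 𝓢(Space d, ℂ)) (x : Space d) :
    mulS (mulS φ ψ) (translate x (mulS a b)) =
      mulS (mulS φ (translate x a)) (mulS ψ (translate x b)) := by
  ext y
  simp only [mulS_apply, translate_apply]
  ring

/-- With a product window each factor receives its own window. The transform is then pointwise in
`x` and a convolution in frequency, which lets Hölder act in `x` and Young in `ξ`. -/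
theorem cross_mulS (φ ψ a b : 𝓢(Space d, ℂ)) (x ξ : Space d) :
    cross (mulS φ ψ) (mulS a b) x ξ = ∫ η, cross φ a x η * cross ψ b x (ξ - η) := by
  rw [cross, mulS_translate, fourier_mulS]
  rfl

/-- Young's inequality for twisted products in mixed norm spaces. -/
theorem mixNorm_conv_le {s : ℝ} (hs : 0 ≤ s) {p a b r : ℝ≥0∞} (hp : 1 ≤ p) (ha : 1 ≤ a)
    (hb : 1 ≤ b) (hr : 1 ≤ r) (h : a⁻¹ + b⁻¹ = 1 + r⁻¹) {U V : Space d → Space d → ℝ≥0∞}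
    (hU : Measurable (Function.uncurry U)) (hV : Measurable (Function.uncurry V)) :
    mixNorm p r s (fun x ξ ↦ ∫⁻ η, U x η * V x (ξ - η)) ≤
      ENNReal.ofReal (2 ^ (s / 2)) * (mixNorm ∞ a s U * mixNorm p b s V) := by
  set c := ENNReal.ofReal (2 ^ (s / 2)) with hc
  have hUi : Measurable fun η ↦ weight s η * eLpNorm (fun x ↦ U x η) ∞ volume :=
    measurable_weight_mul_eLpNorm hU ∞ s
  have hVi : Measurable fun η ↦ weight s η * eLpNorm (fun x ↦ V x η) p volume :=
    measurable_weight_mul_eLpNorm hV p s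
  have hconv : Measurable fun ξ ↦ ∫⁻ η, (weight s η * eLpNorm (fun x ↦ U x η) ∞ volume) *
      (weight s (ξ - η) * eLpNorm (fun x ↦ V x (ξ - η)) p volume) :=
    (measurable_uncurry_sub hUi hVi).lintegral_prod_right'
  have hUη : ∀ η, Measurable fun x ↦ U x η := fun η ↦ hU.comp (measurable_prodMk_right (y := η))
  have hVη : ∀ η, Measurable fun x ↦ V x η := fun η ↦ hV.comp (measurable_prodMk_right (y := η))
  have hp0 : p ≠ 0 := (zero_lt_one.trans_le hp).ne'
  have hpt : ∀ ξ, weight s ξ * eLpNorm (fun x ↦ ∫⁻ η, U x η * V x (ξ - η)) p volume ≤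
      c * ∫⁻ η, (weight s η * eLpNorm (fun x ↦ U x η) ∞ volume) *
      (weight s (ξ - η) * eLpNorm (fun x ↦ V x (ξ - η)) p volume) := by
    intro ξ
    have hm : Measurable (Function.uncurry fun x η ↦ U x η * V x (ξ - η)) := by
      have h1 : Measurable fun z : Space d × Space d ↦ (z.1, ξ - z.2) := by fun_prop
      exact hU.mul (hV.comp h1)
    calc _ ≤ weight s ξ * ∫⁻ η, eLpNorm (fun x ↦ U x η) ∞ volume *
          eLpNorm (fun x ↦ V x (ξ - η)) p volume := by
          refine mul_le_mul_right ((eLpNorm_lintegral_le hm hp).trans (lintegral_mono fun η ↦ ?_)) _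
          -- Hölder with `1/p = 1/∞ + 1/p`; both factors lie in `L^p_x` type spaces later, and the
          -- first is moved to `L^∞_x` by the embedding.
          exact eLpNorm_mul_le_ennreal hp0 (by simp) (hUη η) (hVη _)
      _ = ∫⁻ η, weight s ξ * (eLpNorm (fun x ↦ U x η) ∞ volume *
          eLpNorm (fun x ↦ V x (ξ - η)) p volume) :=
          (lintegral_const_mul' _ _ (weight_ne_top s ξ)).symm
      _ ≤ ∫⁻ η, c * ((weight s η * eLpNorm (fun x ↦ U x η) ∞ volume) *
          (weight s (ξ - η) * eLpNorm (fun x ↦ V x (ξ - η)) p volume)) := by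
          refine lintegral_mono fun η ↦ ?_
          calc _ ≤ (c * (weight s η * weight s (ξ - η))) * (eLpNorm (fun x ↦ U x η) ∞ volume *
                eLpNorm (fun x ↦ V x (ξ - η)) p volume) :=
                mul_le_mul_left (weight_le_weight_mul_weight hs ξ η) _
            _ = _ := by ring
      _ = _ := lintegral_const_mul' _ _ ENNReal.ofReal_ne_top
  refine (eLpNorm_mono_ennreal _ hpt).trans ?_
  refine (eLpNorm_const_mul_ennreal hconv _ (zero_lt_one.trans_le hr).ne').trans ?_
  exact mul_le_mul_right (eLpNorm_conv_le hUi hVi ha hb h) _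

theorem conjS_mulS (φ ψ : 𝓢(Space d, ℂ)) : conjS (mulS φ ψ) = mulS (conjS φ) (conjS ψ) := by
  ext x
  simp

theorem mulS_self_ne_zero {g : 𝓢(Space d, ℂ)} (hg : g ≠ 0) : mulS g g ≠ 0 := by
  intro h
  refine hg (SchwartzMap.ext fun x ↦ ?_)
  have h1 : mulS g g x = 0 := by rw [h]; rfl
  rw [mulS_apply] at h1
  simpa using h1

theorem measurable_enorm_cross (φ a : 𝓢(Space d, ℂ)) :
    Measurable (Function.uncurry fun x ξ ↦ ‖cross φ a x ξ‖ₑ) :=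
  (continuous_cross φ a).enorm.measurable

theorem modNorm_ofSchwartz (g : 𝓢(Space d, ℂ)) (p q : ℝ≥0∞) (s : ℝ) (φ : 𝓢(Space d, ℂ)) :
    modNorm g p q s (ofSchwartz φ) = mixNorm p q s fun x ξ ↦ ‖cross φ (conjS g) x ξ‖ₑ := by
  simp_rw [modNorm_eq_mixNorm, stft_ofSchwartz]

/-- Products in modulation spaces. -/
theorem exists_modNorm_mulS_le {g : 𝓢(Space d, ℂ)} (hg : g ≠ 0) {s : ℝ} (hs : 0 ≤ s)
    {p a b r : ℝ≥0∞} (hp : 1 ≤ p) (ha : 1 ≤ a) (hb : 1 ≤ b) (hr : 1 ≤ r)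
    (h : a⁻¹ + b⁻¹ = 1 + r⁻¹) :
    ∃ C : ℝ≥0, ∀ φ ψ : 𝓢(Space d, ℂ), modNorm g p r s (ofSchwartz (mulS φ ψ)) ≤
      C * (modNorm g p a s (ofSchwartz φ) * modNorm g p b s (ofSchwartz ψ)) := by
  -- The product estimate comes with the window `g²`; `C₁` returns to `g`, and `C₂` replaces `L^∞_x`
  -- by `L^p_x` for the first factor.
  obtain ⟨C₁, h₁⟩ := exists_modNorm_window_le (mulS_self_ne_zero hg) g s hp hr
  obtain ⟨C₂, h₂⟩ := exists_modNorm_top_le hg s hp ha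
  set c := ENNReal.ofReal (2 ^ (s / 2)) with hc
  have hct : c ≠ ∞ := ENNReal.ofReal_ne_top
  refine ⟨C₁ * c.toNNReal * C₂, fun φ ψ ↦ ?_⟩
  have key : modNorm (mulS g g) p r s (ofSchwartz (mulS φ ψ)) ≤
      c * (modNorm g ∞ a s (ofSchwartz φ) * modNorm g p b s (ofSchwartz ψ)) := by
    rw [modNorm_ofSchwartz, modNorm_ofSchwartz, modNorm_ofSchwartz, conjS_mulS]
    refine le_trans (mixNorm_mono fun x ξ ↦ ?_) (mixNorm_conv_le hs hp ha hb hr h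
      (measurable_enorm_cross φ (conjS g)) (measurable_enorm_cross ψ (conjS g)))
    rw [cross_mulS]
    refine (enorm_integral_le_lintegral_enorm _).trans_eq ?_
    simp_rw [enorm_mul]
  push_cast
  rw [ENNReal.coe_toNNReal hct]
  calc _ ≤ C₁ * modNorm (mulS g g) p r s (ofSchwartz (mulS φ ψ)) := h₁ _
    _ ≤ C₁ * (c * ((C₂ * modNorm g p a s (ofSchwartz φ)) * modNorm g p b s (ofSchwartz ψ))) := by
        refine mul_le_mul_right (key.trans (mul_le_mul_right (mul_le_mul_left (h₂ _) _) _)) _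
    _ = _ := by ring

theorem cross_conjS (φ a : 𝓢(Space d, ℂ)) (x ξ : Space d) :
    cross (conjS φ) (conjS a) x ξ = (starRingEnd ℂ) (cross φ a x (-ξ)) := by
  rw [cross_eq, cross_eq, ← integral_conj]
  refine integral_congr_ae (.of_forall fun y ↦ ?_)
  simp only [map_mul, conjS_apply]
  congr 1
  rw [character, character, ← Complex.exp_conj, map_mul, Complex.conj_I, Complex.conj_ofReal,
    inner_neg_left]
  congr 1
  push_cast
  ring

theorem mixNorm_comp_neg (p q : ℝ≥0∞) (s : ℝ) {W : Space d → Space d → ℝ≥0∞}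
    (hW : Measurable (Function.uncurry W)) :
    mixNorm p q s (fun x ξ ↦ W x (-ξ)) = mixNorm p q s W := by
  have h := eLpNorm_comp_sub_left (μ := (volume : Measure (Space d))) _
    (measurable_weight_mul_eLpNorm hW p s) q 0
  simpa [weight, mixNorm] using h

theorem modNorm_conjS (g : 𝓢(Space d, ℂ)) (p q : ℝ≥0∞) (s : ℝ) (φ : 𝓢(Space d, ℂ)) :
    modNorm g p q s (ofSchwartz (conjS φ)) = modNorm (conjS g) p q s (ofSchwartz φ) := by
  have hcc : conjS (conjS g) = g := by
    ext x
    simp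
  have h1 : ∀ x ξ, ‖cross (conjS φ) (conjS g) x ξ‖ₑ = ‖cross φ g x (-ξ)‖ₑ := by
    intro x ξ
    rw [cross_conjS, ← ofReal_norm, ← ofReal_norm, RCLike.norm_conj]
  have h2 := mixNorm_comp_neg p q s (W := fun x ξ ↦ ‖cross φ g x ξ‖ₑ) (measurable_enorm_cross φ g)
  rw [modNorm_ofSchwartz, modNorm_ofSchwartz, hcc, ← h2]
  simp only [h1]

theorem exists_modNorm_conjS_le {g : 𝓢(Space d, ℂ)} (hg : g ≠ 0) (s : ℝ) {p q : ℝ≥0∞}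
    (hp : 1 ≤ p) (hq : 1 ≤ q) :
    ∃ C : ℝ≥0, ∀ φ : 𝓢(Space d, ℂ),
      modNorm g p q s (ofSchwartz (conjS φ)) ≤ C * modNorm g p q s (ofSchwartz φ) := by
  obtain ⟨C, hC⟩ := exists_modNorm_window_le hg (conjS g) s hp hq
  exact ⟨C, fun φ ↦ (modNorm_conjS g p q s φ).trans_le (hC (ofSchwartz φ))⟩

theorem ofSchwartz_add (φ ψ : 𝓢(Space d, ℂ)) :
    ofSchwartz (φ + ψ) = ofSchwartz φ + ofSchwartz ψ := map_add _ φ ψ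

theorem ofSchwartz_sub (φ ψ : 𝓢(Space d, ℂ)) :
    ofSchwartz (φ - ψ) = ofSchwartz φ - ofSchwartz ψ := map_sub _ φ ψ

theorem ofSchwartz_smul (c : ℂ) (φ : 𝓢(Space d, ℂ)) :
    ofSchwartz (c • φ) = c • ofSchwartz φ := map_smul _ c φ

@[simp]
theorem ofSchwartz_zero : ofSchwartz (0 : 𝓢(Space d, ℂ)) = 0 := map_zero _

/-- The Schwartz function `|φ|^{2j} φ`. -/
def powS : ℕ → 𝓢(Space d, ℂ) → 𝓢(Space d, ℂ)
  | 0, φ => φ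
  | j + 1, φ => mulS φ (mulS (conjS φ) (powS j φ))

theorem powS_apply (j : ℕ) (φ : 𝓢(Space d, ℂ)) (x : Space d) :
    powS j φ x = (‖φ x‖ : ℂ) ^ (2 * j) * φ x := by
  induction j with
  | zero => simp [powS]
  | succ j ih =>
    rw [powS, mulS_apply, mulS_apply, ih, conjS_apply, ← mul_assoc, Complex.mul_conj', ← mul_assoc,
      ← pow_add]
    ring_nf

@[simp]
theorem powS_zero (j : ℕ) : powS j (0 : 𝓢(Space d, ℂ)) = 0 := by
  ext x
  simp [powS_apply]

/-- Telescoping in the three factors `φ`, `conj φ`, `|φ|^{2j}φ`, replacing one factor at a time. -/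
theorem powS_succ_sub (j : ℕ) (φ ψ : 𝓢(Space d, ℂ)) :
    powS (j + 1) φ - powS (j + 1) ψ =
      mulS (φ - ψ) (mulS (conjS φ) (powS j φ)) + mulS ψ (mulS (conjS (φ - ψ)) (powS j φ)) +
        mulS ψ (mulS (conjS ψ) (powS j φ - powS j ψ)) := by
  ext x
  have hs : ∀ u v : 𝓢(Space d, ℂ), (u - v) x = u x - v x := fun _ _ ↦ rfl
  have ha : ∀ u v : 𝓢(Space d, ℂ), (u + v) x = u x + v x := fun _ _ ↦ rfl
  simp only [powS, hs, ha, mulS_apply, conjS_apply, map_sub]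
  ring

/-- The Lebesgue exponent in frequency of a product of `i` factors. -/
def productExponent (q' : ℝ≥0∞) (i : ℕ) : ℝ≥0∞ := (1 - i * q'⁻¹)⁻¹

theorem one_le_productExponent (q' : ℝ≥0∞) (i : ℕ) : 1 ≤ productExponent q' i := by
  rw [productExponent, ENNReal.one_le_inv]
  exact tsub_le_self

/-- Young's relation for multiplying by one more function with frequency exponent `q`. The bound `i
+ 1 ≤ q'` keeps the truncated subtraction in `productExponent` an honest one. -/
theorem productExponent_add {q q' : ℝ≥0∞} (hqq : q⁻¹ + q'⁻¹ = 1) {i : ℕ}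
    (hi : ((i + 1 : ℕ) : ℝ≥0∞) ≤ q') :
    q⁻¹ + (productExponent q' i)⁻¹ = 1 + (productExponent q' (i + 1))⁻¹ := by
  have hq0 : q' ≠ 0 := by
    rintro rfl
    simp at hi
  have ha : q'⁻¹ ≠ ∞ := ENNReal.inv_ne_top.2 hq0
  have h1 : ((i + 1 : ℕ) : ℝ≥0∞) * q'⁻¹ ≤ 1 := by
    rw [← div_eq_mul_inv]
    exact ENNReal.div_le_of_le_mul (by rwa [one_mul])
  have h2 := tsub_add_cancel_of_le h1
  rw [productExponent, productExponent, inv_inv, inv_inv]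
  set x := 1 - ((i + 1 : ℕ) : ℝ≥0∞) * q'⁻¹ with hx
  have h3 : 1 - (i : ℝ≥0∞) * q'⁻¹ = x + q'⁻¹ := by
    refine ENNReal.sub_eq_of_eq_add (ENNReal.mul_ne_top (by simp) ha) ?_
    rw [← h2]
    push_cast
    ring
  rw [h3, add_left_comm, hqq, add_comm]

theorem productExponent_one {q q' : ℝ≥0∞} (hqq : q⁻¹ + q'⁻¹ = 1) : productExponent q' 1 = q := by
  have hq0 : q' ≠ 0 := by
    rintro rfl
    simp at hqq
  rw [productExponent, Nat.cast_one, one_mul, ← inv_inv q]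
  congr 1
  exact ENNReal.sub_eq_of_eq_add (ENNReal.inv_ne_top.2 hq0) hqq.symm

variable {g : 𝓢(Space d, ℂ)} {p q q' : ℝ≥0∞} {s : ℝ}

theorem exists_modNorm_mulS_mulS_le (hg : g ≠ 0) (hs : 0 ≤ s) (hp : 1 ≤ p) (hq : 1 ≤ q)
    (hqq : q⁻¹ + q'⁻¹ = 1) {i : ℕ} (hi : ((i + 2 : ℕ) : ℝ≥0∞) ≤ q') :
    ∃ C : ℝ≥0, ∀ u v w : 𝓢(Space d, ℂ),
      modNorm g p (productExponent q' (i + 2)) s (ofSchwartz (mulS u (mulS (conjS v) w))) ≤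
      C * (modNorm g p q s (ofSchwartz u) * modNorm g p q s (ofSchwartz v) *
        modNorm g p (productExponent q' i) s (ofSchwartz w)) := by
  have hi1 : ((i + 1 : ℕ) : ℝ≥0∞) ≤ q' := le_trans (by exact_mod_cast Nat.le_succ _) hi
  obtain ⟨C₁, h₁⟩ := exists_modNorm_mulS_le hg hs hp hq (one_le_productExponent q' i)
    (one_le_productExponent q' (i + 1)) (productExponent_add hqq hi1)
  obtain ⟨C₂, h₂⟩ := exists_modNorm_mulS_le hg hs hp hq (one_le_productExponent q' (i + 1))
    (one_le_productExponent q' (i + 2)) (productExponent_add hqq hi)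
  obtain ⟨C₃, h₃⟩ := exists_modNorm_conjS_le hg s hp hq
  refine ⟨C₂ * C₁ * C₃, fun u v w ↦ (h₂ _ _).trans ?_⟩
  calc _ ≤ C₂ * (modNorm g p q s (ofSchwartz u) * (C₁ * ((C₃ * modNorm g p q s (ofSchwartz v)) *
        modNorm g p (productExponent q' i) s (ofSchwartz w)))) := by
        refine mul_le_mul_right (mul_le_mul_right ((h₁ _ _).trans ?_) _) _
        exact mul_le_mul_right (mul_le_mul_left (h₃ v) _) _
    _ = _ := by
        push_cast
        ring

/-- Local Lipschitz estimate for `|φ|^{2j} φ`. -/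
theorem exists_modNorm_powS_sub_le (hg : g ≠ 0) (hs : 0 ≤ s) (hp : 1 ≤ p) (hq : 1 ≤ q)
    (hqq : q⁻¹ + q'⁻¹ = 1) (j : ℕ) (hj : ((2 * j + 1 : ℕ) : ℝ≥0∞) ≤ q') :
    ∃ C : ℝ≥0, ∀ φ ψ : 𝓢(Space d, ℂ),
      modNorm g p (productExponent q' (2 * j + 1)) s (ofSchwartz (powS j φ - powS j ψ)) ≤
      C * ((modNorm g p q s (ofSchwartz φ) + modNorm g p q s (ofSchwartz ψ)) ^ (2 * j) *
        modNorm g p q s (ofSchwartz (φ - ψ))) := by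
  induction j with
  | zero =>
    refine ⟨1, fun φ ψ ↦ ?_⟩
    simp only [mul_zero, zero_add, productExponent_one hqq, powS, pow_zero, one_mul,
      ENNReal.coe_one, le_refl]
  | succ j ih =>
    obtain ⟨C, hC⟩ := ih (le_trans (by exact_mod_cast (by omega)) hj)
    obtain ⟨D, hD⟩ := exists_modNorm_mulS_mulS_le hg hs hp hq hqq (i := 2 * j + 1)
      (by rwa [show 2 * j + 1 + 2 = 2 * (j + 1) + 1 by ring])
    -- One copy of `D * C` for each of the three telescoping terms.
    refine ⟨3 * (D * C), fun φ ψ ↦ ?_⟩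
    have hr := one_le_productExponent q' (2 * j + 1 + 2)
    -- The size of a power is the case `ψ = 0` of the Lipschitz estimate.
    have hA : ∀ φ : 𝓢(Space d, ℂ),
        modNorm g p (productExponent q' (2 * j + 1)) s (ofSchwartz (powS j φ)) ≤
        C * (modNorm g p q s (ofSchwartz φ) ^ (2 * j) * modNorm g p q s (ofSchwartz φ)) := by
      intro φ
      simpa using hC φ 0
    rw [show 2 * (j + 1) + 1 = 2 * j + 1 + 2 by ring, powS_succ_sub, ofSchwartz_add,
      ofSchwartz_add]
    refine (modNorm_add_le g hp hr s _ _).trans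
      ((add_le_add_left (modNorm_add_le g hp hr s _ _) _).trans ?_)
    set a := modNorm g p q s (ofSchwartz φ)
    set b := modNorm g p q s (ofSchwartz ψ)
    set δ := modNorm g p q s (ofSchwartz (φ - ψ))
    have hab : a ≤ a + b := le_self_add
    have hba : b ≤ a + b := le_add_self
    have h1 : D * (δ * a * (C * (a ^ (2 * j) * a))) ≤
        D * C * ((a + b) ^ (2 * j + 2) * δ) := by
      calc _ ≤ D * (δ * (a + b) * (C * ((a + b) ^ (2 * j) * (a + b)))) := by gcongr
        _ = _ := by ring
    have h2 : D * (b * δ * (C * (a ^ (2 * j) * a))) ≤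
        D * C * ((a + b) ^ (2 * j + 2) * δ) := by
      calc _ ≤ D * ((a + b) * δ * (C * ((a + b) ^ (2 * j) * (a + b)))) := by gcongr
        _ = _ := by ring
    have h3 : D * (b * b * (C * ((a + b) ^ (2 * j) * δ))) ≤
        D * C * ((a + b) ^ (2 * j + 2) * δ) := by
      calc _ ≤ D * ((a + b) * (a + b) * (C * ((a + b) ^ (2 * j) * δ))) := by gcongr
        _ = _ := by ring
    calc _ ≤ D * C * ((a + b) ^ (2 * j + 2) * δ) + D * C * ((a + b) ^ (2 * j + 2) * δ) +
          D * C * ((a + b) ^ (2 * j + 2) * δ) := by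
          refine add_le_add (add_le_add ?_ ?_) ?_
          · exact (hD _ _ _).trans (le_trans (mul_le_mul_right (mul_le_mul_right (hA φ) _) _) h1)
          · exact (hD _ _ _).trans (le_trans (mul_le_mul_right (mul_le_mul_right (hA φ) _) _) h2)
          · exact (hD _ _ _).trans (le_trans (mul_le_mul_right (mul_le_mul_right (hC φ ψ) _) _) h3)
      _ = _ := by
          push_cast
          rw [show 2 * (j + 1) = 2 * j + 2 by ring]
          ring

/-- Integrability of `⟨ξ⟩^{-b}` over `ℝ^d` for finite `b > d`. With `b = q'/(2k)` the condition
reads `q' > 2kd`. -/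
theorem eLpNorm_weight_neg_one_lt_top {b : ℝ≥0∞} (hb : (d : ℝ≥0∞) < b) :
    eLpNorm (weight (-1) : Space d → ℝ≥0∞) b volume < ∞ := by
  rcases eq_or_ne b ∞ with rfl | ht
  · refine (eLpNorm_top_le (C := 1) (.of_forall fun ξ ↦ ?_)).trans_lt ENNReal.one_lt_top
    rw [← weight_zero_left ξ]
    exact weight_mono (by norm_num) ξ
  · have h0 : b ≠ 0 := (zero_le.trans_lt hb).ne'
    have hd : (d : ℝ) < b.toReal := by
      simpa using (ENNReal.toReal_lt_toReal (by simp) ht).2 hb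
    have hb0 : 0 ≤ b.toReal := ENNReal.toReal_nonneg
    rw [eLpNorm_ennreal h0 ht]
    refine ENNReal.rpow_lt_top_of_nonneg (by positivity) (ne_of_lt ?_)
    have hint := integrable_rpow_neg_one_add_norm_sq (E := Space d) (μ := volume) (r := b.toReal)
      (by simpa using hd)
    refine lt_of_eq_of_lt (lintegral_congr fun ξ ↦ ?_) hint.lintegral_lt_top
    rw [weight, ENNReal.ofReal_rpow_of_nonneg (by positivity) hb0, ← Real.rpow_mul (by positivity)]
    congr 2
    ring

/-- Loss of one derivative against the exponent of a product of `2k + 1` factors. -/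
theorem exists_modNorm_sub_one_le (hq : 1 ≤ q) (hqq : q⁻¹ + q'⁻¹ = 1) (k : ℕ)
    (hk : ((2 * k * d : ℕ) : ℝ≥0∞) < q') (hk1 : ((2 * k + 1 : ℕ) : ℝ≥0∞) ≤ q') (s : ℝ) :
    ∃ C : ℝ≥0, ∀ f : 𝓢'(Space d, ℂ), modNorm g p q (s - 1) f ≤
      C * modNorm g p (productExponent q' (2 * k + 1)) s f := by
  have hq0 : q' ≠ 0 := (zero_le.trans_lt hk).ne'
  have ha : q'⁻¹ ≠ ∞ := ENNReal.inv_ne_top.2 hq0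
  -- This exponent satisfies `1/b + (1 - (2k+1)/q') = 1 - 1/q' = 1/q`, as Hölder demands. For `k =
  -- 0` it equals `∞`.
  set b : ℝ≥0∞ := q' / (2 * k : ℕ) with hb
  have hbi : b⁻¹ = (2 * k : ℕ) * q'⁻¹ := by
    rw [hb, ENNReal.inv_div (.inl (ENNReal.natCast_ne_top _)) (.inr hq0), div_eq_mul_inv]
  have hdb : (d : ℝ≥0∞) < b := by
    rw [hb]
    rcases Nat.eq_zero_or_pos k with rfl | hk0
    · simp [ENNReal.div_zero hq0]
    · rw [ENNReal.lt_div_iff_mul_lt (.inl (by simp; omega)) (.inl (ENNReal.natCast_ne_top _))]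
      refine lt_of_eq_of_lt ?_ hk
      push_cast
      ring
  have hh : b⁻¹ + (productExponent q' (2 * k + 1))⁻¹ = q⁻¹ := by
    have h1 : ((2 * k + 1 : ℕ) : ℝ≥0∞) * q'⁻¹ ≤ 1 := by
      rw [← div_eq_mul_inv]
      exact ENNReal.div_le_of_le_mul (by rwa [one_mul])
    have h2 := tsub_add_cancel_of_le h1
    rw [productExponent, inv_inv, hbi]
    refine (ENNReal.add_left_inj ha).1 ?_
    rw [hqq]
    refine Eq.trans ?_ h2
    push_cast
    ring
  have hD := (eLpNorm_weight_neg_one_lt_top hdb).ne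
  refine ⟨(eLpNorm (weight (-1) : Space d → ℝ≥0∞) b volume).toNNReal, fun f ↦ ?_⟩
  rw [ENNReal.coe_toNNReal hD, modNorm_eq_mixNorm, modNorm_eq_mixNorm, mixNorm, mixNorm]
  have hm := measurable_weight_mul_eLpNorm (measurable_enorm_stft g f) p s
  refine le_trans (eLpNorm_mono_ennreal _ fun ξ ↦ ?_) (eLpNorm_mul_le_ennreal
    (zero_lt_one.trans_le hq).ne' hh (measurable_weight (-1)) hm)
  rw [← mul_assoc, ← weight_add, neg_add_eq_sub]

/-- The nonlinearity on Schwartz functions. -/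
def nonlinS (lam : ℂ) (k : ℕ) (φ : 𝓢(Space d, ℂ)) : 𝓢(Space d, ℂ) := lam • powS k φ

theorem nonlinS_apply (lam : ℂ) (k : ℕ) (φ : 𝓢(Space d, ℂ)) (x : Space d) :
    nonlinS lam k φ x = lam * (‖φ x‖ : ℂ) ^ (2 * k) * φ x := by
  rw [nonlinS, smul_apply, powS_apply, smul_eq_mul, mul_assoc]

/-- The power estimate lands in a space with a larger frequency exponent but the same `s`; the
missing integrability is bought with one derivative, which the sine propagator gives back. -/
theorem exists_modNorm_nonlinS_sub_le (hg : g ≠ 0) (hs : 0 ≤ s) (hp : 1 ≤ p) (hq : 1 ≤ q)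
    (hqq : q⁻¹ + q'⁻¹ = 1) (lam : ℂ) (k : ℕ) (hk : ((2 * k * d : ℕ) : ℝ≥0∞) < q')
    (hk1 : ((2 * k + 1 : ℕ) : ℝ≥0∞) ≤ q') :
    ∃ C : ℝ≥0, ∀ φ ψ : 𝓢(Space d, ℂ),
      modNorm g p q (s - 1) (ofSchwartz (nonlinS lam k φ) - ofSchwartz (nonlinS lam k ψ)) ≤
      C * ((modNorm g p q s (ofSchwartz φ) + modNorm g p q s (ofSchwartz ψ)) ^ (2 * k) *
        modNorm g p q s (ofSchwartz φ - ofSchwartz ψ)) := by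
  obtain ⟨C₁, h₁⟩ := exists_modNorm_sub_one_le (g := g) (p := p) hq hqq k hk hk1 s
  obtain ⟨C₂, h₂⟩ := exists_modNorm_powS_sub_le hg hs hp hq hqq k hk1
  refine ⟨‖lam‖₊ * (C₁ * C₂), fun φ ψ ↦ ?_⟩
  have h3 : ofSchwartz (nonlinS lam k φ) - ofSchwartz (nonlinS lam k ψ) =
      lam • ofSchwartz (powS k φ - powS k ψ) := by
    rw [nonlinS, nonlinS, ← ofSchwartz_sub, ← smul_sub, ofSchwartz_smul]
  rw [h3, ← ofSchwartz_sub]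
  calc _ ≤ ‖lam‖ₑ * modNorm g p q (s - 1) (ofSchwartz (powS k φ - powS k ψ)) :=
        modNorm_smul_le g hp hq _ _ _
    _ ≤ ‖lam‖ₑ * (C₁ * (C₂ * ((modNorm g p q s (ofSchwartz φ) +
        modNorm g p q s (ofSchwartz ψ)) ^ (2 * k) * modNorm g p q s (ofSchwartz (φ - ψ))))) :=
        mul_le_mul_right ((h₁ _).trans (mul_le_mul_right (h₂ φ ψ) _)) _
    _ = _ := by
        push_cast
        rw [enorm_eq_nnnorm]
        ring

end Products

/-! ### Abstract extension and the abstract semilinear Cauchy problem. -/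

/-- A locally Lipschitz map on a dense set extends. -/
theorem exists_extension_of_lipschitz {X Y : Type*} [NormedAddCommGroup X]
    [NormedAddCommGroup Y] [CompleteSpace Y] {D : Type*} {ι : D → X}
    (hι : DenseRange ι) {N : D → Y} {L : ℝ → ℝ}
    (hN : ∀ ρ a b, ‖ι a‖ ≤ ρ → ‖ι b‖ ≤ ρ → ‖N a - N b‖ ≤ L ρ * ‖ι a - ι b‖) :
    ∃ F : X → Y, (∀ (φ : ℕ → D) x, Tendsto (fun n ↦ ι (φ n)) atTop (𝓝 x) →
      Tendsto (fun n ↦ N (φ n)) atTop (𝓝 (F x))) ∧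
      ∀ ρ x y, ‖x‖ < ρ → ‖y‖ < ρ → ‖F x - F y‖ ≤ L ρ * ‖x - y‖ := by
  have hseq : ∀ x, ∃ φ : ℕ → D, Tendsto (fun n ↦ ι (φ n)) atTop (𝓝 x) := by
    intro x
    obtain ⟨u, hu, hx⟩ := mem_closure_iff_seq_limit.1 (hι x)
    choose φ hφ using hu
    exact ⟨φ, by simpa only [hφ] using hx⟩
  choose φ hφ using hseq
  -- The strict inequalities force approximating sequences to enter the ball of radius `ρ`
  -- eventually, so one Lipschitz constant serves the tails.
  have hsmall : ∀ {a b : ℕ → D} {x y : X} {ρ : ℝ}, ‖x‖ < ρ → ‖y‖ < ρ →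
      Tendsto (fun n ↦ ι (a n)) atTop (𝓝 x) → Tendsto (fun n ↦ ι (b n)) atTop (𝓝 y) →
      ∀ᶠ n in atTop, ‖N (a n) - N (b n)‖ ≤ L ρ * ‖ι (a n) - ι (b n)‖ := by
    intro a b x y ρ hx hy ha hb
    filter_upwards [ha.norm.eventually_lt_const hx, hb.norm.eventually_lt_const hy] with n h1 h2
    exact hN ρ _ _ h1.le h2.le
  have hcauchy : ∀ x, CauchySeq fun n ↦ N (φ x n) := by
    intro x
    have hc := (hφ x).cauchySeq
    have hb := (hφ x).norm.eventually_lt_const (lt_add_one ‖x‖)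
    rw [Metric.cauchySeq_iff] at hc ⊢
    intro ε hε
    obtain ⟨n₁, h₁⟩ := hc (ε / (|L (‖x‖ + 1)| + 1)) (by positivity)
    obtain ⟨n₂, h₂⟩ := eventually_atTop.1 hb
    refine ⟨max n₁ n₂, fun m hm n hn ↦ ?_⟩
    have h3 := h₁ m (le_of_max_le_left hm) n (le_of_max_le_left hn)
    rw [dist_eq_norm] at h3 ⊢
    calc _ ≤ L (‖x‖ + 1) * ‖ι (φ x m) - ι (φ x n)‖ :=
          hN _ _ _ (h₂ m (le_of_max_le_right hm)).le (h₂ n (le_of_max_le_right hn)).le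
      _ ≤ (|L (‖x‖ + 1)| + 1) * ‖ι (φ x m) - ι (φ x n)‖ := by
          gcongr
          linarith [le_abs_self (L (‖x‖ + 1))]
      _ < (|L (‖x‖ + 1)| + 1) * (ε / (|L (‖x‖ + 1)| + 1)) := by gcongr
      _ = ε := by field_simp
  choose F hF using fun x ↦ cauchySeq_tendsto_of_complete (hcauchy x)
  refine ⟨F, fun ψ x hψ ↦ ?_, fun ρ x y hx hy ↦ ?_⟩
  · have h1 : Tendsto (fun n ↦ N (ψ n) - N (φ x n)) atTop (𝓝 0) := by
      refine squeeze_zero_norm' (hsmall (lt_add_one ‖x‖) (lt_add_one ‖x‖) hψ (hφ x)) ?_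
      have := ((hψ.sub (hφ x)).norm).const_mul (L (‖x‖ + 1))
      simpa using this
    have := h1.add (hF x)
    simpa using this
  · exact le_of_tendsto_of_tendsto ((hF x).sub (hF y)).norm
      (((hφ x).sub (hφ y)).norm.const_mul _) (hsmall hx hy (hφ x) (hφ y))

section Abstract

variable {X Y : Type*} [NormedAddCommGroup X] [NormedSpace ℝ X]
  [NormedAddCommGroup Y] [NormedSpace ℝ Y]

/-- A bounded, strongly continuous family of operators. -/
structure IsStrongFamily (K : ℝ → Y →L[ℝ] X) (M : ℝ) : Prop where
  nonneg : 0 ≤ M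
  bound : ∀ t y, ‖K t y‖ ≤ M * ‖y‖
  continuous_apply : ∀ y, Continuous fun t ↦ K t y

theorem IsStrongFamily.continuous {K : ℝ → Y →L[ℝ] X} {M : ℝ} (h : IsStrongFamily K M) :
    Continuous fun z : ℝ × Y ↦ K z.1 z.2 := by
  refine continuous_iff_continuousAt.2 fun ⟨t₀, y₀⟩ ↦ ?_
  have h1 : Tendsto (fun z : ℝ × Y ↦ K z.1 y₀) (𝓝 (t₀, y₀)) (𝓝 (K t₀ y₀)) :=
    ((h.continuous_apply y₀).comp continuous_fst).tendsto (t₀, y₀)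
  have h2 : Tendsto (fun z : ℝ × Y ↦ K z.1 (z.2 - y₀)) (𝓝 (t₀, y₀)) (𝓝 0) := by
    refine squeeze_zero_norm (fun z ↦ h.bound z.1 (z.2 - y₀)) ?_
    have : Continuous fun z : ℝ × Y ↦ M * ‖z.2 - y₀‖ := by fun_prop
    simpa using this.tendsto (t₀, y₀)
  have h3 := h2.add h1
  rw [zero_add] at h3
  refine h3.congr fun z ↦ ?_
  rw [← map_add, sub_add_cancel]

/-- Strong continuity follows from uniform boundedness and strong continuity on a dense set. -/
theorem IsStrongFamily.of_dense {K : ℝ → Y →L[ℝ] X} {M : ℝ} (hM : 0 ≤ M)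
    (hK : ∀ t y, ‖K t y‖ ≤ M * ‖y‖) {D : Set Y} (hD : Dense D)
    (h : ∀ y ∈ D, Continuous fun t ↦ K t y) : IsStrongFamily K M := by
  refine ⟨hM, hK, fun y ↦ continuous_iff_continuousAt.2 fun t₀ ↦
    Metric.tendsto_nhds.2 fun ε hε ↦ ?_⟩
  obtain ⟨z, hz, hyz⟩ := Metric.dense_iff.1 hD y (ε / (3 * (M + 1))) (by positivity)
  rw [Metric.mem_ball, dist_eq_norm] at hz
  have h1 : ∀ t, ‖K t (z - y)‖ < ε / 3 := fun t ↦ by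
    calc ‖K t (z - y)‖ ≤ M * ‖z - y‖ := hK t _
      _ ≤ (M + 1) * ‖z - y‖ := by gcongr; linarith
      _ < (M + 1) * (ε / (3 * (M + 1))) := by gcongr
      _ = ε / 3 := by field_simp
  filter_upwards [Metric.tendsto_nhds.1 ((h z hyz).tendsto t₀) (ε / 3) (by positivity)] with t ht
  rw [dist_eq_norm] at ht ⊢
  have e : K t y - K t₀ y = (K t z - K t₀ z) - K t (z - y) + K t₀ (z - y) := by
    rw [map_sub, map_sub]
    abel
  rw [e]
  calc _ ≤ ‖K t z - K t₀ z‖ + ‖K t (z - y)‖ + ‖K t₀ (z - y)‖ :=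
        (norm_add_le _ _).trans (by gcongr; exact norm_sub_le _ _)
    _ < ε / 3 + ε / 3 + ε / 3 := by
        gcongr
        · exact h1 t
        · exact h1 t₀
    _ = ε := by ring

/-- Gronwall's inequality in integral form. -/
theorem le_mul_exp_of_le_integral {f : ℝ → ℝ} (hf : Continuous f) {δ κ T : ℝ} (hκ : 0 ≤ κ)
    (h : ∀ t ∈ Icc 0 T, f t ≤ δ + κ * ∫ τ in (0 : ℝ)..t, f τ) :
    ∀ t ∈ Icc 0 T, f t ≤ δ * Real.exp (κ * t) := by
  let H : ℝ → ℝ := fun t ↦ ∫ τ in (0 : ℝ)..t, f τ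
  have hH : ∀ t, HasDerivAt H (f t) t := fun t ↦ hf.integral_hasStrictDerivAt 0 t |>.hasDerivAt
  -- The right-hand side of the hypothesis times the integrating factor is nonincreasing and equals
  -- `δ` at time `0`.
  let E : ℝ → ℝ := fun t ↦ (δ + κ * H t) * Real.exp (-(κ * t))
  have hE : ∀ t, HasDerivAt E (κ * f t * Real.exp (-(κ * t)) +
      (δ + κ * H t) * (Real.exp (-(κ * t)) * -(κ * 1))) t := fun t ↦
    (((hH t).const_mul κ).const_add δ).mul ((((hasDerivAt_id t).const_mul κ).neg).exp)
  have hanti : AntitoneOn E (Icc 0 T) := by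
    refine antitoneOn_of_deriv_nonpos (convex_Icc 0 T)
      (fun t _ ↦ (hE t).continuousAt.continuousWithinAt)
      (fun t _ ↦ (hE t).differentiableAt.differentiableWithinAt) fun t ht ↦ ?_
    rw [(hE t).deriv]
    have h1 := h t (interior_subset ht)
    have h2 : κ * (f t - (δ + κ * H t)) ≤ 0 := mul_nonpos_of_nonneg_of_nonpos hκ (sub_nonpos.2 h1)
    have h3 := mul_nonpos_of_nonpos_of_nonneg h2 (Real.exp_pos (-(κ * t))).le
    linarith
  intro t ht
  have h1 := hanti ⟨le_rfl, ht.1.trans ht.2⟩ ht ht.1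
  have h2 : E 0 = δ := by simp [E, H]
  rw [h2] at h1
  calc f t ≤ δ + κ * H t := h t ht
    _ = E t * Real.exp (κ * t) := by
        simp only [E]
        rw [mul_assoc, ← Real.exp_add, neg_add_cancel, Real.exp_zero, mul_one]
    _ ≤ δ * Real.exp (κ * t) := by gcongr

/-- Mild solutions of the abstract Cauchy problem on `[0, T]`. -/
structure IsMild (C : ℝ → X →L[ℝ] X) (K : ℝ → Y →L[ℝ] X) (F : X → Y) (T : ℝ) (x : X) (y : Y)
    (u : ℝ → X) : Prop where
  continuousOn : ContinuousOn u (Icc 0 T)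
  eq : ∀ t ∈ Icc 0 T, u t = C t x + K t y + ∫ τ in (0 : ℝ)..t, K (t - τ) (F (u τ))

theorem IsStrongFamily.intervalIntegrable {K : ℝ → Y →L[ℝ] X} {M : ℝ} (hK : IsStrongFamily K M)
    {w : ℝ → Y} {T t : ℝ} (hw : ContinuousOn w (Icc 0 T)) (ht : t ∈ Icc 0 T) :
    IntervalIntegrable (fun τ ↦ K (t - τ) (w τ)) volume 0 t := by
  refine ContinuousOn.intervalIntegrable ?_
  rw [uIcc_of_le ht.1]
  exact hK.continuous.comp_continuousOn ((continuousOn_const.sub continuousOn_id).prodMk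
    (hw.mono (Icc_subset_Icc_right ht.2)))

variable {C : ℝ → X →L[ℝ] X} {K : ℝ → Y →L[ℝ] X} {F : X → Y} {M : ℝ}

/-- Continuous dependence of mild solutions on the data. -/
theorem IsMild.norm_sub_le (hC : IsStrongFamily C M) (hK : IsStrongFamily K M)
    (hF : Continuous F) {ρ L : ℝ} (hL0 : 0 ≤ L)
    (hL : ∀ u v, ‖u‖ ≤ ρ → ‖v‖ ≤ ρ → ‖F u - F v‖ ≤ L * ‖u - v‖) {T : ℝ} (hT : 0 ≤ T)
    {x x' : X} {y y' : Y} {u v : ℝ → X} (hu : IsMild C K F T x y u) (hv : IsMild C K F T x' y' v)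
    (hub : ∀ t ∈ Icc 0 T, ‖u t‖ ≤ ρ) (hvb : ∀ t ∈ Icc 0 T, ‖v t‖ ≤ ρ) :
    ∀ t ∈ Icc 0 T, ‖u t - v t‖ ≤ M * (‖x - x'‖ + ‖y - y'‖) * Real.exp (M * L * t) := by
  have hM := hC.nonneg
  -- Gronwall's inequality is stated for functions continuous on the whole line, hence the constant
  -- extension beyond `[0, T]`.
  let f : ℝ → ℝ := IccExtend hT ((Icc 0 T).domRestrict fun t ↦ ‖u t - v t‖)
  have hfc : Continuous f :=
    (continuousOn_iff_continuous_domRestrict.1 (hu.continuousOn.sub hv.continuousOn).norm).Icc_extend'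
  have hf : ∀ t ∈ Icc 0 T, f t = ‖u t - v t‖ := fun t ht ↦ by
    simp only [f, IccExtend_of_mem hT _ ht, domRestrict_apply]
  have key := le_mul_exp_of_le_integral hfc (δ := M * (‖x - x'‖ + ‖y - y'‖)) (κ := M * L) (T := T)
    (by positivity) fun t ht ↦ by
      have hsub : Icc 0 t ⊆ Icc 0 T := Icc_subset_Icc_right ht.2
      have e : u t - v t = C t (x - x') + K t (y - y') +
          ∫ τ in (0 : ℝ)..t, K (t - τ) (F (u τ) - F (v τ)) := by
        rw [hu.eq t ht, hv.eq t ht]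
        simp only [map_sub]
        have hiu : IntervalIntegrable (fun τ ↦ K (t - τ) (F (u τ))) volume 0 t :=
          hK.intervalIntegrable (hF.comp_continuousOn hu.continuousOn) ht
        have hiv : IntervalIntegrable (fun τ ↦ K (t - τ) (F (v τ))) volume 0 t :=
          hK.intervalIntegrable (hF.comp_continuousOn hv.continuousOn) ht
        rw [intervalIntegral.integral_sub hiu hiv]
        abel
      rw [hf t ht, e]
      have h1 : ‖∫ τ in (0 : ℝ)..t, K (t - τ) (F (u τ) - F (v τ))‖ ≤
          ∫ τ in (0 : ℝ)..t, M * L * f τ := by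
        refine intervalIntegral.norm_integral_le_of_norm_le ht.1 (.of_forall fun τ hτ ↦ ?_)
          ((continuous_const.mul hfc).intervalIntegrable _ _)
        have hτ' : τ ∈ Icc 0 T := hsub ⟨hτ.1.le, hτ.2⟩
        rw [hf τ hτ', mul_assoc]
        refine (hK.bound _ _).trans ?_
        gcongr
        exact hL _ _ (hub τ hτ') (hvb τ hτ')
      rw [intervalIntegral.integral_const_mul] at h1
      calc _ ≤ ‖C t (x - x')‖ + ‖K t (y - y')‖ +
            ‖∫ τ in (0 : ℝ)..t, K (t - τ) (F (u τ) - F (v τ))‖ := norm_add₃_le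
        _ ≤ M * ‖x - x'‖ + M * ‖y - y'‖ + M * L * ∫ τ in (0 : ℝ)..t, f τ := by
            gcongr
            · exact hC.bound _ _
            · exact hK.bound _ _
        _ = _ := by ring
  intro t ht
  rw [← hf t ht]
  exact key t ht

/-- The Duhamel integral is continuous in time. -/
theorem IsStrongFamily.continuous_duhamel (hK : IsStrongFamily K M) {w : ℝ → Y}
    (hw : Continuous w) : Continuous fun t ↦ ∫ τ in (0 : ℝ)..t, K (t - τ) (w τ) := by
  refine intervalIntegral.continuous_parametric_intervalIntegral_of_continuous (a₀ := 0)
    (f := fun t τ ↦ K (t - τ) (w τ)) ?_ continuous_id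
  have h1 : Continuous fun z : ℝ × ℝ ↦ (z.1 - z.2, w z.2) := by fun_prop
  exact hK.continuous.comp h1

/-- Banach's fixed point theorem for the Duhamel map on the closed ball of radius `ρ` in `C([0, T];
X)`: `hρ` makes the ball invariant, and `hLT` makes the map a contraction with constant `1/2`. -/
theorem exists_isMild_of_small [CompleteSpace X] (hC : IsStrongFamily C M)
    (hK : IsStrongFamily K M) (hF : Continuous F) {R ρ L T : ℝ} (hT : 0 ≤ T) (hL0 : 0 ≤ L)
    (hρ0 : 0 ≤ ρ) (hL : ∀ u v, ‖u‖ ≤ ρ → ‖v‖ ≤ ρ → ‖F u - F v‖ ≤ L * ‖u - v‖)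
    (hLT : M * L * T ≤ 1 / 2) (hρ : M * R + T * (M * (‖F 0‖ + L * ρ)) ≤ ρ) {x : X} {y : Y}
    (hxy : ‖x‖ + ‖y‖ ≤ R) :
    ∃ u, IsMild C K F T x y u ∧ ∀ t ∈ Icc 0 T, ‖u t‖ ≤ ρ := by
  have hM := hC.nonneg
  let ext : C(Icc 0 T, X) → ℝ → X := fun u ↦ IccExtend hT u
  have hext : ∀ u, Continuous (ext u) := fun u ↦ u.continuous.Icc_extend'
  have hextn : ∀ u t, ‖ext u t‖ ≤ ‖u‖ := fun u t ↦ u.norm_coe_le_norm _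
  have hexts : ∀ u v t, ‖ext u t - ext v t‖ ≤ ‖u - v‖ := fun u v t ↦
    (u - v).norm_coe_le_norm (projIcc 0 T hT t)
  let G : C(Icc 0 T, X) → ℝ → X := fun u t ↦
    C t x + K t y + ∫ τ in (0 : ℝ)..t, K (t - τ) (F (ext u τ))
  have hG : ∀ u, Continuous (G u) := fun u ↦
    ((hC.continuous_apply x).add (hK.continuous_apply y)).add
      (hK.continuous_duhamel (hF.comp (hext u)))
  let Φ : C(Icc 0 T, X) → C(Icc 0 T, X) := fun u ↦ ⟨fun t ↦ G u t, (hG u).comp continuous_subtype_val⟩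
  have hFn : ∀ z, ‖z‖ ≤ ρ → ‖F z‖ ≤ ‖F 0‖ + L * ρ := by
    intro z hz
    have h1 := hL z 0 hz (by simpa using hρ0)
    rw [sub_zero] at h1
    have h2 : F z = F 0 + (F z - F 0) := by abel
    rw [h2]
    refine (norm_add_le _ _).trans ?_
    gcongr
    exact h1.trans (by gcongr)
  have hmaps : MapsTo Φ (Metric.closedBall 0 ρ) (Metric.closedBall 0 ρ) := by
    intro u hu
    rw [mem_closedBall_zero_iff] at hu ⊢
    refine (ContinuousMap.norm_le _ hρ0).2 fun t ↦ ?_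
    have h1 : ‖∫ τ in (0 : ℝ)..t, K (t - τ) (F (ext u τ))‖ ≤
        M * (‖F 0‖ + L * ρ) * |(t : ℝ) - 0| := by
      refine intervalIntegral.norm_integral_le_of_norm_le_const fun τ _ ↦ ?_
      refine (hK.bound _ _).trans ?_
      gcongr
      exact hFn _ ((hextn u τ).trans hu)
    rw [sub_zero, abs_of_nonneg t.2.1] at h1
    have h0 : 0 ≤ M * (‖F 0‖ + L * ρ) := by positivity
    calc ‖G u t‖ ≤ ‖C t x‖ + ‖K t y‖ + ‖∫ τ in (0 : ℝ)..t, K (t - τ) (F (ext u τ))‖ := norm_add₃_le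
      _ ≤ M * ‖x‖ + M * ‖y‖ + M * (‖F 0‖ + L * ρ) * T := by
          gcongr
          · exact hC.bound _ _
          · exact hK.bound _ _
          · exact h1.trans (mul_le_mul_of_nonneg_left t.2.2 h0)
      _ = M * (‖x‖ + ‖y‖) + T * (M * (‖F 0‖ + L * ρ)) := by ring
      _ ≤ M * R + T * (M * (‖F 0‖ + L * ρ)) := by gcongr
      _ ≤ ρ := hρ
  have hcontr : ContractingWith (1 / 2) (hmaps.restrict Φ _ _) := by
    refine ⟨by norm_num, LipschitzWith.of_dist_le_mul fun u v ↦ ?_⟩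
    have hu := mem_closedBall_zero_iff.1 u.2
    have hv := mem_closedBall_zero_iff.1 v.2
    rw [Subtype.dist_eq, Subtype.dist_eq, dist_eq_norm, dist_eq_norm]
    simp only [MapsTo.val_restrict_apply]
    refine (ContinuousMap.norm_le _ (by positivity)).2 fun t ↦ ?_
    have e : (Φ u - Φ v) t = ∫ τ in (0 : ℝ)..t, K (t - τ) (F (ext u τ) - F (ext v τ)) := by
      have hi : ∀ u, IntervalIntegrable (fun τ ↦ K (t - τ) (F (ext u τ))) volume 0 t := fun u ↦
        hK.intervalIntegrable (hF.comp (hext u)).continuousOn t.2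
      simp only [map_sub]
      rw [intervalIntegral.integral_sub (hi _) (hi _)]
      change G u t - G v t = _
      simp only [G]
      abel
    rw [e]
    have h1 : ‖∫ τ in (0 : ℝ)..t, K (t - τ) (F (ext u τ) - F (ext v τ))‖ ≤
        M * (L * ‖(u : C(Icc 0 T, X)) - v‖) * |(t : ℝ) - 0| := by
      refine intervalIntegral.norm_integral_le_of_norm_le_const fun τ _ ↦ ?_
      refine (hK.bound _ _).trans ?_
      gcongr
      refine (hL _ _ ((hextn u τ).trans hu) ((hextn v τ).trans hv)).trans ?_
      gcongr
      exact hexts u v τ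
    rw [sub_zero, abs_of_nonneg t.2.1] at h1
    calc _ ≤ M * (L * ‖(u : C(Icc 0 T, X)) - v‖) * t := h1
      _ ≤ M * (L * ‖(u : C(Icc 0 T, X)) - v‖) * T := by
          gcongr
          exact t.2.2
      _ = (M * L * T) * ‖(u : C(Icc 0 T, X)) - v‖ := by ring
      _ ≤ 1 / 2 * ‖(u : C(Icc 0 T, X)) - v‖ := by gcongr
      _ = _ := by norm_num
  obtain ⟨u, hu, hfix, -⟩ := hcontr.exists_fixedPoint' (Metric.isClosed_closedBall.isComplete)
    hmaps (x := 0) (by simpa using hρ0) (edist_ne_top _ _)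
  rw [mem_closedBall_zero_iff] at hu
  refine ⟨ext u, ⟨(hext u).continuousOn, fun t ht ↦ ?_⟩, fun t _ ↦ (hextn u t).trans hu⟩
  have h1 : ext u t = u ⟨t, ht⟩ := IccExtend_of_mem hT _ ht
  rw [h1]
  conv_lhs => rw [← hfix]
  rfl

/-- Local well-posedness of the abstract Cauchy problem. -/
theorem exists_wellPosed [CompleteSpace X] (hC : IsStrongFamily C M) (hK : IsStrongFamily K M)
    (hF : Continuous F)
    (hL : ∀ ρ : ℝ, ∃ L, 0 ≤ L ∧ ∀ u v, ‖u‖ ≤ ρ → ‖v‖ ≤ ρ → ‖F u - F v‖ ≤ L * ‖u - v‖)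
    {R : ℝ} (hR : 0 ≤ R) :
    ∃ T, 0 < T ∧ T ≤ 1 ∧
      (∀ x y, ‖x‖ + ‖y‖ ≤ R → ∃ u, IsMild C K F T x y u) ∧
      (∀ x y u v, IsMild C K F T x y u → IsMild C K F T x y v → EqOn u v (Icc 0 T)) ∧
      ∃ A : ℝ, 0 ≤ A ∧ ∀ x y x' y' u v, ‖x‖ + ‖y‖ ≤ R → ‖x'‖ + ‖y'‖ ≤ R → IsMild C K F T x y u →
        IsMild C K F T x' y' v → ∀ t ∈ Icc 0 T, ‖u t - v t‖ ≤ A * (‖x - x'‖ + ‖y - y'‖) := by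
  have hM := hC.nonneg
  -- The linear evolution of the data has norm at most `M * R`; one unit is left for the Duhamel
  -- term.
  set ρ := M * R + 1 with hρ
  have hρ0 : 0 ≤ ρ := by positivity
  obtain ⟨L, hL0, hLρ⟩ := hL ρ
  set B := M * (‖F 0‖ + L * ρ) with hB
  have hB0 : 0 ≤ B := by positivity
  -- This choice gives at once `T ≤ 1`, `T * B ≤ 1` for invariance of the ball, and `M * L * T ≤
  -- 1/2` for the contraction.
  set T := 1 / (1 + B + 2 * (M * L)) with hTdef
  have hden : 0 < 1 + B + 2 * (M * L) := by positivity
  have hT0 : 0 < T := by positivity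
  have hTm : T * (1 + B + 2 * (M * L)) = 1 := by
    rw [hTdef]
    field_simp
  have hTB : 0 ≤ T * B := by positivity
  have hTL : 0 ≤ T * (2 * (M * L)) := by positivity
  have hex : ∀ x y, ‖x‖ + ‖y‖ ≤ R → ∃ u, IsMild C K F T x y u ∧ ∀ t ∈ Icc 0 T, ‖u t‖ ≤ ρ :=
    fun x y hxy ↦ exists_isMild_of_small hC hK hF hT0.le hL0 hρ0 hLρ (by linarith)
      (by rw [hρ, ← hρ, ← hB]; linarith) hxy
  have huniq : ∀ x y u v, IsMild C K F T x y u → IsMild C K F T x y v → EqOn u v (Icc 0 T) := by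
    -- Uniqueness is not restricted to the ball: any two solutions are bounded on the compact
    -- interval, and Gronwall works with the Lipschitz constant of that larger radius.
    intro x y u v hu hv t ht
    obtain ⟨r₁, h₁⟩ := isCompact_Icc.exists_bound_of_continuousOn hu.continuousOn
    obtain ⟨r₂, h₂⟩ := isCompact_Icc.exists_bound_of_continuousOn hv.continuousOn
    obtain ⟨L', hL0', hL'⟩ := hL (max r₁ r₂)
    have := hu.norm_sub_le hC hK hF hL0' hL' hT0.le hv
      (fun t ht ↦ (h₁ t ht).trans (le_max_left _ _))
      (fun t ht ↦ (h₂ t ht).trans (le_max_right _ _)) t ht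
    simp only [sub_self, norm_zero, add_zero, mul_zero, zero_mul] at this
    exact sub_eq_zero.1 (norm_le_zero_iff.1 this)
  refine ⟨T, hT0, by nlinarith, fun x y hxy ↦ (hex x y hxy).imp fun u hu ↦ hu.1, huniq,
    M * Real.exp (M * L * T), by positivity, fun x y x' y' u v hxy hxy' hu hv t ht ↦ ?_⟩
  -- The given solutions are not known to stay in the ball, but by uniqueness they coincide with the
  -- constructed ones, which do; so the constant depends on `R` only.
  obtain ⟨u', hu', hub⟩ := hex x y hxy
  obtain ⟨v', hv', hvb⟩ := hex x' y' hxy'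
  rw [huniq x y u u' hu hu' ht, huniq x' y' v v' hv hv' ht]
  refine (hu'.norm_sub_le hC hK hF hL0 hLρ hT0.le hv' hub hvb t ht).trans ?_
  rw [mul_right_comm]
  gcongr
  exact ht.2

end Abstract

/-! ### Modulation spaces as Banach spaces. -/

variable {d : ℕ}

/-- A window and the integrability exponents of a scale of modulation spaces. -/
structure ModParams (d : ℕ) where
  g : 𝓢(Space d, ℂ)
  p : ℝ≥0∞
  q : ℝ≥0∞
  g_ne : g ≠ 0
  one_le_p : 1 ≤ p
  one_le_q : 1 ≤ q

namespace ModParams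

/-- The modulation norm with the given parameters. -/
def nrm (P : ModParams d) (s : ℝ) (f : 𝓢'(Space d, ℂ)) : ℝ≥0∞ := modNorm P.g P.p P.q s f

variable (P : ModParams d) (s : ℝ)

theorem nrm_add_le (f h : 𝓢'(Space d, ℂ)) : P.nrm s (f + h) ≤ P.nrm s f + P.nrm s h :=
  modNorm_add_le P.g P.one_le_p P.one_le_q s f h

theorem nrm_smul_le (c : ℂ) (f : 𝓢'(Space d, ℂ)) : P.nrm s (c • f) ≤ ‖c‖ₑ * P.nrm s f :=
  modNorm_smul_le P.g P.one_le_p P.one_le_q s c f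

theorem nrm_zero : P.nrm s (0 : 𝓢'(Space d, ℂ)) = 0 := modNorm_zero P.g P.p P.q s

theorem nrm_sub_comm (f h : 𝓢'(Space d, ℂ)) : P.nrm s (f - h) = P.nrm s (h - f) :=
  modNorm_sub_comm P.g P.p P.q s f h

theorem nrm_sub_le_add (f h k : 𝓢'(Space d, ℂ)) :
    P.nrm s (f - k) ≤ P.nrm s (f - h) + P.nrm s (h - k) := by
  rw [← sub_add_sub_cancel f h k]
  exact P.nrm_add_le s _ _

theorem nrm_ofSchwartz_lt_top (φ : 𝓢(Space d, ℂ)) : P.nrm s (ofSchwartz φ) < ∞ :=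
  modNorm_ofSchwartz_lt_top P.g P.one_le_p P.one_le_q s φ

/-- The modulation space as a subspace of the tempered distributions. -/
def modSubmodule : Submodule ℂ 𝓢'(Space d, ℂ) where
  carrier := modSpace P.g P.p P.q s
  zero_mem' := fun ε hε ↦ ⟨0, by rwa [ofSchwartz_zero, sub_zero, modNorm_zero]⟩
  add_mem' := by
    intro f h hf hh ε hε
    obtain ⟨φ, hφ⟩ := hf (ε / 2) (ENNReal.half_pos hε.ne')
    obtain ⟨ψ, hψ⟩ := hh (ε / 2) (ENNReal.half_pos hε.ne')
    refine ⟨φ + ψ, ?_⟩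
    have e : f + h - ofSchwartz (φ + ψ) = (f - ofSchwartz φ) + (h - ofSchwartz ψ) := by
      rw [ofSchwartz_add]
      abel
    rw [e, ← ENNReal.add_halves ε]
    exact (P.nrm_add_le s _ _).trans_lt (ENNReal.add_lt_add hφ hψ)
  smul_mem' := by
    intro c f hf ε hε
    obtain ⟨φ, hφ⟩ := hf (ε / (‖c‖ₑ + 1)) (ENNReal.div_pos hε.ne' (by simp))
    refine ⟨c • φ, ?_⟩
    rw [ofSchwartz_smul, ← smul_sub]
    refine (P.nrm_smul_le s _ _).trans_lt ?_
    rcases eq_or_ne ε ∞ with rfl | hε'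
    · refine lt_of_le_of_ne le_top (ENNReal.mul_ne_top (by simp) ?_)
      exact (hφ.trans_le le_top).ne
    calc ‖c‖ₑ * P.nrm s (f - ofSchwartz φ) ≤ (‖c‖ₑ + 1) * P.nrm s (f - ofSchwartz φ) :=
          mul_le_mul_left le_self_add _
      _ < ε := (ENNReal.lt_div_iff_mul_lt (by simp) (by simp)).1 hφ |> fun h ↦ by
          rwa [mul_comm]

end ModParams

/-- The modulation space `M^{p,q}_s` as a Banach space. -/
def ModSp (P : ModParams d) (s : ℝ) : Type := P.modSubmodule s

namespace ModSp

variable {P : ModParams d} {s : ℝ}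

instance : AddCommGroup (ModSp P s) := inferInstanceAs (AddCommGroup (P.modSubmodule s))

instance : Module ℂ (ModSp P s) := inferInstanceAs (Module ℂ (P.modSubmodule s))

/-- The tempered distribution underlying an element of the modulation space. -/
def val : ModSp P s →ₗ[ℂ] 𝓢'(Space d, ℂ) := (P.modSubmodule s).subtype

theorem mem (f : ModSp P s) : val f ∈ modSpace P.g P.p P.q s := Subtype.property f

theorem val_injective : Function.Injective (val : ModSp P s → 𝓢'(Space d, ℂ)) :=
  Subtype.val_injective

/-- The element of the modulation space given by a tempered distribution. -/
def mk (f : 𝓢'(Space d, ℂ)) (hf : f ∈ modSpace P.g P.p P.q s) : ModSp P s := ⟨f, hf⟩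

@[simp]
theorem val_mk (f : 𝓢'(Space d, ℂ)) (hf : f ∈ modSpace P.g P.p P.q s) :
    val (mk f hf : ModSp P s) = f := rfl

theorem nrm_lt_top (f : ModSp P s) : P.nrm s (val f) < ∞ := by
  obtain ⟨φ, hφ⟩ := f.mem 1 one_pos
  have h := P.nrm_sub_le_add s (val f) (ofSchwartz φ) 0
  rw [sub_zero, sub_zero] at h
  exact h.trans_lt (ENNReal.add_lt_top.2 ⟨hφ.trans ENNReal.one_lt_top, P.nrm_ofSchwartz_lt_top s φ⟩)

instance : Norm (ModSp P s) := ⟨fun f ↦ (P.nrm s (val f)).toReal⟩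

theorem norm_def (f : ModSp P s) : ‖f‖ = (P.nrm s (val f)).toReal := rfl

theorem ofReal_norm' (f : ModSp P s) : ENNReal.ofReal ‖f‖ = P.nrm s (val f) :=
  ENNReal.ofReal_toReal f.nrm_lt_top.ne

/-- Convergence in norm implies convergence of distributions. This gives definiteness of the norm,
the candidate limit in the completeness proof, and the continuous test functionals. -/
theorem exists_norm_apply_le (P : ModParams d) (s : ℝ) :
    ∃ Q : Seminorm ℝ 𝓢(Space d, ℂ), Continuous Q ∧
      ∀ (f : ModSp P s) ψ, ‖val f ψ‖ ≤ Q ψ * ‖f‖ := by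
  obtain ⟨Q, hQ, h⟩ := exists_enorm_apply_le P.g_ne s P.one_le_p P.one_le_q
  refine ⟨Q, hQ, fun f ψ ↦ ?_⟩
  have h1 := h (val f) ψ
  have h2 := f.ofReal_norm'
  rw [ModParams.nrm] at h2
  rw [← h2, ← ENNReal.ofReal_mul (apply_nonneg Q ψ), ← ofReal_norm] at h1
  exact (ENNReal.ofReal_le_ofReal_iff (mul_nonneg (apply_nonneg Q ψ) ENNReal.toReal_nonneg)).1 h1

theorem core : NormedSpace.Core ℂ (ModSp P s) where
  norm_nonneg f := ENNReal.toReal_nonneg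
  norm_smul c f := by
    -- The inequality suffices: applied to `c⁻¹` and `c • f` it yields the reverse one.
    have key : ∀ (c : ℂ) (f : ModSp P s), ‖c • f‖ ≤ ‖c‖ * ‖f‖ := fun c f ↦ by
      have h := P.nrm_smul_le s c (val f)
      have h1 := ENNReal.toReal_mono (ENNReal.mul_ne_top (by simp) f.nrm_lt_top.ne) h
      rw [ENNReal.toReal_mul, toReal_enorm, ← map_smul] at h1
      exact h1
    refine le_antisymm (key c f) ?_
    rcases eq_or_ne c 0 with rfl | hc
    · rw [norm_zero, zero_mul]
      exact ENNReal.toReal_nonneg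
    · have h := key c⁻¹ (c • f)
      rw [inv_smul_smul₀ hc, norm_inv] at h
      rwa [← div_eq_inv_mul, le_div_iff₀ (norm_pos_iff.2 hc), mul_comm] at h
  norm_triangle f h := by
    have h1 := ENNReal.toReal_mono (ENNReal.add_ne_top.2 ⟨f.nrm_lt_top.ne, h.nrm_lt_top.ne⟩)
      (P.nrm_add_le s (val f) (val h))
    rw [ENNReal.toReal_add f.nrm_lt_top.ne h.nrm_lt_top.ne, ← map_add] at h1
    exact h1
  norm_eq_zero_iff f := by
    refine ⟨fun hf ↦ val_injective ?_, fun hf ↦ ?_⟩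
    · obtain ⟨Q, -, hQ⟩ := exists_norm_apply_le P s
      rw [map_zero]
      ext ψ
      have := hQ f ψ
      rw [hf, mul_zero] at this
      exact norm_le_zero_iff.1 this
    · rw [hf, norm_def, map_zero, P.nrm_zero, ENNReal.toReal_zero]

instance : NormedAddCommGroup (ModSp P s) := NormedAddCommGroup.ofCore core

instance : NormedSpace ℂ (ModSp P s) := NormedSpace.ofCore core

theorem nrm_sub_eq (f h : ModSp P s) : P.nrm s (val f - val h) = ENNReal.ofReal ‖f - h‖ := by
  rw [ofReal_norm', map_sub]

/-- Schwartz functions as elements of the modulation space. -/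
def ofS (P : ModParams d) (s : ℝ) (φ : 𝓢(Space d, ℂ)) : ModSp P s :=
  mk (ofSchwartz φ) fun ε hε ↦ ⟨φ, by rwa [sub_self, modNorm_zero]⟩

@[simp]
theorem val_ofS (φ : 𝓢(Space d, ℂ)) : val (ofS P s φ) = ofSchwartz φ := rfl

theorem denseRange_ofS : DenseRange (ofS P s) := by
  refine Metric.dense_iff.2 fun f r hr ↦ ?_
  obtain ⟨φ, hφ⟩ := f.mem (ENNReal.ofReal r) (ENNReal.ofReal_pos.2 hr)
  refine ⟨ofS P s φ, ?_, mem_range_self φ⟩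
  rw [Metric.mem_ball', dist_eq_norm]
  rw [← ENNReal.ofReal_lt_ofReal_iff hr, ← nrm_sub_eq]
  exact hφ

/-- Testing against a Schwartz function, as a continuous functional on the modulation space. -/
def eval (P : ModParams d) (s : ℝ) (ψ : 𝓢(Space d, ℂ)) : ModSp P s →L[ℂ] ℂ :=
  LinearMap.mkContinuousOfExistsBound
    { toFun := fun f ↦ val f ψ
      map_add' := fun f h ↦ by rw [map_add]; rfl
      map_smul' := fun c f ↦ by rw [map_smul]; rfl }
    ((exists_norm_apply_le P s).elim fun Q h ↦ ⟨Q ψ, fun f ↦ h.2 f ψ⟩)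

@[simp]
theorem eval_apply (ψ : 𝓢(Space d, ℂ)) (f : ModSp P s) : eval P s ψ f = val f ψ := rfl

theorem tendsto_val {ι : Type*} {l : Filter ι} {f : ι → ModSp P s} {F : ModSp P s}
    (h : Tendsto f l (𝓝 F)) (ψ : 𝓢(Space d, ℂ)) :
    Tendsto (fun i ↦ val (f i) ψ) l (𝓝 (val F ψ)) :=
  ((eval P s ψ).continuous.tendsto F).comp h

theorem tendsto_iff {ι : Type*} {l : Filter ι} {f : ι → ModSp P s} {F : ModSp P s} :
    Tendsto f l (𝓝 F) ↔ Tendsto (fun i ↦ P.nrm s (val (f i) - val F)) l (𝓝 0) := by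
  rw [tendsto_iff_norm_sub_tendsto_zero]
  simp_rw [nrm_sub_eq]
  constructor
  · intro h
    simpa using ENNReal.tendsto_ofReal h
  · intro h
    have := (ENNReal.tendsto_toReal ENNReal.zero_ne_top).comp h
    simpa [Function.comp_def] using this

/-- A Cauchy sequence converges against every test function to a tempered distribution. Lower
semicontinuity of the norm under weak limits upgrades this to norm convergence, and then the limit
inherits approximability by Schwartz functions. -/
instance : CompleteSpace (ModSp P s) := by
  refine Metric.complete_of_cauchySeq_tendsto fun f hf ↦ ?_
  obtain ⟨Q, hQ, hQle⟩ := exists_norm_apply_le P s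
  have hc : ∀ ψ, CauchySeq fun n ↦ val (f n) ψ := fun ψ ↦
    hf.map (eval P s ψ).uniformContinuous
  choose F hF using fun ψ ↦ cauchySeq_tendsto_of_complete (hc ψ)
  obtain ⟨B, hB⟩ := hf.isBounded_range.exists_norm_le
  have hB' : ∀ n, ‖f n‖ ≤ B := fun n ↦ hB _ (mem_range_self n)
  have hFle : ∀ ψ, ‖F ψ‖ ≤ Q ψ * B := fun ψ ↦ by
    refine le_of_tendsto (hF ψ).norm (.of_forall fun n ↦ (hQle _ _).trans ?_)
    exact mul_le_mul_of_nonneg_left (hB' n) (apply_nonneg Q ψ)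
  let Fl : 𝓢(Space d, ℂ) →ₗ[ℂ] ℂ :=
    { toFun := F
      map_add' := fun φ ψ ↦ by
        refine tendsto_nhds_unique (hF (φ + ψ)) (((hF φ).add (hF ψ)).congr fun n ↦ ?_)
        exact (map_add (val (f n)) φ ψ).symm
      map_smul' := fun c ψ ↦ by
        refine tendsto_nhds_unique (hF (c • ψ)) (((hF ψ).const_mul c).congr fun n ↦ ?_)
        exact (map_smul (val (f n)) c ψ).symm }
  have hFlc : Continuous Fl := by
    refine continuous_of_continuousAt_zero Fl ?_
    rw [ContinuousAt, map_zero]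
    refine squeeze_zero_norm hFle ?_
    have := (hQ.tendsto 0).mul_const B
    rwa [map_zero, zero_mul] at this
  let G : 𝓢'(Space d, ℂ) := (⟨Fl, hFlc⟩ : 𝓢(Space d, ℂ) →L[ℂ] ℂ)
  have hlim : ∀ ε : ℝ, 0 < ε → ∃ N, ∀ n ≥ N, P.nrm s (val (f n) - G) ≤ ENNReal.ofReal ε := by
    intro ε hε
    obtain ⟨N, hN⟩ := Metric.cauchySeq_iff.1 hf ε hε
    refine ⟨N, fun n hn ↦ ?_⟩
    -- With `n` fixed the second index tends to infinity; shifting it by `N` makes the Cauchy bound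
    -- hold for every `m`.
    refine modNorm_le_of_tendsto P.g P.one_le_q s (f := fun m ↦ val (f n) - val (f (m + N)))
      (fun ψ ↦ ?_) fun m ↦ ?_
    · have h1 := ((tendsto_add_atTop_iff_nat N).2 (hF ψ)).const_sub (val (f n) ψ)
      exact h1
    · have h1 := hN n hn (m + N) (Nat.le_add_left N m)
      rw [dist_eq_norm] at h1
      exact (nrm_sub_eq (f n) (f (m + N))).trans_le (ENNReal.ofReal_le_ofReal h1.le)
  have hGmem : G ∈ modSpace P.g P.p P.q s := by
    intro ε hε
    obtain ⟨δ, hδ0, hδ⟩ := ENNReal.lt_iff_exists_real_btwn.1 (ENNReal.half_pos hε.ne')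
    have hδ1 : 0 < δ := ENNReal.ofReal_pos.1 hδ.1
    obtain ⟨N, hN⟩ := hlim δ hδ1
    obtain ⟨φ, hφ⟩ := (f N).mem (ε / 2) (ENNReal.half_pos hε.ne')
    refine ⟨φ, ?_⟩
    rw [← ENNReal.add_halves ε]
    refine (P.nrm_sub_le_add s G (val (f N)) (ofSchwartz φ)).trans_lt (ENNReal.add_lt_add ?_ hφ)
    rw [P.nrm_sub_comm]
    exact (hN N le_rfl).trans_lt hδ.2
  refine ⟨mk G hGmem, Metric.tendsto_atTop.2 fun ε hε ↦ ?_⟩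
  obtain ⟨N, hN⟩ := hlim (ε / 2) (half_pos hε)
  refine ⟨N, fun n hn ↦ ?_⟩
  have h1 := hN n hn
  have h2 := nrm_sub_eq (f n) (mk G hGmem)
  rw [val_mk] at h2
  rw [h2, ENNReal.ofReal_le_ofReal_iff (half_pos hε).le] at h1
  rw [dist_eq_norm]
  linarith

end ModSp

/-! ### Propagators and nonlinearity on the Banach spaces. -/

variable {d : ℕ} {P : ModParams d} {s : ℝ}

/-- The truncation of the time variable to `[-1, 1]`. -/
def clamp (t : ℝ) : ℝ := max (-1) (min 1 t)

theorem abs_clamp_le (t : ℝ) : |clamp t| ≤ 1 := by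
  rw [clamp, abs_le]
  exact ⟨le_max_left _ _, max_le (by norm_num) (min_le_left _ _)⟩

theorem clamp_of_abs_le {t : ℝ} (h : |t| ≤ 1) : clamp t = t := by
  rw [abs_le] at h
  rw [clamp, min_eq_right h.2, max_eq_right h.1]

theorem continuous_clamp : Continuous clamp :=
  continuous_const.max (continuous_const.min continuous_id)

namespace ModSp

theorem norm_le_mul_of_nrm_le {σ : ℝ} {f : ModSp P s} {h : ModSp P σ} {C : ℝ≥0}
    (hle : P.nrm s (val f) ≤ C * P.nrm σ (val h)) : ‖f‖ ≤ C * ‖h‖ := by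
  have h1 := ENNReal.toReal_mono (ENNReal.mul_ne_top ENNReal.coe_ne_top h.nrm_lt_top.ne) hle
  rwa [ENNReal.toReal_mul, ENNReal.coe_toReal] at h1

/-- A bounded map between modulation spaces given by a linear map of tempered distributions. -/
def bddMap {σ : ℝ} (A : 𝓢'(Space d, ℂ) →L[ℂ] 𝓢'(Space d, ℂ)) (C : ℝ≥0)
    (hA : ∀ f, P.nrm s (A f) ≤ C * P.nrm σ f)
    (hm : ∀ f ∈ modSpace P.g P.p P.q σ, A f ∈ modSpace P.g P.p P.q s) :
    ModSp P σ →L[ℝ] ModSp P s :=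
  let A' : ModSp P σ →ₗ[ℂ] ModSp P s :=
    { toFun := fun f ↦ mk (A (val f)) (hm _ f.mem)
      map_add' := fun f h ↦ val_injective <| by
        rw [val_mk, map_add, map_add, map_add, val_mk, val_mk]
      map_smul' := fun c f ↦ val_injective <| by
        rw [val_mk, map_smul, map_smul, RingHom.id_apply, map_smul, val_mk] }
  (A'.mkContinuous C fun f ↦ norm_le_mul_of_nrm_le (hA (val f))).restrictScalars ℝ

@[simp]
theorem val_bddMap {σ : ℝ} (A : 𝓢'(Space d, ℂ) →L[ℂ] 𝓢'(Space d, ℂ)) (C : ℝ≥0)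
    (hA : ∀ f, P.nrm s (A f) ≤ C * P.nrm σ f)
    (hm : ∀ f ∈ modSpace P.g P.p P.q σ, A f ∈ modSpace P.g P.p P.q s) (f : ModSp P σ) :
    val (bddMap A C hA hm f) = A (val f) := rfl

theorem norm_bddMap_le {σ : ℝ} (A : 𝓢'(Space d, ℂ) →L[ℂ] 𝓢'(Space d, ℂ)) (C : ℝ≥0)
    (hA : ∀ f, P.nrm s (A f) ≤ C * P.nrm σ f)
    (hm : ∀ f ∈ modSpace P.g P.p P.q σ, A f ∈ modSpace P.g P.p P.q s) (f : ModSp P σ) :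
    ‖bddMap A C hA hm f‖ ≤ C * ‖f‖ :=
  norm_le_mul_of_nrm_le (hA (val f))

/-- A family of multipliers that is bounded uniformly in time and Lipschitz in time on Schwartz
functions defines a strongly continuous family. -/
theorem exists_isStrongFamily {σ : ℝ} (A : ℝ → 𝓢'(Space d, ℂ) →L[ℂ] 𝓢'(Space d, ℂ)) {C : ℝ≥0}
    (hA : ∀ t, |t| ≤ 1 → ∀ f, P.nrm s (A t f) ≤ C * P.nrm σ f)
    (hm : ∀ t, |t| ≤ 1 → ∀ f ∈ modSpace P.g P.p P.q σ, A t f ∈ modSpace P.g P.p P.q s)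
    (hL : ∀ φ : 𝓢(Space d, ℂ), ∃ L : ℝ≥0, ∀ t t₀, |t| ≤ 1 → |t₀| ≤ 1 →
      P.nrm s (A t (ofSchwartz φ) - A t₀ (ofSchwartz φ)) ≤ L * ENNReal.ofReal |t - t₀|)
    {M : ℝ} (hM : C ≤ M) :
    ∃ B : ℝ → ModSp P σ →L[ℝ] ModSp P s, IsStrongFamily B M ∧
      ∀ t, |t| ≤ 1 → ∀ f, val (B t f) = A t (val f) := by
  -- The uniform bounds hold for `|t| ≤ 1` only; truncating time produces a family on the whole
  -- line, as `IsStrongFamily` requires, that agrees with `A` on `[-1, 1]`.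
  have hc := abs_clamp_le
  refine ⟨fun t ↦ bddMap (A (clamp t)) C (hA _ (hc t)) (hm _ (hc t)),
    .of_dense (C.coe_nonneg.trans hM) (fun t f ↦ ?_) (D := range (ofS P σ)) denseRange_ofS ?_,
    fun t ht f ↦ by rw [val_bddMap, clamp_of_abs_le ht]⟩
  · exact (norm_bddMap_le _ _ _ _ f).trans (mul_le_mul_of_nonneg_right hM (norm_nonneg f))
  · rintro _ ⟨φ, rfl⟩
    obtain ⟨L, hL⟩ := hL φ
    refine continuous_iff_continuousAt.2 fun t₀ ↦ tendsto_iff.2 ?_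
    refine tendsto_of_tendsto_of_tendsto_of_le_of_le tendsto_const_nhds ?_ (fun _ ↦ zero_le)
      fun t ↦ hL (clamp t) (clamp t₀) (hc t) (hc t₀)
    have h1 : Continuous fun t ↦ |clamp t - clamp t₀| := (continuous_clamp.sub continuous_const).abs
    have h2 := ENNReal.Tendsto.const_mul (a := (L : ℝ≥0∞))
      (ENNReal.tendsto_ofReal (h1.tendsto t₀)) (Or.inr ENNReal.coe_ne_top)
    simpa using h2

/-- The propagators of the wave equation on the modulation spaces. -/
theorem exists_propagators (P : ModParams d) (s : ℝ) :
    ∃ (M : ℝ) (C : ℝ → ModSp P s →L[ℝ] ModSp P s) (K : ℝ → ModSp P (s - 1) →L[ℝ] ModSp P s),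
      IsStrongFamily C M ∧ IsStrongFamily K M ∧
      (∀ t, |t| ≤ 1 → ∀ f, val (C t f) = propCos t (val f)) ∧
      ∀ t, |t| ≤ 1 → ∀ f, val (K t f) = propSin t (val f) := by
  obtain ⟨C₁, h₁⟩ := exists_modNorm_propCos_le P.g_ne P.one_le_p P.one_le_q s
  obtain ⟨C₂, h₂⟩ := exists_modNorm_propSin_le P.g_ne P.one_le_p P.one_le_q s
  obtain ⟨B₁, hB₁, e₁⟩ := exists_isStrongFamily (P := P) (s := s) (σ := s) propCos h₁
    (fun t ht f hf ↦ propCos_mem_modSpace P.g_ne P.one_le_p P.one_le_q ht hf)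
    (fun φ ↦ exists_modNorm_propCos_sub_le P.g_ne P.one_le_p P.one_le_q s φ)
    (NNReal.coe_le_coe.2 (le_max_left C₁ C₂))
  obtain ⟨B₂, hB₂, e₂⟩ := exists_isStrongFamily (P := P) (s := s) (σ := s - 1) propSin h₂
    (fun t ht f hf ↦ propSin_mem_modSpace P.g_ne P.one_le_p P.one_le_q ht hf)
    (fun φ ↦ exists_modNorm_propSin_sub_le P.g_ne P.one_le_p P.one_le_q s φ)
    (NNReal.coe_le_coe.2 (le_max_right C₁ C₂))
  exact ⟨_, B₁, B₂, hB₁, hB₂, e₁, e₂⟩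

/-- The power nonlinearity on the modulation space. -/
theorem exists_nonlinearity (P : ModParams d) (hs : 0 ≤ s) {q' : ℝ≥0∞} (hqq : P.q⁻¹ + q'⁻¹ = 1)
    (lam : ℂ) (k : ℕ) (hk : ((2 * k * d : ℕ) : ℝ≥0∞) < q')
    (hk1 : ((2 * k + 1 : ℕ) : ℝ≥0∞) ≤ q') :
    ∃ F : ModSp P s → ModSp P (s - 1),
      (∀ ρ : ℝ, ∃ L, 0 ≤ L ∧ ∀ u v, ‖u‖ ≤ ρ → ‖v‖ ≤ ρ → ‖F u - F v‖ ≤ L * ‖u - v‖) ∧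
      ∀ (u : ModSp P s) w, IsPower P.g P.p P.q s lam k (val u) w ↔ w = val (F u) := by
  obtain ⟨C, hC⟩ := exists_modNorm_nonlinS_sub_le P.g_ne hs P.one_le_p P.one_le_q hqq lam k hk hk1
  have hN : ∀ ρ φ ψ, ‖ofS P s φ‖ ≤ ρ → ‖ofS P s ψ‖ ≤ ρ →
      ‖ofS P (s - 1) (nonlinS lam k φ) - ofS P (s - 1) (nonlinS lam k ψ)‖ ≤
        C * (ρ + ρ) ^ (2 * k) * ‖ofS P s φ - ofS P s ψ‖ := by
    intro ρ φ ψ hφ hψ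
    have hρ : 0 ≤ ρ := (norm_nonneg _).trans hφ
    have h1 := hC φ ψ
    have e1 := nrm_sub_eq (ofS P (s - 1) (nonlinS lam k φ)) (ofS P (s - 1) (nonlinS lam k ψ))
    have e2 := nrm_sub_eq (ofS P s φ) (ofS P s ψ)
    have e3 := (ofS P s φ).ofReal_norm'
    have e4 := (ofS P s ψ).ofReal_norm'
    simp only [val_ofS, ModParams.nrm] at e1 e2 e3 e4
    rw [e1, e2, ← e3, ← e4, ← ENNReal.ofReal_add (norm_nonneg _) (norm_nonneg _),
      ← ENNReal.ofReal_pow (by positivity), ← ENNReal.ofReal_mul (by positivity),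
      ← ENNReal.ofReal_coe_nnreal, ← ENNReal.ofReal_mul C.coe_nonneg,
      ENNReal.ofReal_le_ofReal_iff (by positivity)] at h1
    refine h1.trans ?_
    rw [← mul_assoc]
    gcongr
  obtain ⟨F, hF, hL⟩ := exists_extension_of_lipschitz denseRange_ofS
    (N := fun φ ↦ ofS P (s - 1) (nonlinS lam k φ)) (L := fun ρ ↦ C * (ρ + ρ) ^ (2 * k)) hN
  have hint : ∀ φ ψ : 𝓢(Space d, ℂ), ∫ x, (lam * (‖φ x‖ : ℂ) ^ (2 * k) * φ x) * ψ x =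
      val (ofS P (s - 1) (nonlinS lam k φ)) ψ := fun φ ψ ↦ by
    rw [val_ofS, ofSchwartz_apply]
    simp_rw [nonlinS_apply, mul_comm (ψ _)]
  have hconv : ∀ (u : ModSp P s) (φ : ℕ → 𝓢(Space d, ℂ)),
      Tendsto (fun n ↦ modNorm P.g P.p P.q s (val u - ofSchwartz (φ n))) atTop (𝓝 0) ↔
        Tendsto (fun n ↦ ofS P s (φ n)) atTop (𝓝 u) := fun u φ ↦ by
    rw [tendsto_iff]
    simp_rw [val_ofS, P.nrm_sub_comm s _ (val u)]
    rfl
  -- The radius `|ρ| + 1` turns the closed ball into the open one of the extension lemma and keeps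
  -- the constant nonnegative.
  refine ⟨F, fun ρ ↦ ⟨C * ((|ρ| + 1) + (|ρ| + 1)) ^ (2 * k), by positivity, fun u v hu hv ↦
    hL (|ρ| + 1) u v (by linarith [le_abs_self ρ]) (by linarith [le_abs_self ρ])⟩, fun u w ↦ ?_⟩
  constructor
  · rintro ⟨-, h⟩
    -- An approximating sequence of Schwartz functions exists, and along it the limit against each
    -- test function is unique; so `IsPower` determines `w`.
    obtain ⟨z, hz, hzu⟩ := mem_closure_iff_seq_limit.1 (denseRange_ofS (P := P) (s := s) u)
    choose φ hφ using hz
    have hφu : Tendsto (fun n ↦ ofS P s (φ n)) atTop (𝓝 u) := by simpa only [hφ] using hzu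
    ext ψ
    have h1 := h φ ((hconv u φ).2 hφu) ψ
    simp_rw [hint] at h1
    exact tendsto_nhds_unique h1 (tendsto_val (hF φ u hφu) ψ)
  · rintro rfl
    refine ⟨u.mem, fun φ hφ ψ ↦ ?_⟩
    simp_rw [hint]
    exact tendsto_val (hF φ u ((hconv u φ).1 hφ)) ψ

theorem isModCurve_iff {T : ℝ} {u : ℝ → ModSp P s} :
    IsModCurve P.g P.p P.q s T (fun t ↦ val (u t)) ↔ ContinuousOn u (Icc 0 T) :=
  ⟨fun h t ht ↦ tendsto_iff.2 (h.2 t ht), fun h ↦ ⟨fun t _ ↦ (u t).mem,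
    fun t ht ↦ tendsto_iff.1 (h t ht)⟩⟩

end ModSp

/-! ### Distributional solutions as mild solutions, and conclusion. -/

theorem IsSolution.congr {g : 𝓢(Space d, ℂ)} {p q : ℝ≥0∞} {lam : ℂ} {k : ℕ} {T : ℝ}
    {u₀ u₁ : 𝓢'(Space d, ℂ)} {u v : ℝ → 𝓢'(Space d, ℂ)}
    (h : IsSolution g p q s lam k T u₀ u₁ u) (huv : EqOn u v (Icc 0 T)) :
    IsSolution g p q s lam k T u₀ u₁ v := by
  obtain ⟨⟨h1, h2⟩, w, hw, h3⟩ := h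
  refine ⟨⟨fun t ht ↦ huv ht ▸ h1 t ht, fun t ht ↦ ?_⟩, w, fun t ht ↦ huv ht ▸ hw t ht,
    fun t ht ↦ huv ht ▸ h3 t ht⟩
  refine (h2 t ht).congr' ?_
  filter_upwards [self_mem_nhdsWithin] with τ hτ
  rw [huv hτ, huv ht]

namespace ModSp

variable {C : ℝ → ModSp P s →L[ℝ] ModSp P s} {K : ℝ → ModSp P (s - 1) →L[ℝ] ModSp P s}
  {F : ModSp P s → ModSp P (s - 1)} {M : ℝ} {lam : ℂ} {k : ℕ}

/-- Testing against a Schwartz function is a continuous functional on the Banach space, so it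
commutes with the Bochner integral, and these functionals separate points. The condition `T ≤ 1`
keeps `t` and `t - τ` in the range where the truncated propagators are the true ones. -/
theorem isSolution_iff_isMild (hK : IsStrongFamily K M)
    (hCv : ∀ t, |t| ≤ 1 → ∀ f, val (C t f) = propCos t (val f))
    (hKv : ∀ t, |t| ≤ 1 → ∀ f, val (K t f) = propSin t (val f)) (hF : Continuous F)
    (hFv : ∀ (u : ModSp P s) w, IsPower P.g P.p P.q s lam k (val u) w ↔ w = val (F u))
    {T : ℝ} (hT : T ≤ 1) {x : ModSp P s} {y : ModSp P (s - 1)} {u : ℝ → ModSp P s} :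
    IsSolution P.g P.p P.q s lam k T (val x) (val y) (fun t ↦ val (u t)) ↔
      IsMild C K F T x y u := by
  have hval : ContinuousOn u (Icc 0 T) → ∀ t ∈ Icc 0 T, ∀ ψ : 𝓢(Space d, ℂ),
      IntervalIntegrable (fun τ ↦ propSin (t - τ) (val (F (u τ))) ψ) volume 0 t ∧
      val (C t x + K t y + ∫ τ in (0 : ℝ)..t, K (t - τ) (F (u τ))) ψ =
        propCos t (val x) ψ + propSin t (val y) ψ +
          ∫ τ in (0 : ℝ)..t, propSin (t - τ) (val (F (u τ))) ψ := by
    intro hu t ht ψ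
    have hi : IntervalIntegrable (fun τ ↦ K (t - τ) (F (u τ))) volume 0 t :=
      hK.intervalIntegrable (hF.comp_continuousOn hu) ht
    have ht1 : |t| ≤ 1 := by
      rw [abs_of_nonneg ht.1]
      exact ht.2.trans hT
    have hts : ∀ τ ∈ uIcc 0 t, eval P s ψ (K (t - τ) (F (u τ))) =
        propSin (t - τ) (val (F (u τ))) ψ := by
      intro τ hτ
      rw [uIcc_of_le ht.1] at hτ
      rw [eval_apply, hKv]
      rw [abs_of_nonneg (sub_nonneg.2 hτ.2)]
      linarith [hτ.1, ht.2]
    have hi' : IntervalIntegrable (fun τ ↦ eval P s ψ (K (t - τ) (F (u τ)))) volume 0 t :=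
      ⟨(eval P s ψ).integrable_comp hi.1, (eval P s ψ).integrable_comp hi.2⟩
    refine ⟨hi'.congr fun τ hτ ↦ hts τ (uIoc_subset_uIcc hτ), ?_⟩
    rw [← eval_apply, map_add, map_add, ← (eval P s ψ).intervalIntegral_comp_comm hi,
      intervalIntegral.integral_congr hts, eval_apply, eval_apply, hCv t ht1, hKv t ht1]
  constructor
  · rintro ⟨h1, w, hw, h2⟩
    have hu := isModCurve_iff.1 h1
    refine ⟨hu, fun t ht ↦ val_injective ?_⟩
    ext ψ
    rw [(hval hu t ht ψ).2, (h2 t ht ψ).2]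
    congr 1
    refine intervalIntegral.integral_congr fun τ hτ ↦ ?_
    rw [uIcc_of_le ht.1] at hτ
    simp only [(hFv _ _).1 (hw τ ⟨hτ.1, hτ.2.trans ht.2⟩)]
  · intro h
    refine ⟨isModCurve_iff.2 h.continuousOn, fun t ↦ val (F (u t)), fun t _ ↦ (hFv _ _).2 rfl,
      fun t ht ψ ↦ ?_⟩
    obtain ⟨h1, h2⟩ := hval h.continuousOn t ht ψ
    refine ⟨h1, ?_⟩
    rw [← h2, ← h.eq t ht]

end ModSp

/-- Outside `[0, T]` a solution need not take values in the modulation space; there the lift is set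
to zero, which `IsSolution.congr` shows to be immaterial. -/
theorem IsSolution.exists_eqOn {lam : ℂ} {k : ℕ} {T : ℝ} {u₀ u₁ : 𝓢'(Space d, ℂ)}
    {u : ℝ → 𝓢'(Space d, ℂ)} (h : IsSolution P.g P.p P.q s lam k T u₀ u₁ u) :
    ∃ U : ℝ → ModSp P s, EqOn u (fun t ↦ (U t).val) (Icc 0 T) := by
  classical
  refine ⟨fun t ↦ if ht : t ∈ Icc 0 T then .mk (u t) (h.1.1 t ht) else 0, fun t ht ↦ ?_⟩
  simp only [dif_pos ht, ModSp.val_mk]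

/-- Local well-posedness in modulation spaces. -/
theorem exists_time_wellPosed (P : ModParams d) (hs : 0 ≤ s) {q' : ℝ≥0∞}
    (hqq : P.q⁻¹ + q'⁻¹ = 1) (lam : ℂ) (k : ℕ) (hk : ((2 * k * d : ℕ) : ℝ≥0∞) < q')
    (hk1 : ((2 * k + 1 : ℕ) : ℝ≥0∞) ≤ q') (R : ℝ≥0) :
    ∃ T : ℝ, 0 < T ∧
      (∀ a ∈ dataBall P.g P.p P.q s R, ∃ u : ℝ → 𝓢'(Space d, ℂ),
        IsSolution P.g P.p P.q s lam k T a.1 a.2 u ∧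
        ∀ v : ℝ → 𝓢'(Space d, ℂ), IsSolution P.g P.p P.q s lam k T a.1 a.2 v →
          EqOn v u (Icc 0 T)) ∧
      ∃ L : ℝ≥0, ∀ a ∈ dataBall P.g P.p P.q s R, ∀ b ∈ dataBall P.g P.p P.q s R,
        ∀ u v : ℝ → 𝓢'(Space d, ℂ),
          IsSolution P.g P.p P.q s lam k T a.1 a.2 u → IsSolution P.g P.p P.q s lam k T b.1 b.2 v →
          ∀ t ∈ Icc 0 T, modNorm P.g P.p P.q s (u t - v t) ≤
            L * (modNorm P.g P.p P.q s (a.1 - b.1) + modNorm P.g P.p P.q (s - 1) (a.2 - b.2)) := by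
  obtain ⟨M, C, K, hC, hK, hCv, hKv⟩ := ModSp.exists_propagators P s
  obtain ⟨F, hL, hFv⟩ := ModSp.exists_nonlinearity P hs hqq lam k hk hk1
  have hF : Continuous F := by
    refine continuous_iff_continuousAt.2 fun u ↦ ?_
    obtain ⟨L, -, hL⟩ := hL (‖u‖ + 1)
    rw [ContinuousAt, tendsto_iff_norm_sub_tendsto_zero]
    have h1 : Tendsto (fun v ↦ L * ‖v - u‖) (𝓝 u) (𝓝 0) := by
      have : Continuous fun v ↦ L * ‖v - u‖ := by fun_prop
      simpa using this.tendsto u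
    refine squeeze_zero' (.of_forall fun _ ↦ norm_nonneg _) ?_ h1
    filter_upwards [continuous_norm.continuousAt.eventually_lt_const (lt_add_one ‖u‖)] with v hv
    exact hL v u hv.le (by linarith)
  obtain ⟨T, hT0, hT1, hex, huniq, A, hA0, hA⟩ := exists_wellPosed hC hK hF hL R.2
  have hiff := fun (x : ModSp P s) (y : ModSp P (s - 1)) (u : ℝ → ModSp P s) ↦
    ModSp.isSolution_iff_isMild (x := x) (y := y) (u := u) hK hCv hKv hF hFv hT1
  have hdata : ∀ a ∈ dataBall P.g P.p P.q s R, ∃ (x : ModSp P s) (y : ModSp P (s - 1)),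
      a = (x.val, y.val) ∧ ‖x‖ + ‖y‖ ≤ R := by
    rintro ⟨a, b⟩ ⟨ha, hb, hab⟩
    refine ⟨.mk a ha, .mk b hb, rfl, ?_⟩
    rw [← ENNReal.ofReal_le_ofReal_iff R.coe_nonneg, ENNReal.ofReal_add (norm_nonneg _) (norm_nonneg _),
      ModSp.ofReal_norm', ModSp.ofReal_norm', ENNReal.ofReal_coe_nnreal]
    exact hab
  refine ⟨T, hT0, fun a ha ↦ ?_, A.toNNReal, fun a ha b hb u v hu hv t ht ↦ ?_⟩
  · obtain ⟨x, y, rfl, hxy⟩ := hdata a ha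
    obtain ⟨u, hu⟩ := hex x y hxy
    refine ⟨fun t ↦ (u t).val, (hiff x y u).2 hu, fun v hv t ht ↦ ?_⟩
    obtain ⟨V, hV⟩ := hv.exists_eqOn
    have := (hiff x y V).1 (hv.congr hV)
    rw [hV ht]
    exact congrArg ModSp.val (huniq x y V u this hu ht)
  · obtain ⟨x, y, rfl, hxy⟩ := hdata a ha
    obtain ⟨x', y', rfl, hxy'⟩ := hdata b hb
    obtain ⟨U, hU⟩ := hu.exists_eqOn
    obtain ⟨V, hV⟩ := hv.exists_eqOn
    have h1 := hA x y x' y' U V hxy hxy' ((hiff x y U).1 (hu.congr hU))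
      ((hiff x' y' V).1 (hv.congr hV)) t ht
    rw [hU ht, hV ht]
    have e0 := ModSp.nrm_sub_eq (U t) (V t)
    have e1 := ModSp.nrm_sub_eq x x'
    have e2 := ModSp.nrm_sub_eq y y'
    simp only [ModParams.nrm] at e0 e1 e2
    rw [e0, e1, e2, ← ENNReal.ofReal_add (norm_nonneg _) (norm_nonneg _)]
    change _ ≤ ENNReal.ofReal A * _
    rw [← ENNReal.ofReal_mul hA0]
    exact ENNReal.ofReal_le_ofReal h1

end NLW

end

theorem theorem2 (d : ℕ) (hd : 1 ≤ d) (k : ℕ) (lam : ℂ) (s : ℝ) (hs : 0 ≤ s)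
    (p q q' : ℝ≥0∞) (hp : 1 ≤ p) (hqq' : q⁻¹ + q'⁻¹ = 1)
    (hq' : (2 * k * d : ℕ) < q') (hd1 : d = 1 → (2 * k + 1 : ℕ) ≤ q')
    (g : 𝓢(NLW.Space d, ℂ)) (hg : g ≠ 0) (R : ℝ≥0) :
    ∃ T : ℝ, 0 < T ∧
      (∀ a ∈ NLW.dataBall g p q s R, ∃ u : ℝ → 𝓢'(NLW.Space d, ℂ),
        NLW.IsSolution g p q s lam k T a.1 a.2 u ∧
        ∀ v : ℝ → 𝓢'(NLW.Space d, ℂ), NLW.IsSolution g p q s lam k T a.1 a.2 v →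
          EqOn v u (Icc 0 T)) ∧
      ∃ L : ℝ≥0, ∀ a ∈ NLW.dataBall g p q s R, ∀ b ∈ NLW.dataBall g p q s R,
        ∀ u v : ℝ → 𝓢'(NLW.Space d, ℂ),
          NLW.IsSolution g p q s lam k T a.1 a.2 u → NLW.IsSolution g p q s lam k T b.1 b.2 v →
          ∀ t ∈ Icc 0 T, NLW.modNorm g p q s (u t - v t) ≤
            L * (NLW.modNorm g p q s (a.1 - b.1) + NLW.modNorm g p q (s - 1) (a.2 - b.2)) := by
  have hq : 1 ≤ q := ENNReal.inv_le_one.1 (hqq' ▸ le_self_add)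
  have hk1 : ((2 * k + 1 : ℕ) : ℝ≥0∞) ≤ q' := by
    -- For `d ≥ 2` the condition `2k + 1 ≤ q'` is automatic: if `k ≥ 1` then `2k + 1 ≤ 2kd < q'`,
    -- and if `k = 0` it is `1 ≤ q'`.
    rcases hd.eq_or_lt with h | h
    · exact hd1 h.symm
    · rcases Nat.eq_zero_or_pos k with rfl | hk
      · have : 1 ≤ q' := ENNReal.inv_le_one.1 (hqq' ▸ le_add_self)
        simpa using this
      · refine le_trans (Nat.cast_le.2 ?_) hq'.le
        nlinarith
  exact NLW.exists_time_wellPosed ⟨g, p, q, hg, hp, hq⟩ hs hqq' lam k hq' hk1 R
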